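/- Let $p$ be a prime and let $\mathbb F$ be a perfect field of characteristic $p$. A restricted Lie algebra over $\mathbb F$ is a Lie algebra $L$ over $\mathbb F$ with a map $x\mapsto x^{[p]}$ on $L$ such that, for all $x,y\in L$ and $\alpha\in\mathbb F$: $(\operatorname{ad}x)^p=\operatorname{ad}(x^{[p]})$; $(\alpha x)^{[p]}=\alpha^p x^{[p]}$; and $(x+y)^{[p]}=x^{[p]}+y^{[p]}+\sum_{i=1}^{p-1}s_i(x,y)$, where $i\,s_i(x,y)$ is the coefficient of $\lambda^{i-1}$ in $\operatorname{ad}(\lambda x+y)^{p-1}(x)$. Its restricted enveloping algebra $u(L)$ is the quotient of the universal enveloping algebra $U(L)$ by the two-sided ideal generated by all $x^{[p]}-x^p$, $x\in L$. A Lie subalgebra or a Lie ideal is called restricted if it is closed under the map $x\mapsto x^{[p]}$. A restricted Lie algebra is cyclic if it is generated, as a restricted Lie algebra, by one element. $L$ is metacyclic if it has a restricted ideal $I$ such that both $I$ and $L/I$ are cyclic, and $L$ is $p$-nilpotent if for some positive integer $k$ the $k$-fold iterate of the map $x\mapsto x^{[p]}$ vanishes on $L$. Theorem. Let $L$ be a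 finite-dimensional, $p$-nilpotent, metacyclic restricted Lie algebra over $\mathbb F$, and let $H$ be any restricted Lie algebra over $\mathbb F$. If $u(L)\cong u(H)$ as associative $\mathbb F$-algebras, then $L\cong H$ as restricted Lie algebras; that is, there is an isomorphism of Lie algebras $e:L\to H$ over $\mathbb F$ with $e(x^{[p]})=e(x)^{[p]}$ for all $x\in L$. -/

import Mathlib

universe u v w

/-- `Jacobson's polynomials`: `jacobsonS F x y i` is the element `s_i(x, y)` of `L` for which
`i • s_i(x, y)` is the coefficient of `λ ^ (i - 1)` in `ad(λ x + y) ^ (p - 1) (x)`.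
The indeterminate `λ` is the (central) variable of the polynomial ring over `End_F(L)`. The
definition is used only for `1 ≤ i ≤ p - 1`, where `i` is invertible in `F`. (Taking `ad a b` to be
`⁅a, b⁆` or `⁅b, a⁆` makes no difference in characteristic `p`.) -/
noncomputable def jacobsonS (p : ℕ) (F : Type u) {L : Type v} [Field F] [LieRing L] [LieAlgebra F L]
    (x y : L) (i : ℕ) : L :=
  (i : F)⁻¹ • ((Polynomial.X * Polynomial.C (LieAlgebra.ad F L x) +
    Polynomial.C (LieAlgebra.ad F L y) : Polynomial (Module.End F L)) ^ (p - 1)).coeff (i - 1) x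

/-- A restricted Lie algebra structure (a `[p]`-mapping) on a Lie algebra `L` over a field `F`
(whose characteristic is `p` in all uses). -/
class RestrictedLieAlgebra (p : ℕ) (F : Type u) (L : Type v) [Field F] [LieRing L]
    [LieAlgebra F L] where
  /-- the `[p]`-mapping -/
  pMap : L → L
  ad_pMap : ∀ x : L, LieAlgebra.ad F L x ^ p = LieAlgebra.ad F L (pMap x)
  pMap_smul : ∀ (a : F) (x : L), pMap (a • x) = a ^ p • pMap x
  pMap_add : ∀ x y : L,
    pMap (x + y) = pMap x + pMap y + ∑ i ∈ Finset.Icc 1 (p - 1), jacobsonS p F x y i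

namespace RestrictedLieAlgebra

section Basic

variable (p : ℕ) (F : Type u) {L : Type v} [Field F] [LieRing L] [LieAlgebra F L]
  [RestrictedLieAlgebra p F L]

/-- `⟨X⟩_p`: the smallest Lie subalgebra that contains `X` and is closed under the
`[p]`-mapping. -/
def closure (X : Set L) : LieSubalgebra F L :=
  sInf {K : LieSubalgebra F L | X ⊆ K ∧ ∀ x ∈ K, pMap p F x ∈ K}

variable (L) in
/-- A restricted Lie algebra is cyclic if it is generated by one element. -/
def IsCyclic : Prop :=
  ∃ x : L, closure p F {x} = ⊤

variable (L) in
/-- `p`-nilpotency: some fixed iterate of the `[p]`-mapping is zero. -/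
def IsPNilpotent : Prop :=
  ∃ k : ℕ, 0 < k ∧ ∀ x : L, (pMap p F)^[k] x = 0

variable {F} in
/-- An ideal is restricted if it is closed under the `[p]`-mapping. -/
def IsRestrictedIdeal (I : LieIdeal F L) : Prop :=
  ∀ x ∈ I, pMap p F x ∈ I

end Basic

section Quotient

variable {p : ℕ} {F : Type u} {L : Type v} [Field F] [LieRing L] [LieAlgebra F L]

theorem coeff_mem (I : LieIdeal F L) (x y a : L) (ha : a ∈ I) (n k : ℕ) :
    ((Polynomial.X * Polynomial.C (LieAlgebra.ad F L x) +
      Polynomial.C (LieAlgebra.ad F L y) : Polynomial (Module.End F L)) ^ n).coeff k a ∈ I := by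
  induction n generalizing k with
  | zero =>
    rw [pow_zero, Polynomial.coeff_one]
    split_ifs
    · simpa using ha
    · simp
  | succ n ih =>
    rw [pow_succ', add_mul, mul_assoc, Polynomial.coeff_add, Polynomial.coeff_C_mul]
    cases k with
    | zero =>
      simpa using lie_mem_right F L I y _ (ih 0)
    | succ k =>
      rw [Polynomial.coeff_X_mul, Polynomial.coeff_C_mul]
      exact add_mem (lie_mem_right F L I x _ (ih k)) (lie_mem_right F L I y _ (ih (k + 1)))

theorem mk_coeff (I : LieIdeal F L) (x y a : L) (n k : ℕ) :
    (LieSubmodule.Quotient.mk (((Polynomial.X * Polynomial.C (LieAlgebra.ad F L x) +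
      Polynomial.C (LieAlgebra.ad F L y) : Polynomial (Module.End F L)) ^ n).coeff k a) : L ⧸ I) =
    ((Polynomial.X * Polynomial.C (LieAlgebra.ad F (L ⧸ I) (LieSubmodule.Quotient.mk x)) +
      Polynomial.C (LieAlgebra.ad F (L ⧸ I) (LieSubmodule.Quotient.mk y)) :
        Polynomial (Module.End F (L ⧸ I))) ^ n).coeff k (LieSubmodule.Quotient.mk a) := by
  induction n generalizing k with
  | zero =>
    rw [pow_zero, pow_zero, Polynomial.coeff_one, Polynomial.coeff_one]
    split_ifs <;> rfl
  | succ n ih =>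
    rw [pow_succ', pow_succ', add_mul, add_mul, mul_assoc, mul_assoc, Polynomial.coeff_add,
      Polynomial.coeff_C_mul, Polynomial.coeff_add, Polynomial.coeff_C_mul]
    cases k with
    | zero =>
      simp only [Polynomial.coeff_X_mul_zero, zero_add, Module.End.mul_apply,
        LieAlgebra.ad_apply, LieSubmodule.Quotient.mk_bracket, ih]
    | succ k =>
      simp only [Polynomial.coeff_X_mul, Polynomial.coeff_C_mul, LinearMap.add_apply,
        Module.End.mul_apply, LieAlgebra.ad_apply, ← ih]
      rfl

theorem mk_jacobsonS (I : LieIdeal F L) (x y : L) (i : ℕ) :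
    (LieSubmodule.Quotient.mk (jacobsonS p F x y i) : L ⧸ I) =
      jacobsonS p F (LieSubmodule.Quotient.mk x : L ⧸ I) (LieSubmodule.Quotient.mk y) i := by
  unfold jacobsonS
  rw [← mk_coeff]
  rfl

variable [RestrictedLieAlgebra p F L]

theorem pMap_congr (I : LieIdeal F L) (hI : IsRestrictedIdeal p I) (x y : L) (h : x - y ∈ I) :
    pMap p F x - pMap p F y ∈ I := by
  have h1 : pMap p F x = pMap p F ((x - y) + y) := by rw [sub_add_cancel]
  rw [h1, pMap_add, add_sub_right_comm, add_sub_cancel_right]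
  refine add_mem (hI _ h) (sum_mem fun i _ => ?_)
  exact I.smul_mem _ (coeff_mem I _ _ _ h _ _)

/-- The quotient of a restricted Lie algebra by a restricted ideal, with
`(x + I)^[p] = x^[p] + I`. -/
@[reducible] def quotient (I : LieIdeal F L) (hI : IsRestrictedIdeal p I) :
    RestrictedLieAlgebra p F (L ⧸ I) where
  pMap := Quotient.map' (pMap p F) fun x y h => by
    rw [Submodule.quotientRel_def] at h ⊢
    exact pMap_congr I hI x y h
  ad_pMap := by
    intro q
    induction q using Quotient.inductionOn' with | _ x
    ext r
    induction r using Quotient.inductionOn' with | _ y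
    have key : ∀ n : ℕ, (LieAlgebra.ad F (L ⧸ I) (LieSubmodule.Quotient.mk x) ^ n)
        (LieSubmodule.Quotient.mk y) =
          LieSubmodule.Quotient.mk ((LieAlgebra.ad F L x ^ n) y) := by
      intro n
      induction n with
      | zero => rfl
      | succ n ih =>
        rw [pow_succ', Module.End.mul_apply, ih, pow_succ', Module.End.mul_apply]
        rfl
    exact (key p).trans (congrArg _ (LinearMap.congr_fun (ad_pMap x) y))
  pMap_smul := by
    intro a q
    induction q using Quotient.inductionOn' with | _ x
    exact congrArg (LieSubmodule.Quotient.mk : L → L ⧸ I) (pMap_smul a x)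
  pMap_add := by
    intro q r
    induction q using Quotient.inductionOn' with | _ x
    induction r using Quotient.inductionOn' with | _ y
    have h := congrArg (LieSubmodule.Quotient.mk' I) (pMap_add (p := p) (F := F) x y)
    rw [map_add, map_add, map_sum] at h
    refine h.trans (congrArg _ (Finset.sum_congr rfl fun i _ => ?_))
    exact mk_jacobsonS I x y i

end Quotient

section Main

variable (p : ℕ) (F : Type u) (L : Type v) [Field F] [LieRing L] [LieAlgebra F L]
  [RestrictedLieAlgebra p F L]

/-- `L` is metacyclic if it has a cyclic restricted ideal `I` such that `L / I` is cyclic. -/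
def IsMetacyclic : Prop :=
  ∃ (I : LieIdeal F L) (hI : IsRestrictedIdeal p I),
    (∃ y : L, closure p F {y} = (I : LieSubalgebra F L)) ∧
      @IsCyclic p F (L ⧸ I) _ _ _ (quotient I hI)

/-- The relations `x^[p] = x^p` in the universal enveloping algebra `U(L)`. -/
inductive EnvelopingRel :
    UniversalEnvelopingAlgebra F L → UniversalEnvelopingAlgebra F L → Prop
  | pMap_compat (x : L) : EnvelopingRel (UniversalEnvelopingAlgebra.ι F (pMap p F x))
      (UniversalEnvelopingAlgebra.ι F x ^ p)

/-- The restricted enveloping algebra `u(L)`: the quotient of `U(L)` by the two-sided ideal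
generated by all `x^[p] - x^p`, `x ∈ L`. -/
abbrev EnvelopingAlgebra := RingQuot (EnvelopingRel p F L)

/-- `L` and `H` are isomorphic as restricted Lie algebras. -/
def IsIso (H : Type w) [LieRing H] [LieAlgebra F H] [RestrictedLieAlgebra p F H] : Prop :=
  ∃ e : L ≃ₗ⁅F⁆ H, ∀ x : L, e (pMap p F x) = pMap p F (e x)

end Main

end RestrictedLieAlgebra

namespace RestrictedLieAlgebra

/-! ### Identities in associative rings of characteristic `p`. -/

section AssociativeIdentities

/-! Let A = u(L), with augmentation ideal ω. The plan is to present any G with u(G) ≅ A by two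
generators and a few relations whose parameters can be read off inside A.

The restricted Poincaré-Birkhoff-Witt theorem gives dim u(G) = p ^ dim G and an embedding of G in
u(G) when G is finite-dimensional and p-nilpotent (`finrank_envelopingAlgebra`,
`envι_injective_of_finite`). Nothing of the kind is assumed of H, so the embedding of H is proved
separately (`envι_injective_of_isNilpotent`); it makes H finite-dimensional and p-nilpotent too.

A metacyclic p-nilpotent L is the sum of the orbits of two elements x, y under the p-map, and ⁅x, y⁆
lies in the orbit of y^[p] (`IsMetacyclic.exists_orbit`); hence all p-th powers are central. If L is
abelian, L and H are direct sums of two cyclic algebras, whose lengths follow from exponent and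
dimension (`isIso_of_lie_eq_zero`).

Otherwise z = ⁅x, y⁆ is central in A and zA is the ideal generated by all commutators; `IsFrame`
collects what A knows about z. For each G with u(G) ≅ A, the restricted ideal generated by
commutators is the preimage of zA and has dimension ν. Let r be the largest exponent for which some
h in G has h ^ p^r = z · unit. It is the same for all G, because an element of A with p^r-th power
in zA has a linear part in G with the same p^r-th power modulo zω
(`IsFrame.exists_linear_part_pow`). Completing such an h = y to a pair of generators gives ⁅x, y⁆ =
c y^[p]^r + ... and x^[p]^m = d y^[p]^s + ..., up to higher iterates of y (`IsFrame.exists_isLead`).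
Over a perfect field the higher terms are absorbed into the generators
(`IsLead.exists_isPresentation`), so m, n, r, s, c, d determine G.

Finally s is taken minimal over all such pairs in L and in H. The pair attaining it is viewed in A,
and its linear parts generate the other algebra. Since ω² is central modulo zω, replacing elements
by their linear parts preserves the leading coefficients (`IsFrame.isLead_of_relations`), and the
two presentations agree. -/

theorem cast_choose_pred {R : Type*} [Ring R] (p : ℕ) [Fact p.Prime] [CharP R p] {i : ℕ}
    (hi : i < p) : ((p - 1).choose i : R) = (-1) ^ i := by
  have hp := (Fact.out : p.Prime)
  induction i with
  | zero => simp
  | succ i ih =>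
    have h1 : (p.choose (i + 1) : R) = 0 :=
      (CharP.cast_eq_zero_iff R p _).2 (hp.dvd_choose_self (by omega) hi)
    obtain ⟨q, rfl⟩ : ∃ q, p = q + 1 := ⟨p - 1, by have := hp.pos; omega⟩
    rw [Nat.choose_succ_succ, Nat.cast_add] at h1
    have h2 := ih (by omega)
    simp only [Nat.add_sub_cancel] at h2 ⊢
    rw [h2] at h1
    rw [pow_succ, mul_neg_one]
    exact (neg_eq_of_add_eq_zero_right h1).symm

/-- The binomial coefficients of `p - 1` are alternating signs modulo `p`, and these cancel the
signs from the powers of `-y`. -/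
theorem sub_pow_pred_of_commute {R : Type*} [Ring R] (p : ℕ) [Fact p.Prime] [CharP R p] {x y : R}
    (h : Commute x y) : (x - y) ^ (p - 1) = ∑ i ∈ Finset.range p, x ^ i * y ^ (p - 1 - i) := by
  have hp := (Fact.out : p.Prime)
  have h1 : (-1 : R) ^ (p - 1) = 1 := by
    have h2 : (-1 : R) ^ (p - 1 + 1) = -1 := by
      rw [Nat.sub_add_cancel hp.one_le]; exact neg_one_pow_char R p
    rw [pow_succ, mul_neg_one] at h2
    exact neg_injective h2
  rw [sub_eq_add_neg, (h.neg_right).add_pow, Nat.sub_add_cancel hp.one_le]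
  refine Finset.sum_congr rfl fun i hi => ?_
  have hi' := Finset.mem_range.1 hi
  rw [cast_choose_pred p hi', neg_pow y, mul_assoc, mul_assoc]
  have h3 : (y ^ (p - 1 - i) : R) * (-1) ^ i = (-1) ^ i * y ^ (p - 1 - i) :=
    ((Commute.neg_one_right _).pow_right i).eq
  rw [h3, ← mul_assoc ((-1) ^ (p - 1 - i)), ← pow_add, Nat.sub_add_cancel (by omega), h1, one_mul]

/-- The inner derivation `a ↦ c * a - a * c` of an associative algebra. -/
def innerDer {R : Type*} [Ring R] (c : R) : Module.End ℤ R :=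
  LinearMap.mulLeft ℤ c - LinearMap.mulRight ℤ c

@[simp] theorem innerDer_apply {R : Type*} [Ring R] (c a : R) :
    innerDer c a = c * a - a * c := rfl

theorem charP_end (R : Type*) [Ring R] (p : ℕ) [CharP R p] : CharP (Module.End ℤ R) p where
  cast_eq_zero_iff x := by
    rw [← CharP.cast_eq_zero_iff R p]
    constructor
    · intro h
      have := LinearMap.congr_fun h (1 : R)
      simpa [Module.End.natCast_apply] using this
    · intro h
      ext a
      simp [Module.End.natCast_apply, h]

/-- Left and right multiplication by `c` commute. The resulting sum is what both the derivative of a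
`p`-th power and the first-order part of a `p`-th power over dual numbers produce. -/
theorem innerDer_pow_pred {R : Type*} [Ring R] (p : ℕ) [Fact p.Prime] [CharP R p] (c a : R) :
    (innerDer c ^ (p - 1)) a = ∑ i ∈ Finset.range p, c ^ i * a * c ^ (p - 1 - i) := by
  have := charP_end R p
  rw [innerDer, sub_pow_pred_of_commute p (LinearMap.commute_mulLeft_right (R := ℤ) c c)]
  simp [LinearMap.sum_apply, mul_assoc]

theorem innerDer_pow_char {R : Type*} [Ring R] (p : ℕ) [Fact p.Prime] [CharP R p] (c : R) :
    innerDer c ^ p = innerDer (c ^ p) := by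
  have := charP_end R p
  rw [innerDer, sub_pow_char_of_commute p (LinearMap.commute_mulLeft_right (R := ℤ) c c)]
  simp [innerDer]

open Polynomial in
theorem derivative_pow_eq_sum {R : Type*} [Ring R] (P : R[X]) (n : ℕ) :
    derivative (P ^ n) = ∑ i ∈ Finset.range n, P ^ i * derivative P * P ^ (n - 1 - i) := by
  induction n with
  | zero => simp
  | succ n ih =>
    rw [pow_succ, derivative_mul, ih, Finset.sum_range_succ, Finset.sum_mul]
    congr 1
    · refine Finset.sum_congr rfl fun i hi => ?_
      have := Finset.mem_range.1 hi
      rw [mul_assoc, ← pow_succ]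
      congr 2
      omega
    · simp

end AssociativeIdentities

/-! ### Jacobson's formula and representations in associative algebras. -/

section Representation

variable {p : ℕ} {F : Type u} {G : Type v} [Field F] [LieRing G] [LieAlgebra F G]
  {A : Type w} [Ring A] [Algebra F A]

-- Carries the polynomial that defines `jacobsonS` from endomorphisms of `G` to `A[X]`, where `ad`
-- becomes an honest commutator.
open Polynomial in
theorem map_coeff_ad_pow {j : G →ₗ[F] A} (hj : ∀ x y, j ⁅x, y⁆ = j x * j y - j y * j x)
    (x y g : G) (n k : ℕ) :
    j (((X * C (LieAlgebra.ad F G x) + C (LieAlgebra.ad F G y) : (Module.End F G)[X]) ^ n).coeff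
      k g) = ((innerDer (X * C (j x) + C (j y) : A[X]) ^ n) (C (j g))).coeff k := by
  induction n generalizing k with
  | zero =>
    simp only [pow_zero, coeff_one, Module.End.one_apply, coeff_C]
    split_ifs <;> simp
  | succ n ih =>
    rw [pow_succ', pow_succ', Module.End.mul_apply, innerDer_apply]
    generalize (X * C (LieAlgebra.ad F G x) + C (LieAlgebra.ad F G y) : (Module.End F G)[X]) ^ n = Q
      at ih ⊢
    generalize (innerDer (X * C (j x) + C (j y) : A[X]) ^ n) (C (j g)) = E at ih ⊢
    rw [add_mul, mul_assoc, coeff_add, coeff_C_mul, add_mul, mul_add, coeff_sub, coeff_add,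
      coeff_add, coeff_C_mul, coeff_mul_C, mul_assoc X, X_mul_C (j x), ← mul_assoc E]
    cases k with
    | zero => simp [hj, ih]
    | succ k =>
      simp only [coeff_X_mul, coeff_C_mul, coeff_mul_X, coeff_mul_C, LinearMap.add_apply,
        Module.End.mul_apply, LieAlgebra.ad_apply, map_add, hj, ih]
      abel

open Polynomial in
/-- Jacobson's formula for the `p`-th power of a sum. -/
theorem add_pow_char_eq [Fact p.Prime] [CharP F p] {j : G →ₗ[F] A}
    (hj : ∀ x y, j ⁅x, y⁆ = j x * j y - j y * j x) (x y : G) :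
    (j x + j y) ^ p = j x ^ p + j y ^ p + ∑ i ∈ Finset.Icc 1 (p - 1), j (jacobsonS p F x y i) := by
  have hp := (Fact.out : p.Prime)
  cases subsingleton_or_nontrivial A with
  | inl h => exact Subsingleton.elim _ _
  | inr h =>
  have : CharP A p := charP_of_injective_algebraMap (algebraMap F A).injective p
  have : CharP A[X] p := inferInstance
  set P : A[X] := X * C (j x) + C (j y) with hP
  have hdeg : P.natDegree ≤ 1 := by
    rw [hP]; compute_degree
  have hdegp : (P ^ p).natDegree < p + 1 :=
    Nat.lt_succ_of_le ((natDegree_pow_le_of_le p hdeg).trans (by simp))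
  let ev : A[X] →+* A := eval₂RingHom' (RingHom.id A) 1 (fun a => Commute.one_right a)
  have hev : ∀ Q : A[X], ev Q = Q.eval 1 := fun Q => rfl
  have h1 : (j x + j y) ^ p = (P ^ p).eval 1 := by
    rw [← hev, map_pow, hev, hP]
    simp [X_mul]
  -- Differentiating `P ^ p` in λ gives the sum of `P ^ i * j x * P ^ (p - 1 - i)`, which is `ad(P)
  -- ^ (p - 1) (j x)`; its coefficients define the `s_i`.
  have hder : ∀ k, (P ^ p).coeff (k + 1) * ((k : A) + 1) =
      j (((X * C (LieAlgebra.ad F G x) + C (LieAlgebra.ad F G y) : (Module.End F G)[X]) ^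
        (p - 1)).coeff k x) := by
    intro k
    rw [← coeff_derivative, derivative_pow_eq_sum, map_coeff_ad_pow hj, innerDer_pow_pred]
    have : derivative P = C (j x) := by rw [hP]; simp
    rw [this]
  have hc : ∀ i ∈ Finset.Icc 1 (p - 1), (P ^ p).coeff i = j (jacobsonS p F x y i) := by
    intro i hi
    obtain ⟨hi1, hi2⟩ := Finset.mem_Icc.1 hi
    obtain ⟨k, rfl⟩ : ∃ k, i = k + 1 := ⟨i - 1, by omega⟩
    have hne : ((k + 1 : ℕ) : F) ≠ 0 := by
      rw [Ne, CharP.cast_eq_zero_iff F p]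
      intro hd
      have := Nat.le_of_dvd (by omega) hd
      have := hp.pos
      omega
    rw [jacobsonS, map_smul, Nat.add_sub_cancel, ← hder]
    have : ((k : A) + 1) = algebraMap F A ((k + 1 : ℕ) : F) := by simp
    rw [this, ← Algebra.commutes, ← Algebra.smul_def, inv_smul_smul₀ hne]
  rw [h1, eval_eq_sum_range' hdegp, Finset.sum_range_succ, Finset.range_eq_Ico,
    Finset.sum_eq_sum_Ico_succ_bot hp.pos]
  simp only [one_pow, mul_one]
  have h0 : (P ^ p).coeff 0 = j y ^ p := by
    rw [← constantCoeff_apply, map_pow, hP]; simp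
  have hpp : (P ^ p).coeff p = j x ^ p := by
    have := coeff_pow_of_natDegree_le (m := p) hdeg
    rw [mul_one] at this
    rw [this, hP]; simp
  have hI : Finset.Ico (0 + 1) p = Finset.Icc 1 (p - 1) := by
    ext; simp; have := hp.pos; omega
  rw [h0, hpp, hI, Finset.sum_congr rfl hc]
  abel

variable [RestrictedLieAlgebra p F G]

variable (p) in
/-- `j` is a homomorphism of restricted Lie algebras from `G` to an associative algebra. -/
def IsRep (j : G →ₗ[F] A) : Prop :=
  (∀ x y, j ⁅x, y⁆ = j x * j y - j y * j x) ∧ ∀ x, j (pMap p F x) = j x ^ p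

/-- By Jacobson's formula `x ↦ j (x^[p])` and `x ↦ (j x) ^ p` deviate from additivity in the same
way, so agreement spreads from a spanning set to its span. -/
theorem IsRep.of_mem_span [Fact p.Prime] [CharP F p] {j : G →ₗ[F] A}
    (hj : ∀ x y, j ⁅x, y⁆ = j x * j y - j y * j x) {S : Set G} (hS : Submodule.span F S = ⊤)
    (h : ∀ x ∈ S, j (pMap p F x) = j x ^ p) : IsRep p j := by
  refine ⟨hj, fun x => ?_⟩
  have hx : x ∈ Submodule.span F S := hS ▸ Submodule.mem_top
  induction hx using Submodule.span_induction with
  | mem x hx => exact h x hx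
  | zero =>
    have h0 : pMap p F (0 : G) = 0 := by
      have := pMap_smul (p := p) (0 : F) (0 : G)
      simpa [(Fact.out : p.Prime).ne_zero] using this
    rw [h0, map_zero, zero_pow (Fact.out : p.Prime).ne_zero]
  | add x y _ _ hx hy =>
    rw [pMap_add, map_add, map_add, hx, hy, map_add, add_pow_char_eq hj, map_sum]
  | smul a x _ hx => rw [pMap_smul, map_smul, hx, map_smul, smul_pow]

end Representation

/-! ### The universal property of the restricted enveloping algebra. -/

section Envelope

attribute [local instance 100] LieRing.ofAssociativeRing

variable (p : ℕ) (F : Type u) (G : Type v) [Field F] [LieRing G] [LieAlgebra F G]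
  [RestrictedLieAlgebra p F G]

/-- The canonical map from `G` to its restricted enveloping algebra. -/
noncomputable def envι : G →ₗ[F] EnvelopingAlgebra p F G :=
  (RingQuot.mkAlgHom F (EnvelopingRel p F G)).toLinearMap ∘ₗ
    (UniversalEnvelopingAlgebra.ι F : G →ₗ⁅F⁆ UniversalEnvelopingAlgebra F G).toLinearMap

variable {G}

theorem envι_apply (x : G) : envι p F G x =
    RingQuot.mkAlgHom F (EnvelopingRel p F G) (UniversalEnvelopingAlgebra.ι F x) := rfl

theorem isRep_envι : IsRep p (envι p F G) := by
  refine ⟨fun x y => ?_, fun x => ?_⟩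
  · simp only [envι_apply, LieHom.map_lie, LieRing.of_associative_ring_bracket, map_sub, map_mul]
  · rw [envι_apply, envι_apply, ← map_pow]
    exact RingQuot.mkAlgHom_rel F (EnvelopingRel.pMap_compat x)

variable {p F} {A : Type w} [Ring A] [Algebra F A]

theorem exists_lift {f : G →ₗ[F] A} (hf : IsRep p f) :
    ∃ g : EnvelopingAlgebra p F G →ₐ[F] A, ∀ x, g (envι p F G x) = f x := by
  let f' : G →ₗ⁅F⁆ A := { f with
    map_lie' := fun {x y} => by
      rw [LieRing.of_associative_ring_bracket]; exact hf.1 x y }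
  have hf' : ∀ x, f' x = f x := fun x => rfl
  have h : ∀ ⦃a b⦄, EnvelopingRel p F G a b →
      UniversalEnvelopingAlgebra.lift F f' a = UniversalEnvelopingAlgebra.lift F f' b := by
    rintro _ _ ⟨x⟩
    rw [map_pow, UniversalEnvelopingAlgebra.lift_ι_apply, UniversalEnvelopingAlgebra.lift_ι_apply]
    exact hf.2 x
  refine ⟨RingQuot.liftAlgHom F ⟨UniversalEnvelopingAlgebra.lift F f', h⟩, fun x => ?_⟩
  rw [envι_apply, RingQuot.liftAlgHom_mkAlgHom_apply, UniversalEnvelopingAlgebra.lift_ι_apply]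
  rfl

theorem envHom_ext {g₁ g₂ : EnvelopingAlgebra p F G →ₐ[F] A}
    (h : ∀ x, g₁ (envι p F G x) = g₂ (envι p F G x)) : g₁ = g₂ := by
  apply RingQuot.ringQuot_ext'
  apply UniversalEnvelopingAlgebra.hom_ext
  ext x
  exact h x

/-- Lifting the canonical map into the subalgebra it generates and including back is the identity,
by uniqueness. -/
theorem adjoin_range_envι : Algebra.adjoin F (Set.range (envι p F G)) = ⊤ := by
  set S := Algebra.adjoin F (Set.range (envι p F G)) with hS
  let f : G →ₗ[F] S := (envι p F G).codRestrict (Subalgebra.toSubmodule S)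
    fun x => Algebra.subset_adjoin ⟨x, rfl⟩
  have hf : IsRep p f := by
    refine ⟨fun x y => Subtype.ext ?_, fun x => Subtype.ext ?_⟩
    · exact (isRep_envι p F).1 x y
    · exact (isRep_envι p F).2 x
  obtain ⟨g, hg⟩ := exists_lift hf
  have h : S.val.comp g = AlgHom.id F _ := envHom_ext fun x => by
    rw [AlgHom.comp_apply, hg]; rfl
  refine eq_top_iff.2 fun a _ => ?_
  have := congrArg (fun k : EnvelopingAlgebra p F G →ₐ[F] EnvelopingAlgebra p F G => k a) h
  simp only [AlgHom.comp_apply, AlgHom.id_apply] at this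
  rw [← this]
  exact (g a).2

variable (p) in
/-- `j : G → A` exhibits `A` as a restricted enveloping algebra of `G`. -/
def IsEnvelope (j : G →ₗ[F] A) : Prop :=
  ∃ e : EnvelopingAlgebra p F G ≃ₐ[F] A, ∀ x, e (envι p F G x) = j x

theorem isEnvelope_envι : IsEnvelope p (envι p F G) := ⟨AlgEquiv.refl, fun _ => rfl⟩

namespace IsEnvelope

variable {j : G →ₗ[F] A}

theorem isRep (h : IsEnvelope p j) : IsRep p j := by
  obtain ⟨e, he⟩ := h
  refine ⟨fun x y => ?_, fun x => ?_⟩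
  · simp only [← he, (isRep_envι p F).1, map_sub, map_mul]
  · simp only [← he, (isRep_envι p F).2, map_pow]

theorem exists_lift (h : IsEnvelope p j) {B : Type*} [Ring B] [Algebra F B] {f : G →ₗ[F] B}
    (hf : IsRep p f) : ∃ g : A →ₐ[F] B, ∀ x, g (j x) = f x := by
  obtain ⟨e, he⟩ := h
  obtain ⟨g, hg⟩ := RestrictedLieAlgebra.exists_lift hf
  exact ⟨g.comp e.symm.toAlgHom, fun x => by simp [← he, hg]⟩

theorem adjoin_eq_top (h : IsEnvelope p j) : Algebra.adjoin F (Set.range j) = ⊤ := by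
  obtain ⟨e, he⟩ := h
  have h1 : Set.range j = e.toAlgHom '' Set.range (envι p F G) := by
    rw [← Set.range_comp]; congr 1; funext x; exact (he x).symm
  rw [h1, ← AlgHom.map_adjoin, adjoin_range_envι, Algebra.map_top]
  exact (AlgHom.range_eq_top _).2 e.surjective

theorem trans (h : IsEnvelope p j) {B : Type*} [Ring B] [Algebra F B] (e : A ≃ₐ[F] B) :
    IsEnvelope p (e.toLinearMap ∘ₗ j) := by
  obtain ⟨e', he⟩ := h
  exact ⟨e'.trans e, fun x => by simp [he]⟩

end IsEnvelope

end Envelope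

/-! ### Elementary properties of the `p`-map and induced structures. -/

section Basic

variable {p : ℕ} {F : Type u} {G : Type v} [Field F] [LieRing G] [LieAlgebra F G]

theorem jacobsonS_eq_zero {x y : G} (h : ⁅y, x⁆ = 0) (hp : 2 ≤ p) (i : ℕ) :
    jacobsonS p F x y i = 0 := by
  have : ∀ k : ℕ, ((Polynomial.X * Polynomial.C (LieAlgebra.ad F G x) +
      Polynomial.C (LieAlgebra.ad F G y) : Polynomial (Module.End F G)) ^ (p - 1)).coeff k x
        = 0 := by
    intro k
    obtain ⟨q, hq⟩ : ∃ q, p - 1 = q + 1 := ⟨p - 2, by omega⟩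
    rw [hq, pow_succ, mul_add, Polynomial.X_mul, ← mul_assoc, Polynomial.coeff_add,
      Polynomial.coeff_mul_C]
    cases k with
    | zero => simp [h]
    | succ k => simp [h]
  rw [jacobsonS, this, smul_zero]

theorem map_jacobsonS {H : Type w} [LieRing H] [LieAlgebra F H] (f : G →ₗ⁅F⁆ H) (x y : G) (i : ℕ) :
    f (jacobsonS p F x y i) = jacobsonS p F (f x) (f y) i := by
  have : ∀ n k : ℕ, ∀ a, f (((Polynomial.X * Polynomial.C (LieAlgebra.ad F G x) +
      Polynomial.C (LieAlgebra.ad F G y) : Polynomial (Module.End F G)) ^ n).coeff k a) =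
      ((Polynomial.X * Polynomial.C (LieAlgebra.ad F H (f x)) +
      Polynomial.C (LieAlgebra.ad F H (f y)) : Polynomial (Module.End F H)) ^ n).coeff k (f a) := by
    intro n
    induction n with
    | zero =>
      intro k a
      rw [pow_zero, pow_zero, Polynomial.coeff_one, Polynomial.coeff_one]
      split_ifs <;> simp
    | succ n ih =>
      intro k a
      rw [pow_succ', add_mul, mul_assoc, Polynomial.coeff_add, Polynomial.coeff_C_mul,
        pow_succ', add_mul, mul_assoc, Polynomial.coeff_add, Polynomial.coeff_C_mul]
      cases k with
      | zero => simp [-Polynomial.X_mul_C, ih]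
      | succ k => simp [-Polynomial.X_mul_C, ih]
  rw [jacobsonS, jacobsonS, map_smul, this]

variable [RestrictedLieAlgebra p F G]

theorem pMap_add_of_lie_eq_zero [Fact p.Prime] {x y : G} (h : ⁅x, y⁆ = 0) :
    pMap p F (x + y) = pMap p F x + pMap p F y := by
  have h' : ⁅y, x⁆ = 0 := by rw [← lie_skew, h, neg_zero]
  rw [pMap_add, Finset.sum_eq_zero fun i _ => ?_, add_zero]
  exact jacobsonS_eq_zero h' (Fact.out : p.Prime).two_le i

variable (p F) in
@[simp] theorem pMap_zero [Fact p.Prime] : pMap p F (0 : G) = 0 := by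
  have := pMap_smul (p := p) (0 : F) (0 : G)
  simpa [(Fact.out : p.Prime).ne_zero] using this

variable (p F) in
@[simp] theorem pMap_iterate_zero [Fact p.Prime] (k : ℕ) : (pMap p F)^[k] (0 : G) = 0 :=
  Function.iterate_fixed (pMap_zero p F) k

theorem pMap_iterate_smul (k : ℕ) (a : F) (x : G) :
    (pMap p F)^[k] (a • x) = a ^ p ^ k • (pMap p F)^[k] x := by
  induction k generalizing a x with
  | zero => simp
  | succ k ih =>
    rw [Function.iterate_succ_apply, pMap_smul, ih, ← pow_mul, ← pow_succ',
      Function.iterate_succ_apply]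

theorem lie_pMap_left (x y : G) : ⁅pMap p F x, y⁆ = (LieAlgebra.ad F G x ^ p) y := by
  rw [ad_pMap]; rfl

theorem ad_iterate (k : ℕ) (x : G) :
    LieAlgebra.ad F G ((pMap p F)^[k] x) = LieAlgebra.ad F G x ^ p ^ k := by
  induction k with
  | zero => simp
  | succ k ih => rw [Function.iterate_succ_apply', ← ad_pMap, ih, ← pow_mul, ← pow_succ]

theorem lie_pMap_eq_zero_of_lie_lie [Fact p.Prime] {x y : G} (h : ⁅x, ⁅x, y⁆⁆ = 0) :
    ⁅pMap p F x, y⁆ = 0 := by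
  obtain ⟨q, hq⟩ : ∃ q, p = q + 2 := ⟨p - 2, by have := (Fact.out : p.Prime).two_le; omega⟩
  have : LieAlgebra.ad F G x ^ p = LieAlgebra.ad F G x ^ q * LieAlgebra.ad F G x ^ 2 := by
    rw [← pow_add, ← hq]
  rw [lie_pMap_left, this, Module.End.mul_apply, pow_two, Module.End.mul_apply,
    LieAlgebra.ad_apply, LieAlgebra.ad_apply, h, map_zero]

theorem lie_pMap_eq_zero [Fact p.Prime] {x y : G} (h : ⁅x, y⁆ = 0) : ⁅pMap p F x, y⁆ = 0 :=
  lie_pMap_eq_zero_of_lie_lie (by rw [h, lie_zero])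

theorem lie_iterate_eq_zero [Fact p.Prime] {x y : G} (h : ⁅x, y⁆ = 0) (i j : ℕ) :
    ⁅(pMap p F)^[i] x, (pMap p F)^[j] y⁆ = 0 := by
  have key : ∀ (x y : G) (i : ℕ), ⁅x, y⁆ = 0 → ⁅(pMap p F)^[i] x, y⁆ = 0 := by
    intro x y i h
    induction i with
    | zero => simpa using h
    | succ i ih => rw [Function.iterate_succ_apply']; exact lie_pMap_eq_zero ih
  have h1 := key x y i h
  rw [← lie_skew, neg_eq_zero] at h1
  have h2 := key _ _ j h1
  rw [← lie_skew, h2, neg_zero]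

variable (p F) in
theorem lie_iterate_self [Fact p.Prime] (x : G) (i j : ℕ) :
    ⁅(pMap p F)^[i] x, (pMap p F)^[j] x⁆ = 0 := lie_iterate_eq_zero (lie_self x) i j

theorem iterate_add_of_lie_eq_zero [Fact p.Prime] {x y : G} (h : ⁅x, y⁆ = 0) (k : ℕ) :
    (pMap p F)^[k] (x + y) = (pMap p F)^[k] x + (pMap p F)^[k] y := by
  induction k with
  | zero => rfl
  | succ k ih =>
    simp only [Function.iterate_succ_apply']
    rw [ih, pMap_add_of_lie_eq_zero (lie_iterate_eq_zero h k k)]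

theorem IsRep.map_iterate {A : Type*} [Ring A] [Algebra F A] {j : G →ₗ[F] A} (hj : IsRep p j)
    (k : ℕ) (x : G) : j ((pMap p F)^[k] x) = j x ^ p ^ k := by
  induction k with
  | zero => simp
  | succ k ih => rw [Function.iterate_succ_apply', hj.2, ih, ← pow_mul, ← pow_succ]

end Basic

section Comap

variable {p : ℕ} {F : Type u} {G : Type v} [Field F] [LieRing G] [LieAlgebra F G]
  [RestrictedLieAlgebra p F G] {N : Type w} [LieRing N] [LieAlgebra F N]

theorem map_ad_pow (f : N →ₗ⁅F⁆ G) (x y : N) (k : ℕ) :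
    f ((LieAlgebra.ad F N x ^ k) y) = (LieAlgebra.ad F G (f x) ^ k) (f y) := by
  induction k with
  | zero => simp
  | succ k ih =>
    rw [pow_succ', pow_succ', Module.End.mul_apply, Module.End.mul_apply, LieAlgebra.ad_apply,
      LieAlgebra.ad_apply, LieHom.map_lie, ih]

/-- The restricted structure induced along an injective homomorphism of Lie algebras whose range is
closed under the `[p]`-mapping. -/
@[reducible] def comap (f : N →ₗ⁅F⁆ G) (hf : Function.Injective f) (t : N → N)
    (ht : ∀ n, f (t n) = pMap p F (f n)) : RestrictedLieAlgebra p F N where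
  pMap := t
  ad_pMap x := by
    ext y
    apply hf
    rw [map_ad_pow, ad_pMap, ← ht]
    simp
  pMap_smul a x := hf (by rw [ht, map_smul, pMap_smul, map_smul, ht])
  pMap_add x y := hf (by
    simp only [ht, map_add, pMap_add, map_sum, map_jacobsonS])

end Comap

/-! ### The codimension-one step of the restricted Poincaré-Birkhoff-Witt theorem. -/

section Step

variable {p : ℕ} {F : Type u} [Field F]

theorem IsRep.map_ad_pow {G : Type v} [LieRing G] [LieAlgebra F G] [RestrictedLieAlgebra p F G]
    {A : Type w} [Ring A] [Algebra F A] {j : G →ₗ[F] A} (hj : IsRep p j) (x y : G) (k : ℕ) :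
    j ((LieAlgebra.ad F G x ^ k) y) = (innerDer (j x) ^ k) (j y) := by
  induction k with
  | zero => simp
  | succ k ih =>
    rw [pow_succ', pow_succ', Module.End.mul_apply, Module.End.mul_apply, LieAlgebra.ad_apply,
      hj.1, ih, innerDer_apply]

theorem isRep_zero [Fact p.Prime] {G : Type v} [LieRing G] [LieAlgebra F G] [RestrictedLieAlgebra p F G]
    {A : Type w} [Ring A] [Algebra F A] : IsRep p (0 : G →ₗ[F] A) :=
  ⟨fun _ _ => by simp, fun _ => by simp [(Fact.out : p.Prime).ne_zero]⟩

instance nontrivial_envelopingAlgebra [Fact p.Prime] {G : Type v} [LieRing G] [LieAlgebra F G]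
    [RestrictedLieAlgebra p F G] : Nontrivial (EnvelopingAlgebra p F G) := by
  obtain ⟨g, -⟩ := exists_lift (isRep_zero (p := p) (F := F) (G := G) (A := F))
  exact g.toRingHom.domain_nontrivial

variable {N : Type w} [LieRing N] [LieAlgebra F N] [RestrictedLieAlgebra p F N]

theorem inl_add_inr_pow {U : Type*} [Ring U] (a b : U) (k : ℕ) :
    (TrivSqZeroExt.inl a + TrivSqZeroExt.inr b : TrivSqZeroExt U U) ^ k =
      TrivSqZeroExt.inl (a ^ k) +
        TrivSqZeroExt.inr (∑ i ∈ Finset.range k, a ^ i * b * a ^ (k - 1 - i)) := by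
  induction k with
  | zero => simp
  | succ k ih =>
    rw [pow_succ, ih]
    ext
    · simp [pow_succ]
    · simp only [TrivSqZeroExt.snd_mul, TrivSqZeroExt.fst_add, TrivSqZeroExt.fst_inl,
        TrivSqZeroExt.fst_inr, TrivSqZeroExt.snd_add, TrivSqZeroExt.snd_inl, TrivSqZeroExt.snd_inr,
        add_zero, zero_add, smul_eq_mul, MulOpposite.smul_eq_mul_unop, MulOpposite.unop_op]
      rw [Finset.sum_range_succ, add_comm, Finset.sum_mul]
      congr 1
      · refine Finset.sum_congr rfl fun i hi => ?_
        have := Finset.mem_range.1 hi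
        rw [mul_assoc, ← pow_succ]
        congr 2
        omega
      · simp

/-- A derivation of `N` compatible with the `[p]`-mapping extends to `u(N)`. -/
theorem exists_derivation [Fact p.Prime] [CharP F p] (d : N →ₗ[F] N) (hd : ∀ n m, d ⁅n, m⁆ = ⁅d n, m⁆ + ⁅n, d m⁆)
    (hdp : ∀ n, d (pMap p F n) = (LieAlgebra.ad F N n ^ (p - 1)) (d n)) :
    ∃ δ : EnvelopingAlgebra p F N →ₗ[F] EnvelopingAlgebra p F N,
      (∀ a b, δ (a * b) = a * δ b + δ a * b) ∧ ∀ n, δ (envι p F N n) = envι p F N (d n) := by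
  set U := EnvelopingAlgebra p F N
  have hU : CharP U p := charP_of_injective_algebraMap (algebraMap F U).injective p
  have hι := isRep_envι (G := N) p F
  -- A derivation of `U` is the second component of an algebra map to the square-zero extension of
  -- `U` that is the identity on the first. Here `hdp` is exactly the compatibility with `p`-th
  -- powers.
  let f : N →ₗ[F] TrivSqZeroExt U U :=
    { toFun := fun n => TrivSqZeroExt.inl (envι p F N n) + TrivSqZeroExt.inr (envι p F N (d n))
      map_add' := fun a b => by ext <;> simp
      map_smul' := fun a b => by ext <;> simp }
  have hfa : ∀ n, f n = TrivSqZeroExt.inl (envι p F N n) + TrivSqZeroExt.inr (envι p F N (d n)) :=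
    fun n => rfl
  have hf : IsRep p f := by
    refine ⟨fun n m => ?_, fun n => ?_⟩
    · ext
      · simp [hfa, hι.1]
      · simp [hfa, hι.1, hd]; abel
    · rw [hfa, hfa, inl_add_inr_pow, hι.2, hdp, hι.map_ad_pow, innerDer_pow_pred]
  obtain ⟨g, hg⟩ := exists_lift hf
  have hfst : ∀ a, (g a).fst = a := by
    have : (TrivSqZeroExt.fstHom F U U).comp g = AlgHom.id F U :=
      envHom_ext fun n => by simp [hg, hfa]; rfl
    exact fun a => congrArg (fun k : U →ₐ[F] U => k a) this
  refine ⟨(TrivSqZeroExt.sndHom U U).restrictScalars F ∘ₗ g.toLinearMap, fun a b => ?_,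
    fun n => ?_⟩
  · simp [hfst]
  · simp [hg, hfa]

/-- The Leibniz rule says that the commutator of `δ` with left multiplication by `a` is left
multiplication by `δ a`. Now use `ad(δ) ^ p = ad(δ ^ p)`. -/
theorem derivation_pow_char [Fact p.Prime] [CharP F p] {U : Type*} [Ring U] [Algebra F U] [Nontrivial U] {δ : U →ₗ[F] U}
    (hδ : ∀ a b, δ (a * b) = a * δ b + δ a * b) (a b : U) :
    (δ ^ p) (a * b) = a * (δ ^ p) b + (δ ^ p) a * b := by
  have : CharP (Module.End F U) p :=
    charP_of_injective_algebraMap (algebraMap F (Module.End F U)).injective p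
  have key : ∀ k, (innerDer δ ^ k) (LinearMap.mulLeft F a) = LinearMap.mulLeft F ((δ ^ k) a) := by
    intro k
    induction k with
    | zero => simp
    | succ k ih =>
      rw [pow_succ', pow_succ', Module.End.mul_apply, Module.End.mul_apply, ih]
      ext b
      simp [hδ]
  have h := key p
  rw [innerDer_pow_char] at h
  have h' := LinearMap.congr_fun h b
  simp only [innerDer_apply, LinearMap.sub_apply, Module.End.mul_apply,
    LinearMap.mulLeft_apply] at h'
  rw [← h']
  abel

/-- The cyclic shift on `U ^ p` with the wrapped coordinate multiplied by `c` on the right. -/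
def twistedShift (F : Type u) [Field F] {U : Type*} [Ring U] [Algebra F U] (p : ℕ) (c : U) :
    (Fin p → U) →ₗ[F] (Fin p → U) where
  toFun m i := if i.1 = 0 then m ⟨p - 1, by have := i.2; omega⟩ * c
    else m ⟨i.1 - 1, by have := i.2; omega⟩
  map_add' m m' := by ext i; by_cases h : i.1 = 0 <;> simp [h, add_mul]
  map_smul' a m := by ext i; by_cases h : i.1 = 0 <;> simp [h]

/-- At most `p` shifts are made, so each coordinate wraps at most once and picks up at most one
factor `c`. -/
theorem twistedShift_pow {U : Type*} [Ring U] [Algebra F U] (c : U) (k : ℕ) (hk : k ≤ p)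
    (m : Fin p → U) (i : Fin p) : (twistedShift F p c ^ k) m i =
      if h : i.1 < k then m ⟨i.1 + p - k, by omega⟩ * c
        else m ⟨i.1 - k, by have := i.2; omega⟩ := by
  induction k generalizing i with
  | zero => simp
  | succ k ih =>
    rw [pow_succ', Module.End.mul_apply]
    by_cases h : i.1 = 0
    · simp only [twistedShift, LinearMap.coe_mk, AddHom.coe_mk, h, if_true] at ih ⊢
      rw [ih (by omega), dif_neg (by simp; omega)]
      simp
      congr 2
      ext; simp; omega
    · simp only [twistedShift, LinearMap.coe_mk, AddHom.coe_mk, h, if_false] at ih ⊢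
      rw [ih (by omega)]
      by_cases h2 : i.1 < k + 1
      · rw [dif_pos (by simp; omega), dif_pos h2]
        congr 2
        ext; simp; omega
      · rw [dif_neg (by simp; omega), dif_neg h2]
        congr 1
        ext; simp; omega

theorem twistedShift_pow_char {U : Type*} [Ring U] [Algebra F U] (c : U)
    (m : Fin p → U) (i : Fin p) : (twistedShift F p c ^ p) m i = m i * c := by
  rw [twistedShift_pow c p le_rfl, dif_pos i.2]
  congr 2
  ext; simp

end Step

section Step

variable {p : ℕ} [Fact p.Prime] {F : Type u} [Field F] [CharP F p]
  {N : Type w} [LieRing N] [LieAlgebra F N] [RestrictedLieAlgebra p F N]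
  {G : Type v} [LieRing G] [LieAlgebra F G] [RestrictedLieAlgebra p F G]

/-- The Poincaré-Birkhoff-Witt theorem for a restricted ideal of codimension one that contains the
`p`-th power of a complementary element. -/
theorem envι_injective_of_codim_one (f : N →ₗ⁅F⁆ G) (hf : Function.Injective f)
    (hft : ∀ n, f (pMap p F n) = pMap p F (f n)) (x : G) (hx : ∀ n, f n ≠ x)
    (hspan : ∀ g, ∃ (a : F) (n : N), g = a • x + f n) (hid : ∀ n, ∃ n', f n' = ⁅x, f n⁆)
    (hxp : ∃ n, f n = pMap p F x) :
    (Function.Injective (envι p F N) → Function.Injective (envι p F G)) ∧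
      Nonempty ((Fin p → EnvelopingAlgebra p F N) ≃ₗ[F] EnvelopingAlgebra p F G) := by
  have hp := (Fact.out : p.Prime)
  obtain ⟨ν, hν⟩ := hxp
  set U := EnvelopingAlgebra p F N with hUdef
  set ι := envι p F N with hιdef
  have hι : IsRep p ι := isRep_envι p F
  -- the derivation of `N` induced by `x`
  choose d' hd' using hid
  let d : N →ₗ[F] N :=
    { toFun := d'
      map_add' := fun a b => hf (by simp [hd'])
      map_smul' := fun a b => hf (by simp [hd']) }
  have hd : ∀ n, f (d n) = ⁅x, f n⁆ := hd'
  have hdlie : ∀ n m, d ⁅n, m⁆ = ⁅d n, m⁆ + ⁅n, d m⁆ := fun n m => hf (by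
    rw [hd, map_add, LieHom.map_lie, LieHom.map_lie, LieHom.map_lie, hd, hd, leibniz_lie])
  have hpred : ∃ q, p = q + 1 := ⟨p - 1, by have := hp.pos; omega⟩
  have hdp : ∀ n, d (pMap p F n) = (LieAlgebra.ad F N n ^ (p - 1)) (d n) := fun n => hf (by
    rw [hd, RestrictedLieAlgebra.map_ad_pow, hd, hft, ← lie_skew, lie_pMap_left]
    obtain ⟨q, hq⟩ := hpred
    rw [hq, Nat.add_sub_cancel, pow_succ, Module.End.mul_apply, LieAlgebra.ad_apply, ← map_neg,
      lie_skew])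
  obtain ⟨δ, hδ, hδι⟩ := exists_derivation d hdlie hdp
  have hdν : d ν = 0 := hf (by
    rw [hd, hν, map_zero, ← lie_skew, lie_pMap_eq_zero (lie_self x), neg_zero])
  have hδν : δ (ι ν) = 0 := by rw [hδι, hdν, map_zero]
  have hδ1 : δ 1 = 0 := by
    have := hδ 1 1
    simpa using this
  have hdpow : ∀ k n, f ((d ^ k) n) = (LieAlgebra.ad F G x ^ k) (f n) := by
    intro k n
    induction k with
    | zero => simp
    | succ k ih =>
      rw [pow_succ', pow_succ', Module.End.mul_apply, Module.End.mul_apply, hd, ih]; rfl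
  have hδpow : ∀ k n, (δ ^ k) (ι n) = ι ((d ^ k) n) := by
    intro k n
    induction k with
    | zero => simp
    | succ k ih => rw [pow_succ', pow_succ', Module.End.mul_apply, Module.End.mul_apply, ih, hδι]
  -- Both sides are derivations of `U` (the left one because of the characteristic), so they need
  -- only agree on `N`, where this is `(ad x) ^ p = ad (x^[p])`.
  have hδp : ∀ a, (δ ^ p) a = ι ν * a - a * ι ν := by
    intro a
    have ha : a ∈ Algebra.adjoin F (Set.range ι) := by rw [hιdef, adjoin_range_envι]; trivial
    induction ha using Algebra.adjoin_induction with
    | mem a ha =>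
      obtain ⟨n, rfl⟩ := ha
      rw [hδpow, ← hι.1]
      congr 1
      apply hf
      rw [hdpow, ad_pMap, LieHom.map_lie, hν]; rfl
    | algebraMap r =>
      rw [← Algebra.commutes, sub_self, Algebra.algebraMap_eq_smul_one, map_smul]
      have h1 : ∀ k, (δ ^ (k + 1)) 1 = 0 := fun k => by
        rw [pow_succ, Module.End.mul_apply, hδ1, map_zero]
      have h2 := h1 (p - 1)
      rw [Nat.sub_add_cancel hp.one_le] at h2
      rw [h2, smul_zero]
    | add a b _ _ ha hb => rw [map_add, ha, hb]; noncomm_ring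
    | mul a b _ _ ha hb => rw [derivation_pow_char hδ, ha, hb]; noncomm_ring
  -- the operators
  let Dh : Module.End F (Fin p → U) := δ.compLeft (Fin p)
  let T : Module.End F (Fin p → U) := twistedShift F p (ι ν)
  let Lm : U →ₐ[F] Module.End F (Fin p → U) :=
    { toFun := fun a => (LinearMap.mulLeft F a).compLeft (Fin p)
      map_one' := LinearMap.ext fun m => funext fun i => one_mul _
      map_mul' := fun a b => LinearMap.ext fun m => funext fun i => mul_assoc _ _ _
      map_zero' := LinearMap.ext fun m => funext fun i => zero_mul _
      map_add' := fun a b => LinearMap.ext fun m => funext fun i => add_mul _ _ _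
      commutes' := fun r => LinearMap.ext fun m => funext fun i =>
        (Algebra.smul_def r (m i)).symm }
  have hLm : ∀ a (m : Fin p → U) i, Lm a m i = a * m i := fun a m i => rfl
  have hDh : ∀ (m : Fin p → U) i, Dh m i = δ (m i) := fun m i => rfl
  have hTs : ∀ (m : Fin p → U) (i : Fin p), T m i = if i.1 = 0 then m ⟨p - 1, by have := i.2; omega⟩ * ι ν
    else m ⟨i.1 - 1, by have := i.2; omega⟩ := fun m i => rfl
  have hcomm : Commute Dh T := by
    refine LinearMap.ext fun m => funext fun i => ?_
    rw [Module.End.mul_apply, Module.End.mul_apply, hDh, hTs, hTs]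
    by_cases h : i.1 = 0
    · rw [if_pos h, if_pos h, hδ, hδν, mul_zero, zero_add, hDh]
    · rw [if_neg h, if_neg h, hDh]
  have hDhp : ∀ k (m : Fin p → U) i, (Dh ^ k) m i = (δ ^ k) (m i) := by
    intro k m i
    induction k generalizing m with
    | zero => simp
    | succ k ih => rw [pow_succ, pow_succ, Module.End.mul_apply, Module.End.mul_apply, ih, hDh]
  have : Nonempty (Fin p) := ⟨⟨0, hp.pos⟩⟩
  have hcharM : CharP (Module.End F (Fin p → U)) p :=
    charP_of_injective_algebraMap (algebraMap F (Module.End F (Fin p → U))).injective p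
  -- Think of `Fin p → U` as the sum of the `U ξ^i`, ξ being the image of `x`: `Dh` differentiates
  -- coefficients and `T` multiplies by ξ on the right. They commute, so the `p`-th power is
  -- commutation with ν plus right multiplication by ν, that is, left multiplication by ν.
  have hXp : (Dh + T) ^ p = Lm (ι ν) := by
    rw [add_pow_char_of_commute p hcomm]
    refine LinearMap.ext fun m => funext fun i => ?_
    rw [LinearMap.add_apply, Pi.add_apply, hDhp, hδp, hLm]
    have : (T ^ p) m i = m i * ι ν := twistedShift_pow_char (ι ν) m i
    rw [this, sub_add_cancel]
  have hXL : ∀ a, (Dh + T) * Lm a - Lm a * (Dh + T) = Lm (δ a) := by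
    intro a
    refine LinearMap.ext fun m => funext fun i => ?_
    simp only [LinearMap.sub_apply, Module.End.mul_apply, LinearMap.add_apply, Pi.sub_apply,
      Pi.add_apply, hLm, hDh, hδ, hTs]
    by_cases h : i.1 = 0
    · rw [if_pos h, if_pos h]; noncomm_ring
    · rw [if_neg h, if_neg h]; noncomm_ring
  -- the representation
  let e₀ : (F × N) →ₗ[F] G := (LinearMap.toSpanSingleton F G x).coprod f.toLinearMap
  have he₀ : ∀ (a : F) n, e₀ (a, n) = a • x + f n := fun a n => rfl
  have he₀i : Function.Injective e₀ := by
    rw [← LinearMap.ker_eq_bot, LinearMap.ker_eq_bot']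
    rintro ⟨a, n⟩ h
    rw [he₀] at h
    by_cases ha : a = 0
    · subst ha
      rw [zero_smul, zero_add] at h
      rw [hf (h.trans (map_zero f).symm)]; rfl
    · refine absurd ?_ (hx (-(a⁻¹ • n)))
      rw [map_neg, map_smul, neg_eq_iff_add_eq_zero]
      have := congrArg (a⁻¹ • ·) h
      simpa [smul_add, smul_smul, inv_mul_cancel₀ ha, add_comm] using this
  have he₀s : Function.Surjective e₀ := fun g => by
    obtain ⟨a, n, h⟩ := hspan g
    exact ⟨(a, n), h.symm⟩
  let e : (F × N) ≃ₗ[F] G := LinearEquiv.ofBijective e₀ ⟨he₀i, he₀s⟩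
  let ρ : G →ₗ[F] Module.End F (Fin p → U) :=
    ((LinearMap.toSpanSingleton F _ (Dh + T)).coprod (Lm.toLinearMap ∘ₗ ι)) ∘ₗ e.symm.toLinearMap
  have hρ : ∀ (a : F) n, ρ (a • x + f n) = a • (Dh + T) + Lm (ι n) := by
    intro a n
    have : e.symm (a • x + f n) = (a, n) := by
      rw [LinearEquiv.symm_apply_eq]; rfl
    simp only [ρ, LinearMap.comp_apply, LinearEquiv.coe_coe, this]
    simp
  have hρx : ρ x = Dh + T := by simpa using hρ 1 0
  have hρf : ∀ n, ρ (f n) = Lm (ι n) := fun n => by simpa using hρ 0 n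
  have hρrep : IsRep p ρ := by
    have hS : Submodule.span F (insert x (Set.range f)) = ⊤ := by
      refine eq_top_iff.2 fun g _ => ?_
      obtain ⟨a, n, rfl⟩ := hspan g
      exact add_mem (Submodule.smul_mem _ _ (Submodule.subset_span (Set.mem_insert _ _)))
        (Submodule.subset_span (Set.mem_insert_of_mem _ ⟨n, rfl⟩))
    refine IsRep.of_mem_span (fun g h => ?_) hS ?_
    · obtain ⟨a, n, rfl⟩ := hspan g
      obtain ⟨b, m, rfl⟩ := hspan h
      have h1 : ⁅a • x + f n, b • x + f m⁆ = f (a • d m - b • d n + ⁅n, m⁆) := by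
        simp only [map_add, map_sub, map_smul, hd, LieHom.map_lie, lie_add, add_lie, smul_lie,
          lie_smul, lie_self, smul_zero, zero_add, ← lie_skew (f n) x]
        simp only [smul_neg]
        abel
      have h2 := hXL (ι m)
      have h3 := hXL (ι n)
      rw [hδι] at h2 h3
      rw [h1, hρf, hρ, hρ, map_add, map_sub, map_smul, map_smul, map_add, map_sub, map_smul,
        map_smul, ← h2, ← h3, hι.1, map_sub, map_mul, map_mul]
      generalize Dh + T = X
      simp only [add_mul, mul_add, smul_mul_assoc, mul_smul_comm]
      module
    · rintro _ (rfl | ⟨n, rfl⟩)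
      · rw [hρx, hXp, ← hν, hρf]
      · rw [← hft, hρf, hρf, hι.2, map_pow]
  obtain ⟨g, hg⟩ := exists_lift hρrep
  have hfrep : IsRep p (envι p F G ∘ₗ f.toLinearMap) :=
    ⟨fun n m => by simp [(isRep_envι (G := G) p F).1],
      fun n => by simp [hft, (isRep_envι (G := G) p F).2]⟩
  obtain ⟨Fu, hFu⟩ := exists_lift hfrep
  have hFu' : ∀ n, Fu (ι n) = envι p F G (f n) := hFu
  have hgF : ∀ a, g (Fu a) = Lm a := by
    have : g.comp Fu = Lm := envHom_ext fun n => by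
      rw [AlgHom.comp_apply, hFu', hg, hρf]
    exact fun a => congrArg (fun k : U →ₐ[F] _ => k a) this
  set ξ := envι p F G x
  have hgξ : g ξ = Dh + T := by rw [hg, hρx]
  -- `e0` plays the role of 1: its images under powers of ξ are the standard basis vectors, so
  -- acting on it recovers the coefficients of a sum of `a_i ξ^i`.
  let e0 : Fin p → U := Pi.single ⟨0, hp.pos⟩ 1
  have hXe : ∀ k (hk : k < p), ((Dh + T) ^ k) e0 = Pi.single ⟨k, hk⟩ 1 := by
    intro k hk
    induction k with
    | zero => rfl
    | succ k ih =>
      rw [pow_succ', Module.End.mul_apply, ih (by omega)]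
      ext i
      rw [LinearMap.add_apply, Pi.add_apply, hDh, hTs]
      have hz : ∀ j : Fin p, δ ((Pi.single ⟨k, by omega⟩ 1 : Fin p → U) j) = 0 := by
        intro j
        by_cases h : j = ⟨k, by omega⟩
        · rw [h, Pi.single_eq_same, hδ1]
        · rw [Pi.single_eq_of_ne h, map_zero]
      rw [hz, zero_add]
      by_cases h : i.1 = 0
      · rw [if_pos h, Pi.single_eq_of_ne (by simp [Fin.ext_iff]; omega), zero_mul,
          Pi.single_eq_of_ne (by simp [Fin.ext_iff]; omega)]
      · rw [if_neg h]
        by_cases h2 : i.1 = k + 1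
        · have : i = ⟨k + 1, hk⟩ := Fin.ext h2
          subst this
          simp
        · rw [Pi.single_eq_of_ne (by simp [Fin.ext_iff]; omega),
            Pi.single_eq_of_ne (by simp [Fin.ext_iff]; omega)]
  let φ : (Fin p → U) →ₗ[F] EnvelopingAlgebra p F G :=
    ∑ i : Fin p, LinearMap.mulRight F (ξ ^ i.1) ∘ₗ Fu.toLinearMap ∘ₗ LinearMap.proj i
  have hφ : ∀ m, φ m = ∑ i : Fin p, Fu (m i) * ξ ^ i.1 := fun m => by
    simp [φ, LinearMap.sum_apply]
  have hev : ∀ m, g (φ m) e0 = m := by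
    intro m
    rw [hφ, map_sum, LinearMap.sum_apply]
    conv_rhs => rw [← Finset.univ_sum_single m]
    refine Finset.sum_congr rfl fun i _ => ?_
    rw [map_mul, map_pow, hgF, hgξ, Module.End.mul_apply, hXe i.1 i.2]
    ext k
    rw [hLm]
    by_cases h : k = i
    · subst h; simp
    · rw [Pi.single_eq_of_ne h, Pi.single_eq_of_ne h, mul_zero]
  have hφi : Function.Injective φ := fun m m' h => by
    rw [← hev m, h, hev]
  have hξF : ∀ a, ξ * Fu a - Fu a * ξ = Fu (δ a) := by
    intro a
    have ha : a ∈ Algebra.adjoin F (Set.range ι) := by rw [hιdef, adjoin_range_envι]; trivial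
    induction ha using Algebra.adjoin_induction with
    | mem a ha =>
      obtain ⟨n, rfl⟩ := ha
      rw [hδι, hFu', hFu', hd, (isRep_envι (G := G) p F).1]
    | algebraMap r =>
      rw [AlgHom.commutes, ← Algebra.commutes, sub_self, Algebra.algebraMap_eq_smul_one, map_smul,
        hδ1, smul_zero, map_zero]
    | add a b _ _ ha hb => rw [map_add, map_add, map_add, ← ha, ← hb]; noncomm_ring
    | mul a b _ _ ha hb =>
      rw [map_mul, hδ, map_add, map_mul, map_mul, ← ha, ← hb]; noncomm_ring
  have hξp : ξ ^ p = Fu (ι ν) := by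
    rw [hFu', hν, (isRep_envι (G := G) p F).2]
  have hmem : ∀ a k, k ≤ p → Fu a * ξ ^ k ∈ LinearMap.range φ := by
    intro a k hk
    rcases hk.lt_or_eq with hk | rfl
    · refine ⟨Pi.single ⟨k, hk⟩ a, ?_⟩
      rw [hφ, Finset.sum_eq_single ⟨k, hk⟩]
      · simp
      · intro b _ hb
        rw [Pi.single_eq_of_ne hb, map_zero, zero_mul]
      · simp
    · refine ⟨Pi.single ⟨0, hp.pos⟩ (a * ι ν), ?_⟩
      rw [hφ, Finset.sum_eq_single ⟨0, hp.pos⟩]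
      · simp [hξp]
      · intro b _ hb
        rw [Pi.single_eq_of_ne hb, map_zero, zero_mul]
      · simp
  -- The range contains 1 and is a left ideal: ξ moves to the right past coefficients at the cost of
  -- δ, and `ξ ^ p` is a coefficient.
  have hφs : Function.Surjective φ := by
    have hξ : ∀ b ∈ LinearMap.range φ, ξ * b ∈ LinearMap.range φ := by
      rintro _ ⟨m, rfl⟩
      rw [hφ, Finset.mul_sum]
      refine sum_mem fun i _ => ?_
      have : ξ * (Fu (m i) * ξ ^ i.1) = Fu (m i) * ξ ^ (i.1 + 1) + Fu (δ (m i)) * ξ ^ i.1 := by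
        rw [← hξF, pow_succ']; noncomm_ring
      rw [this]
      exact add_mem (hmem _ _ i.2) (hmem _ _ i.2.le)
    have hFr : ∀ a, ∀ b ∈ LinearMap.range φ, Fu a * b ∈ LinearMap.range φ := by
      rintro a _ ⟨m, rfl⟩
      rw [hφ, Finset.mul_sum]
      refine sum_mem fun i _ => ?_
      rw [← mul_assoc, ← map_mul]
      exact hmem _ _ i.2.le
    have hall : ∀ a : EnvelopingAlgebra p F G, ∀ b ∈ LinearMap.range φ, a * b ∈ LinearMap.range φ := by
      intro a
      have ha : a ∈ Algebra.adjoin F (Set.range (envι p F G)) := by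
        rw [adjoin_range_envι]; trivial
      induction ha using Algebra.adjoin_induction with
      | mem a ha =>
        obtain ⟨y, rfl⟩ := ha
        obtain ⟨c, n, rfl⟩ := hspan y
        intro b hb
        rw [map_add, map_smul, add_mul, smul_mul_assoc, ← hFu']
        exact add_mem (Submodule.smul_mem _ _ (hξ b hb)) (hFr _ b hb)
      | algebraMap r =>
        intro b hb
        rw [← Algebra.smul_def]
        exact Submodule.smul_mem _ _ hb
      | add a b _ _ ha hb => intro c hc; rw [add_mul]; exact add_mem (ha c hc) (hb c hc)
      | mul a b _ _ ha hb => intro c hc; rw [mul_assoc]; exact ha _ (hb c hc)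
    intro a
    have h1 : (1 : EnvelopingAlgebra p F G) ∈ LinearMap.range φ := by
      simpa using hmem 1 0 (Nat.zero_le _)
    simpa using hall a 1 h1
  refine ⟨fun hN => ?_, ⟨LinearEquiv.ofBijective φ ⟨hφi, hφs⟩⟩⟩
  rw [← LinearMap.ker_eq_bot, LinearMap.ker_eq_bot']
  intro y hy
  obtain ⟨a, n, rfl⟩ := hspan y
  have h1 : (a • (Dh + T) + Lm (ι n)) e0 = 0 := by rw [← hρ, ← hg, hy, map_zero]; rfl
  have h2 : (Dh + T) e0 = Pi.single ⟨1, hp.one_lt⟩ 1 := by simpa using hXe 1 hp.one_lt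
  rw [LinearMap.add_apply, LinearMap.smul_apply, h2] at h1
  have h3 := congrFun h1 ⟨1, hp.one_lt⟩
  have h4 := congrFun h1 ⟨0, hp.pos⟩
  simp only [Pi.add_apply, Pi.smul_apply, hLm, e0, Pi.zero_apply] at h3 h4
  rw [Pi.single_eq_same, Pi.single_eq_of_ne (by simp), mul_zero, add_zero] at h3
  rw [Pi.single_eq_same, Pi.single_eq_of_ne (by simp), smul_zero, mul_one, zero_add] at h4
  have ha : a = 0 := (smul_eq_zero.1 h3).resolve_right one_ne_zero
  rw [ha, hN (h4.trans (map_zero _).symm), zero_smul, map_zero, add_zero]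

end Step

/-! ### A commutative algebra with many roots and with nilpotents. -/

section RootAlgebra

open Polynomial in
/-- Over every field there is a nonzero commutative algebra that is not reduced and in which every
nonconstant monic polynomial has a root. -/
theorem exists_algebra_with_roots (F : Type u) [Field F] (p : ℕ) (hp : 2 ≤ p) :
    ∃ (A : Type u) (_ : CommRing A) (_ : Algebra F A), Nontrivial A ∧
      (∀ g : A[X], g.Monic → 0 < g.natDegree → ∃ a, g.eval a = 0) ∧ ∃ a : A, a ≠ 0 ∧ a ^ p = 0 := by
  -- The algebra is `O` modulo `X`. Monic polynomials lift to monic ones, which have roots in `O`. A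
  -- `p`-th root of `X` becomes a nonzero nilpotent, because `X` stays a nonunit in an integral
  -- extension.
  let Ω := AlgebraicClosure (FractionRing F[X])
  let O := integralClosure F[X] Ω
  have hinj : Function.Injective (algebraMap F[X] O) := by
    have : Function.Injective (algebraMap F[X] Ω) := by
      rw [IsScalarTower.algebraMap_eq F[X] (FractionRing F[X]) Ω]
      exact (algebraMap (FractionRing F[X]) Ω).injective.comp (IsFractionRing.injective _ _)
    intro a b h
    exact this (congrArg Subtype.val h)
  have hroot : ∀ g : O[X], g.Monic → 0 < g.natDegree → ∃ a, g.eval a = 0 := by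
    intro g hg hd
    obtain ⟨a, ha⟩ := IsAlgClosed.exists_root (g.map (algebraMap O Ω)) (by
      rw [hg.degree_map]
      exact fun h => by rw [natDegree_eq_zero_iff_degree_le_zero.2 h.le] at hd; omega)
    have hai : IsIntegral O a := ⟨g, hg, by rwa [IsRoot, eval_map] at ha⟩
    have hai' : IsIntegral F[X] a := isIntegral_trans a hai
    refine ⟨⟨a, hai'⟩, ?_⟩
    apply Subtype.val_injective
    rw [IsRoot, eval_map] at ha
    have h2 := eval₂_hom (p := g) (algebraMap O Ω) (⟨a, hai'⟩ : O)
    have h3 : (algebraMap O Ω) (⟨a, hai'⟩ : O) = a := rfl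
    rw [h3, ha] at h2
    exact h2.symm
  let ξ : O := algebraMap F[X] O X
  have hξ : ¬ IsUnit ξ := by
    intro h
    have hint : (algebraMap F[X] O).IsIntegral := fun a =>
      (integralClosure.AlgebraIsIntegral (R := F[X]) (A := Ω)).isIntegral a
    have : IsUnit (X : F[X]) := (hint.isLocalHom hinj).map_nonunit X h
    exact not_isUnit_X this
  let I : Ideal O := Ideal.span {ξ}
  have hmem : ∀ a, a ∈ I ↔ ∃ b, a = ξ * b := fun a => by
    rw [Ideal.mem_span_singleton]; rfl
  refine ⟨O ⧸ I, inferInstance, inferInstance, ?_, ?_, ?_⟩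
  · rw [Ideal.Quotient.nontrivial_iff]
    rwa [Ne, Ideal.span_singleton_eq_top]
  · intro g hg hd
    have : Nontrivial (O ⧸ I) := by
      rw [Ideal.Quotient.nontrivial_iff]
      rwa [Ne, Ideal.span_singleton_eq_top]
    have hl : g ∈ lifts (Ideal.Quotient.mk I) := by
      rw [lifts_iff_coeff_lifts]
      exact fun n => Ideal.Quotient.mk_surjective _
    obtain ⟨g', h1, h2, h3⟩ := lifts_and_natDegree_eq_and_monic hl hg
    obtain ⟨a, ha⟩ := hroot g' h3 (by omega)
    refine ⟨Ideal.Quotient.mk I a, ?_⟩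
    rw [← h1, eval_map, eval₂_hom, ha, map_zero]
  · obtain ⟨y, hy⟩ := hroot (X ^ p - C ξ) (monic_X_pow_sub_C _ (by omega))
      (by rw [natDegree_X_pow_sub_C]; omega)
    rw [eval_sub, eval_pow, eval_X, eval_C, sub_eq_zero] at hy
    refine ⟨Ideal.Quotient.mk I y, ?_, ?_⟩
    · rw [Ne, Ideal.Quotient.eq_zero_iff_mem, hmem]
      rintro ⟨b, rfl⟩
      have hξ0 : ξ ≠ 0 := fun h => X_ne_zero (hinj (h.trans (map_zero _).symm))
      rw [mul_pow, show p = p - 1 + 1 by omega, pow_succ ξ, mul_assoc, mul_comm ξ, ← mul_assoc] at hy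
      have h1 : ξ ^ (p - 1) * b ^ (p - 1 + 1) = 1 := mul_right_cancel₀ hξ0 (by rw [hy, one_mul])
      obtain ⟨q, hq⟩ : ∃ q, p - 1 = q + 1 := ⟨p - 2, by omega⟩
      rw [hq, pow_succ', mul_assoc] at h1
      exact hξ (IsUnit.of_mul_eq_one _ h1)
    · rw [← map_pow, hy, Ideal.Quotient.eq_zero_iff_mem, hmem]
      exact ⟨1, (mul_one _).symm⟩

end RootAlgebra

/-! ### Abelian algebras: extending Frobenius-compatible linear maps. -/

section Extension

variable {p : ℕ} {F : Type u} [Field F] {P : Type v} [AddCommGroup P] [Module F P]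

/-- The submodule generated by `Γ` and the first `e` iterates of `q` under `T`. -/
def adjoinIterates (T : P →+ P) (Γ : Submodule F P) (q : P) (e : ℕ) : Submodule F P :=
  Γ ⊔ Submodule.span F ((fun i => T^[i] q) '' Set.Iio e)

theorem adjoinIterates_succ (T : P →+ P) (Γ : Submodule F P) (q : P) (e : ℕ) :
    adjoinIterates T Γ q (e + 1) = adjoinIterates T Γ q e ⊔ Submodule.span F {T^[e] q} := by
  rw [adjoinIterates, adjoinIterates, sup_assoc, ← Submodule.span_union]
  congr 2
  ext x
  simp only [Set.mem_image, Set.mem_Iio, Set.mem_union, Set.mem_singleton_iff]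
  constructor
  · rintro ⟨i, hi, rfl⟩
    rcases Nat.lt_succ_iff_lt_or_eq.1 hi with h | rfl
    · exact Or.inl ⟨i, h, rfl⟩
    · exact Or.inr rfl
  · rintro (⟨i, hi, rfl⟩ | rfl)
    · exact ⟨i, by omega, rfl⟩
    · exact ⟨e, by omega, rfl⟩

theorem map_span_le_of_semilinear (T : P →+ P) (hT : ∀ (c : F) x, T (c • x) = c ^ p • T x)
    {S : Set P} {Γ : Submodule F P} (h : ∀ x ∈ S, T x ∈ Γ) :
    ∀ x ∈ Submodule.span F S, T x ∈ Γ := by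
  intro x hx
  induction hx using Submodule.span_induction with
  | mem x hx => exact h x hx
  | zero => rw [map_zero]; exact zero_mem _
  | add x y _ _ hx hy => rw [map_add]; exact add_mem hx hy
  | smul c x _ hx => rw [hT]; exact Γ.smul_mem _ hx

theorem map_adjoinIterates (T : P →+ P) (hT : ∀ (c : F) x, T (c • x) = c ^ p • T x)
    (Γ : Submodule F P) (hΓ : ∀ x ∈ Γ, T x ∈ Γ) (q : P) (e : ℕ) :
    ∀ x ∈ adjoinIterates T Γ q e, T x ∈ adjoinIterates T Γ q (e + 1) := by
  intro x hx
  obtain ⟨y, hy, z, hz, rfl⟩ := Submodule.mem_sup.1 hx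
  rw [map_add]
  refine add_mem (Submodule.mem_sup_left (hΓ y hy)) (Submodule.mem_sup_right ?_)
  refine map_span_le_of_semilinear T hT ?_ z hz
  rintro _ ⟨i, hi, rfl⟩
  refine Submodule.subset_span ⟨i + 1, Nat.succ_lt_succ hi, ?_⟩
  exact Function.iterate_succ_apply' _ _ _

theorem adjoinIterates_mono (T : P →+ P) (Γ : Submodule F P) (q : P) :
    Monotone (adjoinIterates T Γ q) := fun _ _ h =>
  sup_le_sup_left (Submodule.span_mono (Set.image_mono fun _ hi => lt_of_lt_of_le hi h)) _

end Extension

section Graph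

variable {p : ℕ} [Fact p.Prime] {F : Type u} [Field F] [CharP F p] {K : Type v} [AddCommGroup K]
  [Module F K] {A : Type w} [CommRing A] [Algebra F A] [CharP A p]

/-- `t` on the first and Frobenius on the second factor. -/
def frobProd (p : ℕ) [Fact p.Prime] {K : Type v} [AddCommGroup K] {A : Type w} [CommRing A]
    [CharP A p] (t : K →+ K) : K × A →+ K × A :=
  t.prodMap (frobenius A p).toAddMonoidHom

theorem frobProd_apply (t : K →+ K) (x : K × A) : frobProd p t x = (t x.1, x.2 ^ p) := rfl

theorem frobProd_iterate (t : K →+ K) (x : K × A) (i : ℕ) :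
    (frobProd p t)^[i] x = (t^[i] x.1, x.2 ^ p ^ i) := by
  induction i with
  | zero => simp
  | succ i ih =>
    rw [Function.iterate_succ_apply', ih, frobProd_apply, ← pow_mul, ← pow_succ,
      Function.iterate_succ_apply']

theorem frobProd_smul (t : K →+ K) (ht : ∀ (c : F) x, t (c • x) = c ^ p • t x) (c : F)
    (x : K × A) : frobProd p t (c • x) = c ^ p • frobProd p t x := by
  rw [frobProd_apply, frobProd_apply]
  ext
  · simp [ht]
  · simp [smul_pow]

/-- A submodule of `K × A` that is the graph of a partial map compatible with `t` and Frobenius. -/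
def IsPartialGraph (t : K →+ K) (Γ : Submodule F (K × A)) : Prop :=
  (∀ x ∈ Γ, frobProd p t x ∈ Γ) ∧ ∀ a : A, (0, a) ∈ Γ → a = 0

/-- Only the first exponent at which an iterate of `u` depends on the earlier ones and the domain of
`Γ` needs checking: applying the semilinear map propagates membership to all later exponents, and
independent iterates cannot spoil the graph. -/
theorem IsPartialGraph.extend {t : K →+ K} (ht : ∀ (c : F) x, t (c • x) = c ^ p • t x)
    {Γ : Submodule F (K × A)} (hΓ : IsPartialGraph (p := p) t Γ) (u : K) (a : A)
    (h : ∀ e, (∃ b, (t^[e] u, b) ∈ adjoinIterates (frobProd p t) Γ (u, a) e) →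
      (∀ e' < e, ¬ ∃ b, (t^[e'] u, b) ∈ adjoinIterates (frobProd p t) Γ (u, a) e') →
      (frobProd p t)^[e] (u, a) ∈ adjoinIterates (frobProd p t) Γ (u, a) e) :
    ∃ Γ', IsPartialGraph (p := p) t Γ' ∧ Γ ≤ Γ' ∧ (u, a) ∈ Γ' := by
  set T := frobProd (A := A) p t with hTdef
  set q : K × A := (u, a) with hq
  have hT : ∀ (c : F) x, T (c • x) = c ^ p • T x := frobProd_smul t ht
  have hmono := adjoinIterates_mono T Γ q
  have hstep := map_adjoinIterates T hT Γ hΓ.1 q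
  have hmem : ∀ e, (∃ b, (t^[e] u, b) ∈ adjoinIterates T Γ q e) →
      T^[e] q ∈ adjoinIterates T Γ q e := by
    intro e he
    by_cases hmin : ∀ e' < e, ¬ ∃ b, (t^[e'] u, b) ∈ adjoinIterates T Γ q e'
    · exact h e he hmin
    · have hex : ∃ e', ∃ b, (t^[e'] u, b) ∈ adjoinIterates T Γ q e' := ⟨e, he⟩
      classical
      have h1 := h (Nat.find hex) (Nat.find_spec hex) fun e' h' => Nat.find_min hex h'
      have hle : Nat.find hex ≤ e := Nat.find_min' hex he
      have h2 : ∀ k, Nat.find hex ≤ k → T^[k] q ∈ adjoinIterates T Γ q k := by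
        intro k hk
        induction k, hk using Nat.le_induction with
        | base => exact h1
        | succ k hk ih => rw [Function.iterate_succ_apply']; exact hstep k _ ih
      exact h2 e hle
  have hfun : ∀ e b, ((0 : K), b) ∈ adjoinIterates T Γ q e → b = 0 := by
    intro e
    induction e with
    | zero =>
      intro b hb
      have : adjoinIterates T Γ q 0 = Γ := by simp [adjoinIterates]
      exact hΓ.2 b (this ▸ hb)
    | succ e ih =>
      intro b hb
      rw [adjoinIterates_succ] at hb
      obtain ⟨y, hy, z, hz, hyz⟩ := Submodule.mem_sup.1 hb
      obtain ⟨c, rfl⟩ := Submodule.mem_span_singleton.1 hz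
      by_cases hc : c = 0
      · rw [hc, zero_smul, add_zero] at hyz
        exact ih b (hyz ▸ hy)
      · have h3 : T^[e] q ∈ adjoinIterates T Γ q e := by
          refine hmem e ⟨-(c⁻¹ • y.2), ?_⟩
          have h4 : (t^[e] u, -(c⁻¹ • y.2)) = -(c⁻¹ • y) := by
            ext
            · have h5 := congrArg Prod.fst hyz
              rw [hTdef, frobProd_iterate] at h5
              simp only [Prod.fst_add, Prod.smul_fst, hq] at h5
              simp only [Prod.fst_neg, Prod.smul_fst]
              rw [eq_neg_iff_add_eq_zero]
              have h6 := congrArg (c⁻¹ • ·) h5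
              simpa [smul_add, smul_smul, inv_mul_cancel₀ hc, add_comm] using h6
            · simp
          rw [h4]
          exact neg_mem (Submodule.smul_mem _ _ hy)
        exact ih b (hyz ▸ add_mem hy (Submodule.smul_mem _ _ h3))
  refine ⟨⨆ e, adjoinIterates T Γ q e, ⟨fun x hx => ?_, fun b hb => ?_⟩, ?_, ?_⟩
  · obtain ⟨e, he⟩ := (Submodule.mem_iSup_of_directed _ hmono.directed_le).1 hx
    exact (Submodule.mem_iSup_of_directed _ hmono.directed_le).2 ⟨e + 1, hstep e x he⟩
  · obtain ⟨e, he⟩ := (Submodule.mem_iSup_of_directed _ hmono.directed_le).1 hb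
    exact hfun e b he
  · exact le_trans le_sup_left (le_iSup (adjoinIterates T Γ q) 0)
  · refine Submodule.mem_iSup_of_mem 1 (Submodule.mem_sup_right (Submodule.subset_span ?_))
    exact ⟨0, by simp, rfl⟩

end Graph

section Roots

variable {p : ℕ} [Fact p.Prime] {F : Type u} [Field F] {A : Type w} [CommRing A] [Nontrivial A]
  [Algebra F A]

open Polynomial in
theorem exists_root_additive
    (hA : ∀ g : A[X], g.Monic → 0 < g.natDegree → ∃ a, g.eval a = 0) (d : ℕ) (c : ℕ → F) (b : A) :
    ∃ a : A, a ^ p ^ d = b + ∑ i ∈ Finset.range d, c i • a ^ p ^ i := by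
  have hp := (Fact.out : p.Prime)
  set q : A[X] := C b + ∑ i ∈ Finset.range d, C (algebraMap F A (c i)) * X ^ p ^ i with hq
  have hdeg : q.degree < (p ^ d : ℕ) := by
    refine (degree_add_le _ _).trans_lt (max_lt ?_ ?_)
    · exact degree_C_le.trans_lt (by exact_mod_cast pow_pos hp.pos d)
    · refine (degree_sum_le _ _).trans_lt ((Finset.sup_lt_iff ?_).2 fun i hi => ?_)
      · exact WithBot.bot_lt_coe _
      · refine (degree_C_mul_X_pow_le _ _).trans_lt ?_
        exact_mod_cast Nat.pow_lt_pow_right hp.one_lt (Finset.mem_range.1 hi)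
  have hm : (X ^ p ^ d - q).Monic := monic_X_pow_sub hdeg
  obtain ⟨a, ha⟩ := hA _ hm (by
    rw [natDegree_sub_eq_left_of_natDegree_lt]
    · rw [natDegree_X_pow]; exact pow_pos hp.pos d
    · rw [natDegree_X_pow]
      by_cases h0 : q = 0
      · rw [h0, natDegree_zero]; exact pow_pos hp.pos d
      · exact (natDegree_lt_iff_degree_lt h0).2 hdeg)
  refine ⟨a, ?_⟩
  rw [eval_sub, sub_eq_zero] at ha
  simpa [hq, eval_finset_sum, Algebra.smul_def] using ha

-- If `c 0 ≠ 0`, the additive polynomial divided by its variable has nonzero constant term, so its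
-- roots are nonzero. If `c 0 = 0`, every exponent that matters is a positive power of `p`, and a
-- nonzero element of `p`-th power zero is a root; this is why the target must not be reduced.
open Polynomial in
theorem exists_root_additive_ne_zero
    (hA : ∀ g : A[X], g.Monic → 0 < g.natDegree → ∃ a, g.eval a = 0)
    (hA' : ∃ a : A, a ≠ 0 ∧ a ^ p = 0) (d : ℕ) (hd : 0 < d) (c : ℕ → F) :
    ∃ a : A, a ≠ 0 ∧ a ^ p ^ d = ∑ i ∈ Finset.range d, c i • a ^ p ^ i := by
  have hp := (Fact.out : p.Prime)
  by_cases hc : c 0 = 0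
  · obtain ⟨a, ha, hap⟩ := hA'
    have h : ∀ i, i ≠ 0 → a ^ p ^ i = 0 := by
      intro i hi
      obtain ⟨k, rfl⟩ := Nat.exists_eq_succ_of_ne_zero hi
      rw [pow_succ', pow_mul, hap, zero_pow (pow_pos hp.pos k).ne']
    refine ⟨a, ha, ?_⟩
    rw [h d hd.ne', Finset.sum_eq_zero]
    intro i _
    by_cases hi : i = 0
    · rw [hi, hc, zero_smul]
    · rw [h i hi, smul_zero]
  · set q : A[X] := ∑ i ∈ Finset.range d, C (algebraMap F A (c i)) * X ^ (p ^ i - 1) with hq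
    have hpd : 1 < p ^ d := Nat.one_lt_pow hd.ne' hp.one_lt
    have hdeg : q.degree < (p ^ d - 1 : ℕ) := by
      refine (degree_sum_le _ _).trans_lt ((Finset.sup_lt_iff ?_).2 fun i hi => ?_)
      · exact WithBot.bot_lt_coe _
      · refine (degree_C_mul_X_pow_le _ _).trans_lt ?_
        have h1 := Nat.pow_lt_pow_right hp.one_lt (Finset.mem_range.1 hi)
        have h2 := pow_pos hp.pos i
        have : p ^ i - 1 < p ^ d - 1 := by omega
        exact_mod_cast this
    have hm : (X ^ (p ^ d - 1) - q).Monic := monic_X_pow_sub hdeg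
    obtain ⟨a, ha⟩ := hA _ hm (by
      rw [natDegree_sub_eq_left_of_natDegree_lt]
      · rw [natDegree_X_pow]; omega
      · rw [natDegree_X_pow]
        by_cases h0 : q = 0
        · rw [h0, natDegree_zero]; omega
        · exact (natDegree_lt_iff_degree_lt h0).2 hdeg)
    rw [eval_sub, sub_eq_zero, eval_pow, eval_X, hq, eval_finset_sum] at ha
    simp only [eval_mul, eval_C, eval_pow, eval_X] at ha
    refine ⟨a, ?_, ?_⟩
    · rintro rfl
      rw [zero_pow (by omega), Finset.sum_eq_single 0] at ha
      · simp only [pow_zero, Nat.sub_self, mul_one] at ha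
        exact hc ((algebraMap F A).injective (ha.symm.trans (map_zero _).symm))
      · intro i _ hi
        have := Nat.one_lt_pow hi hp.one_lt
        rw [zero_pow (by omega), mul_zero]
      · intro h
        exact absurd (Finset.mem_range.2 hd) h
    · have h1 := congrArg (· * a) ha
      simp only [← pow_succ, Finset.sum_mul, mul_assoc] at h1
      rw [Nat.sub_add_cancel hpd.le] at h1
      rw [h1]
      refine Finset.sum_congr rfl fun i _ => ?_
      rw [Nat.sub_add_cancel (pow_pos hp.pos i), Algebra.smul_def]

end Roots

theorem exists_coeff_of_mem_span_image_Iio {F : Type u} [Field F] {P : Type v} [AddCommGroup P]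
    [Module F P] {f : ℕ → P} {d : ℕ} {z : P} (hz : z ∈ Submodule.span F (f '' Set.Iio d)) :
    ∃ c : ℕ → F, z = ∑ i ∈ Finset.range d, c i • f i := by
  induction hz using Submodule.span_induction with
  | mem x hx =>
    obtain ⟨i, hi, rfl⟩ := hx
    refine ⟨fun k => if k = i then 1 else 0, ?_⟩
    rw [Finset.sum_eq_single i]
    · simp
    · intro k _ hk; simp [hk]
    · intro h; exact absurd (Finset.mem_range.2 hi) h
  | zero => exact ⟨0, by simp⟩
  | add x y _ _ hx hy =>
    obtain ⟨c, rfl⟩ := hx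
    obtain ⟨c', rfl⟩ := hy
    exact ⟨c + c', by simp [add_smul, Finset.sum_add_distrib]⟩
  | smul a x _ hx =>
    obtain ⟨c, rfl⟩ := hx
    exact ⟨a • c, by simp [Finset.smul_sum, smul_smul]⟩

section Abelian

variable {p : ℕ} [Fact p.Prime] {F : Type u} [Field F] [CharP F p] {K : Type v} [AddCommGroup K]
  [Module F K] {A : Type w} [CommRing A] [Algebra F A] [CharP A p] [Nontrivial A]

-- The value at `u` must respect only the shortest relation among the iterates of `u` modulo the
-- domain of `Γ`, which is a monic equation for `a`. The last clause lets Zorn's lemma start from a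
-- map that does not vanish at a prescribed element.
open Polynomial in
theorem IsPartialGraph.exists_extend
    (hA : ∀ g : A[X], g.Monic → 0 < g.natDegree → ∃ a, g.eval a = 0)
    (hA' : ∃ a : A, a ≠ 0 ∧ a ^ p = 0) {t : K →+ K} (ht : ∀ (c : F) x, t (c • x) = c ^ p • t x)
    {Γ : Submodule F (K × A)} (hΓ : IsPartialGraph (p := p) t Γ) (u : K) :
    ∃ a Γ', IsPartialGraph (p := p) t Γ' ∧ Γ ≤ Γ' ∧ (u, a) ∈ Γ' ∧ (Γ = ⊥ → u ≠ 0 → a ≠ 0) := by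
  classical
  let R : ℕ → Prop := fun d => ∃ (k : K) (b : A) (c : ℕ → F), (k, b) ∈ Γ ∧
    t^[d] u = k + ∑ i ∈ Finset.range d, c i • t^[i] u
  have hsum : ∀ (a : A) (c : ℕ → F) (d : ℕ),
      ∑ i ∈ Finset.range d, c i • (frobProd p t)^[i] (u, a) =
      (∑ i ∈ Finset.range d, c i • t^[i] u, ∑ i ∈ Finset.range d, c i • a ^ p ^ i) := by
    intro a c d
    ext
    · simp [frobProd_iterate, Prod.fst_sum]
    · simp [frobProd_iterate, Prod.snd_sum]
  have hR : ∀ (a : A) e, (∃ b, (t^[e] u, b) ∈ adjoinIterates (frobProd p t) Γ (u, a) e) → R e := by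
    rintro a e ⟨b, hb⟩
    obtain ⟨y, hy, z, hz, hyz⟩ := Submodule.mem_sup.1 hb
    obtain ⟨c, rfl⟩ := exists_coeff_of_mem_span_image_Iio hz
    rw [hsum] at hyz
    exact ⟨y.1, y.2, c, hy, (congrArg Prod.fst hyz).symm⟩
  by_cases hex : ∃ d, R d
  · obtain ⟨k, b, c, hkb, hu⟩ := Nat.find_spec hex
    set d := Nat.find hex with hd
    have hmemspan : ∀ a : A, ∑ i ∈ Finset.range d, c i • (frobProd p t)^[i] (u, a) ∈
        Submodule.span F ((fun i => (frobProd p t)^[i] (u, a)) '' Set.Iio d) := fun a =>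
      sum_mem fun i hi => Submodule.smul_mem _ _
        (Submodule.subset_span ⟨i, Finset.mem_range.1 hi, rfl⟩)
    have key : ∀ a : A, a ^ p ^ d = b + ∑ i ∈ Finset.range d, c i • a ^ p ^ i →
        ∃ Γ', IsPartialGraph (p := p) t Γ' ∧ Γ ≤ Γ' ∧ (u, a) ∈ Γ' := by
      intro a ha
      have hTd : (frobProd p t)^[d] (u, a) ∈ adjoinIterates (frobProd p t) Γ (u, a) d := by
        have : (frobProd p t)^[d] (u, a) =
            (k, b) + ∑ i ∈ Finset.range d, c i • (frobProd p t)^[i] (u, a) := by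
          rw [hsum, frobProd_iterate]
          ext
          · exact hu
          · exact ha
        rw [this]
        exact add_mem (Submodule.mem_sup_left hkb) (Submodule.mem_sup_right (hmemspan a))
      refine hΓ.extend ht u a fun e he hmin => ?_
      have h1 : d ≤ e := Nat.find_min' hex (hR a e he)
      rcases h1.lt_or_eq with h2 | h2
      · exact absurd ⟨_, by rw [frobProd_iterate] at hTd; exact hTd⟩ (hmin d h2)
      · rw [← h2]; exact hTd
    by_cases hΓu : Γ = ⊥ ∧ u ≠ 0
    · have hkb0 : (k, b) = 0 := by rw [hΓu.1] at hkb; simpa using hkb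
      have hk0 : k = 0 := congrArg Prod.fst hkb0
      have hb0 : b = 0 := congrArg Prod.snd hkb0
      have hd0 : 0 < d := by
        rcases Nat.eq_zero_or_pos d with h | h
        · rw [h, hk0] at hu; simp at hu; exact absurd hu hΓu.2
        · exact h
      obtain ⟨a, ha0, ha⟩ := exists_root_additive_ne_zero hA hA' d hd0 c
      obtain ⟨Γ', h1, h2, h3⟩ := key a (by rw [hb0, zero_add, ha])
      exact ⟨a, Γ', h1, h2, h3, fun _ _ => ha0⟩
    · obtain ⟨a, ha⟩ := exists_root_additive (p := p) hA d c b
      obtain ⟨Γ', h1, h2, h3⟩ := key a ha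
      exact ⟨a, Γ', h1, h2, h3, fun h h' => absurd ⟨h, h'⟩ hΓu⟩
  · obtain ⟨Γ', h1, h2, h3⟩ := hΓ.extend ht u (1 : A) fun e he _ => absurd ⟨e, hR 1 e he⟩ hex
    exact ⟨1, Γ', h1, h2, h3, fun _ _ => one_ne_zero⟩

open Polynomial in
theorem exists_frobenius_linear_ne_zero
    (hA : ∀ g : A[X], g.Monic → 0 < g.natDegree → ∃ a, g.eval a = 0)
    (hA' : ∃ a : A, a ≠ 0 ∧ a ^ p = 0) {t : K →+ K} (ht : ∀ (c : F) x, t (c • x) = c ^ p • t x)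
    {v : K} (hv : v ≠ 0) : ∃ f : K →ₗ[F] A, (∀ k, f (t k) = f k ^ p) ∧ f v ≠ 0 := by
  have hbot : IsPartialGraph (p := p) t (⊥ : Submodule F (K × A)) := by
    refine ⟨fun x hx => ?_, fun a ha => ?_⟩
    · rw [(Submodule.mem_bot F).1 hx, map_zero]; exact zero_mem _
    · exact congrArg Prod.snd ((Submodule.mem_bot F).1 ha)
  obtain ⟨a, Γ₀, hΓ₀, -, hva, ha⟩ := hbot.exists_extend hA hA' ht v
  obtain ⟨Γ, hle, hmax⟩ := zorn_le_nonempty₀ {Γ | IsPartialGraph (F := F) (A := A) (p := p) t Γ}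
    (fun c hc hchain y hy => by
      have hne : c.Nonempty := ⟨y, hy⟩
      have hdir : DirectedOn (· ≤ ·) c := hchain.directedOn
      refine ⟨sSup c, ⟨fun x hx => ?_, fun b hb => ?_⟩, fun z hz => le_sSup hz⟩
      · obtain ⟨z, hz, hxz⟩ := (Submodule.mem_sSup_of_directed hne hdir).1 hx
        exact (Submodule.mem_sSup_of_directed hne hdir).2 ⟨z, hz, (hc hz).1 x hxz⟩
      · obtain ⟨z, hz, hxz⟩ := (Submodule.mem_sSup_of_directed hne hdir).1 hb
        exact (hc hz).2 b hxz) Γ₀ hΓ₀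
  have hΓ : IsPartialGraph (p := p) t Γ := hmax.1
  have htot : ∀ k, ∃ b, (k, b) ∈ Γ := by
    intro k
    obtain ⟨b, Γ', h1, h2, h3, -⟩ := hΓ.exists_extend hA hA' ht k
    exact ⟨b, hmax.2 h1 h2 h3⟩
  choose f hf using htot
  have huniq : ∀ k b, (k, b) ∈ Γ → f k = b := by
    intro k b h
    have := Γ.sub_mem (hf k) h
    rw [Prod.mk_sub_mk, sub_self] at this
    exact sub_eq_zero.1 (hΓ.2 _ this)
  refine ⟨{ toFun := f, map_add' := fun x y => ?_, map_smul' := fun c x => ?_ }, fun k => ?_, ?_⟩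
  · exact huniq _ _ (Γ.add_mem (hf x) (hf y))
  · exact huniq _ _ (Γ.smul_mem c (hf x))
  · exact huniq _ _ (hΓ.1 _ (hf k))
  · change f v ≠ 0
    rw [huniq v a (hle hva)]
    exact ha rfl hv

end Abelian

section Abelian

variable {p : ℕ} [Fact p.Prime] {F : Type u} [Field F] [CharP F p] {K : Type v} [LieRing K]
  [LieAlgebra F K] [RestrictedLieAlgebra p F K]

/-- A Frobenius-compatible linear map to a commutative algebra is a representation, hence factors
through the enveloping algebra, and such maps separate points from 0. No dimension restriction
enters. -/
theorem envι_injective_of_abelian (hK : ∀ x y : K, ⁅x, y⁆ = 0) :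
    Function.Injective (envι p F K) := by
  rw [← LinearMap.ker_eq_bot, LinearMap.ker_eq_bot']
  intro v hv
  by_contra hne
  obtain ⟨A, _, _, _, hA, hA'⟩ := exists_algebra_with_roots F p (Fact.out : p.Prime).two_le
  have : CharP A p := charP_of_injective_algebraMap (algebraMap F A).injective p
  let t : K →+ K :=
    { toFun := pMap p F
      map_zero' := pMap_zero p F
      map_add' := fun x y => pMap_add_of_lie_eq_zero (hK x y) }
  obtain ⟨f, hf, hfv⟩ := exists_frobenius_linear_ne_zero hA hA' (t := t)
    (fun c x => pMap_smul c x) hne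
  obtain ⟨g, hg⟩ := exists_lift (p := p) (f := f)
    ⟨fun x y => by rw [hK, map_zero, mul_comm, sub_self], hf⟩
  exact hfv (by rw [← hg, hv, map_zero])

end Abelian

/-! ### Linear forms that vanish on commutators and `p`-th powers. -/

section Dual

variable {p : ℕ} [Fact p.Prime] {F : Type u} [Field F] {Q : Type v} [LieRing Q] [LieAlgebra F Q]
  [RestrictedLieAlgebra p F Q]

theorem isNilpotent_ad {k : ℕ} {x : Q} (hk : (pMap p F)^[k] x = 0) :
    IsNilpotent (LieAlgebra.ad F Q x) :=
  ⟨p ^ k, by rw [← ad_iterate, hk, map_zero]⟩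

/-- A `p`-th power acts as `(ad q) ^ p` with `p ≥ 2`, so it descends two steps just as a commutator
does. -/
theorem lie_mem_lowerCentralSeries_two {g : Q} (hg : g ∈ Submodule.span F
    ({g : Q | ∃ x y : Q, ⁅x, y⁆ = g} ∪ Set.range (pMap p F))) (y : Q) :
    ⁅g, y⁆ ∈ LieModule.lowerCentralSeries F Q Q 2 := by
  have hmem : ∀ (k : ℕ) (x : Q) {y : Q}, y ∈ LieModule.lowerCentralSeries F Q Q k →
      ⁅x, y⁆ ∈ LieModule.lowerCentralSeries F Q Q (k + 1) := by
    intro k x y hy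
    rw [LieModule.lowerCentralSeries_succ]
    exact LieSubmodule.lie_mem_lie (LieSubmodule.mem_top x) hy
  have h0 : ∀ x : Q, x ∈ LieModule.lowerCentralSeries F Q Q 0 := fun x => LieSubmodule.mem_top x
  induction hg using Submodule.span_induction with
  | mem g hg =>
    rcases hg with ⟨a, b, rfl⟩ | ⟨q, rfl⟩
    · rw [← lie_skew]
      exact neg_mem (hmem 1 _ (hmem 0 _ (h0 _)))
    · rw [lie_pMap_left]
      obtain ⟨m, hm⟩ : ∃ m, p = m + 1 + 1 := ⟨p - 2, by have := (Fact.out : p.Prime).two_le; omega⟩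
      rw [hm]
      have : ∀ i, (LieAlgebra.ad F Q q ^ (i + 1 + 1)) y ∈ LieModule.lowerCentralSeries F Q Q 2 := by
        intro i
        induction i with
        | zero =>
          rw [pow_succ', pow_succ', Module.End.mul_apply, Module.End.mul_apply]
          exact hmem 1 _ (hmem 0 _ (h0 _))
        | succ i ih =>
          rw [pow_succ', Module.End.mul_apply]
          exact LieSubmodule.lie_mem _ ih
      exact this m
  | zero => simp
  | add a b _ _ ha hb => rw [add_lie]; exact add_mem ha hb
  | smul c a _ ha => rw [smul_lie]; exact SMulMemClass.smul_mem c ha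

/-- The only obstruction is that commutators and `p`-th powers span `Q`. Then the lower central
series is constant from its first step on, so by Engel `Q` is abelian; hence `Q` is spanned by its
`p^k`-th powers, which vanish. -/
theorem exists_dual_ne_zero [FiniteDimensional F Q] [Nontrivial Q] {k : ℕ}
    (hk : ∀ x : Q, (pMap p F)^[k] x = 0) :
    ∃ φ : Q →ₗ[F] F, φ ≠ 0 ∧ (∀ x y : Q, φ ⁅x, y⁆ = 0) ∧ ∀ x, φ (pMap p F x) = 0 := by
  set S : Set Q := {g : Q | ∃ x y : Q, ⁅x, y⁆ = g} ∪ Set.range (pMap p F) with hS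
  rcases (le_top : Submodule.span F S ≤ ⊤).lt_or_eq with hlt | htop
  · obtain ⟨φ, hφ, hφ'⟩ := Submodule.exists_dual_map_eq_bot_of_lt_top hlt inferInstance
    have h : ∀ s ∈ S, φ s = 0 := fun s hs => by
      have := Submodule.mem_map_of_mem (f := φ) (Submodule.subset_span (R := F) hs)
      rwa [hφ', Submodule.mem_bot] at this
    exact ⟨φ, hφ, fun x y => h _ (Or.inl ⟨x, y, rfl⟩), fun x => h _ (Or.inr ⟨x, rfl⟩)⟩
  exfalso
  have h12 : LieModule.lowerCentralSeries F Q Q 1 ≤ LieModule.lowerCentralSeries F Q Q 2 := by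
    rw [LieModule.lowerCentralSeries_succ, LieSubmodule.lie_le_iff]
    intro x _ y _
    exact lie_mem_lowerCentralSeries_two (p := p) (htop ▸ Submodule.mem_top) y
  have hstab : ∀ n, LieModule.lowerCentralSeries F Q Q 1 ≤
      LieModule.lowerCentralSeries F Q Q (n + 1) := by
    intro n
    induction n with
    | zero => exact le_rfl
    | succ n ih =>
      refine h12.trans ?_
      rw [LieModule.lowerCentralSeries_succ F Q Q 1, LieModule.lowerCentralSeries_succ F Q Q (n + 1)]
      exact LieSubmodule.mono_lie_right _ ih
  have hnil : LieRing.IsNilpotent Q :=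
    (LieAlgebra.isNilpotent_iff_forall (R := F)).2 fun x => isNilpotent_ad (hk x)
  obtain ⟨n, hn⟩ := (LieModule.isNilpotent_iff F Q Q).1 hnil
  have hab : ∀ x y : Q, ⁅x, y⁆ = 0 := by
    intro x y
    have h1 : ⁅x, y⁆ ∈ LieModule.lowerCentralSeries F Q Q 1 := by
      rw [LieModule.lowerCentralSeries_succ]
      exact LieSubmodule.lie_mem_lie (LieSubmodule.mem_top x) (LieSubmodule.mem_top y)
    have h2 := LieModule.antitone_lowerCentralSeries F Q Q (Nat.le_succ n) (hstab n h1)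
    rwa [hn, LieSubmodule.mem_bot] at h2
  have hspan : ∀ j, Submodule.span F (Set.range (pMap p F)^[j] : Set Q) = ⊤ := by
    intro j
    induction j with
    | zero => simp
    | succ j ih =>
      refine eq_top_iff.2 ?_
      rw [← htop, Submodule.span_le]
      rintro _ (⟨x, y, rfl⟩ | ⟨q, rfl⟩)
      · rw [hab]; exact zero_mem _
      · have hq : q ∈ Submodule.span F (Set.range (pMap p F)^[j] : Set Q) := ih ▸ Submodule.mem_top
        induction hq using Submodule.span_induction with
        | mem q hq =>
          obtain ⟨x, rfl⟩ := hq
          exact Submodule.subset_span ⟨x, Function.iterate_succ_apply' _ _ _⟩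
        | zero => rw [pMap_zero]; exact zero_mem _
        | add a b _ _ ha hb =>
          rw [pMap_add_of_lie_eq_zero (hab a b)]; exact add_mem ha hb
        | smul c a _ ha => rw [pMap_smul]; exact Submodule.smul_mem _ _ ha
  obtain ⟨x, hx⟩ := exists_ne (0 : Q)
  have : x ∈ Submodule.span F (Set.range (pMap p F)^[k] : Set Q) := hspan k ▸ Submodule.mem_top
  refine hx ?_
  have hr : Set.range (pMap p F)^[k] ⊆ ({0} : Set Q) := by
    rintro _ ⟨y, rfl⟩
    exact hk y
  have h3 := Submodule.span_mono (R := F) hr this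
  rwa [Submodule.span_singleton_eq_bot.2 rfl, Submodule.mem_bot] at h3

end Dual

/-! ### The restricted Poincaré-Birkhoff-Witt theorem by hyperplane sections. -/

section Kernel

variable {p : ℕ} [Fact p.Prime] {F : Type u} [Field F] {G : Type v} [LieRing G] [LieAlgebra F G]
  [RestrictedLieAlgebra p F G]

/-- The restricted Lie algebra structure of a Lie subalgebra closed under the `p`-map. -/
@[reducible] def restrict (K : LieSubalgebra F G) (hK : ∀ x ∈ K, pMap p F x ∈ K) :
    RestrictedLieAlgebra p F K :=
  comap K.incl Subtype.val_injective (fun x => ⟨pMap p F x.1, hK x.1 x.2⟩) fun _ => rfl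

/-- The kernel of a linear form that vanishes on commutators. -/
def kerSubalgebra (φ : G →ₗ[F] F) (hφ : ∀ x y : G, φ ⁅x, y⁆ = 0) : LieSubalgebra F G :=
  { LinearMap.ker φ with lie_mem' := fun {x y} _ _ => hφ x y }

theorem mem_kerSubalgebra {φ : G →ₗ[F] F} {hφ : ∀ x y : G, φ ⁅x, y⁆ = 0} {x : G} :
    x ∈ kerSubalgebra φ hφ ↔ φ x = 0 := LinearMap.mem_ker

theorem pMap_mem_kerSubalgebra {φ : G →ₗ[F] F} (hφ : ∀ x y : G, φ ⁅x, y⁆ = 0)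
    (ht : ∀ x, φ (pMap p F x) = 0) (x : G) (_ : x ∈ kerSubalgebra φ hφ) :
    pMap p F x ∈ kerSubalgebra φ hφ := mem_kerSubalgebra.2 (ht x)

theorem envι_kerSubalgebra [CharP F p] {φ : G →ₗ[F] F} (h0 : φ ≠ 0) (hφ : ∀ x y : G, φ ⁅x, y⁆ = 0)
    (ht : ∀ x, φ (pMap p F x) = 0) :
    letI := restrict (kerSubalgebra φ hφ) (pMap_mem_kerSubalgebra hφ ht)
    (Function.Injective (envι p F (kerSubalgebra φ hφ)) → Function.Injective (envι p F G)) ∧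
      Nonempty ((Fin p → EnvelopingAlgebra p F (kerSubalgebra φ hφ)) ≃ₗ[F]
        EnvelopingAlgebra p F G) := by
  letI := restrict (kerSubalgebra φ hφ) (pMap_mem_kerSubalgebra hφ ht)
  obtain ⟨x, hx⟩ : ∃ x, φ x ≠ 0 := by
    by_contra! h
    exact h0 (LinearMap.ext h)
  refine envι_injective_of_codim_one (kerSubalgebra φ hφ).incl Subtype.val_injective
    (fun _ => rfl) x (fun n hn => hx ?_) (fun g => ?_) (fun n => ?_) ?_
  · rw [← hn]; exact n.2
  · refine ⟨φ g / φ x, ⟨g - (φ g / φ x) • x, ?_⟩, ?_⟩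
    · rw [mem_kerSubalgebra, map_sub, map_smul, smul_eq_mul, div_mul_cancel₀ _ hx, sub_self]
    · change g = _ + (g - _)
      abel
  · exact ⟨⟨⁅x, n.1⁆, mem_kerSubalgebra.2 (hφ _ _)⟩, rfl⟩
  · exact ⟨⟨pMap p F x, mem_kerSubalgebra.2 (ht _)⟩, rfl⟩

end Kernel

section Induction

variable {p : ℕ} [Fact p.Prime] {F : Type u} [Field F] [CharP F p]

theorem quotient_pMap_mk {G : Type v} [LieRing G] [LieAlgebra F G] [RestrictedLieAlgebra p F G]
    (K : LieIdeal F G) (hK : IsRestrictedIdeal p K) (k : ℕ) (x : G) :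
    letI := quotient K hK
    (pMap p F)^[k] (LieSubmodule.Quotient.mk x : G ⧸ K) =
      LieSubmodule.Quotient.mk ((pMap p F)^[k] x) := by
  letI := quotient K hK
  induction k generalizing x with
  | zero => rfl
  | succ k ih => exact ih _

/-- Induction on the dimension of `G ⧸ K`: the kernel of a form pulled back from the quotient still
contains `K`, and the induction ends with the abelian algebra `K` itself. Since `K` may be
infinite-dimensional, this also serves for `H`. -/
theorem envι_injective_of_quotient_finite (n : ℕ) : ∀ (G : Type v) [LieRing G] [LieAlgebra F G]
    [RestrictedLieAlgebra p F G] (K : LieIdeal F G) (_ : IsRestrictedIdeal p K)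
    (_ : ∀ x ∈ K, ∀ y ∈ K, ⁅x, y⁆ = 0) (_ : FiniteDimensional F (G ⧸ K))
    (k : ℕ) (_ : ∀ x : G, ((pMap p F)^[k] : G → G) x ∈ K), Module.finrank F (G ⧸ K) ≤ n →
    Function.Injective (envι p F G) := by
  induction n with
  | zero =>
    intro G _ _ _ K hK hab _ k hk hn
    have hsub := Module.finrank_zero_iff.1 (Nat.le_zero.1 hn)
    have htop : ∀ x, x ∈ K := fun x =>
      (LieSubmodule.Quotient.mk_eq_zero').1 (Subsingleton.elim _ _)
    exact envι_injective_of_abelian fun x y => hab x (htop x) y (htop y)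
  | succ n ih =>
    intro G _ _ _ K hK hab _ k hk hn
    rcases subsingleton_or_nontrivial (G ⧸ K) with hsub | hnt
    · have htop : ∀ x, x ∈ K := fun x =>
        (LieSubmodule.Quotient.mk_eq_zero').1 (Subsingleton.elim _ _)
      exact envι_injective_of_abelian fun x y => hab x (htop x) y (htop y)
    letI := quotient K hK
    obtain ⟨φ, h0, hφ, ht⟩ := exists_dual_ne_zero (p := p) (F := F) (Q := G ⧸ K) (k := k) (by
      intro q
      obtain ⟨x, rfl⟩ := LieSubmodule.Quotient.surjective_mk' K q
      refine (quotient_pMap_mk K hK k x).trans ?_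
      exact (LieSubmodule.Quotient.mk_eq_zero').2 (hk x))
    set π : G →ₗ[F] G ⧸ K := (LieSubmodule.Quotient.mk' K : G →ₗ[F] G ⧸ K) with hπ
    have hπs : Function.Surjective π := LieSubmodule.Quotient.surjective_mk' K
    have hφ' : ∀ x y : G, (φ ∘ₗ π) ⁅x, y⁆ = 0 := fun x y => hφ (π x) (π y)
    have ht' : ∀ x, (φ ∘ₗ π) (pMap p F x) = 0 := fun x => ht (π x)
    have h0' : φ ∘ₗ π ≠ 0 := fun h => h0 (LinearMap.ext fun q => by
      obtain ⟨x, rfl⟩ := hπs q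
      exact LinearMap.congr_fun h x)
    set N := kerSubalgebra (φ ∘ₗ π) hφ' with hN
    letI := restrict N (pMap_mem_kerSubalgebra hφ' ht')
    refine (envι_kerSubalgebra h0' hφ' ht').1 ?_
    have hval : ∀ (k : ℕ) (x : N), (((pMap p F)^[k] x : N) : G) = (pMap p F)^[k] (x : G) := by
      intro k
      induction k with
      | zero => intro x; rfl
      | succ k ih => intro x; exact ih _
    -- Embeds the new quotient in the hyperplane `ker φ` of `G ⧸ K`, so the dimension drops.
    let f : N ⧸ (K.comap N.incl) →ₗ[F] LinearMap.ker φ :=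
      Submodule.liftQ _ ((π ∘ₗ N.toSubmodule.subtype).codRestrict (LinearMap.ker φ) fun x => x.2)
        (by
          intro x hx
          rw [LinearMap.mem_ker]
          refine Subtype.ext ?_
          exact (LieSubmodule.Quotient.mk_eq_zero').2 hx)
    have hf : Function.Injective f := by
      rw [← LinearMap.ker_eq_bot, LinearMap.ker_eq_bot']
      intro q hq
      obtain ⟨x, rfl⟩ := Submodule.Quotient.mk_surjective _ q
      refine (Submodule.Quotient.mk_eq_zero _).2 ?_
      have h2 : π (x : G) = 0 := congrArg Subtype.val hq
      exact (LieSubmodule.Quotient.mk_eq_zero' (N := K)).1 h2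
    have hlt : Module.finrank F (LinearMap.ker φ) < Module.finrank F (G ⧸ K) :=
      Submodule.finrank_lt fun h => h0 (LinearMap.ker_eq_top.1 h)
    have hle := LinearMap.finrank_le_finrank_of_injective hf
    refine ih N (K.comap N.incl) (fun x hx => hK _ hx)
      (fun x hx y hy => Subtype.ext (hab x hx y hy)) (FiniteDimensional.of_injective f hf) k
      (fun x => ?_) (by omega)
    change ((((pMap p F)^[k] x : N) : G)) ∈ K
    rw [hval]
    exact hk x

/-- The Poincaré-Birkhoff-Witt theorem for finite-dimensional `p`-nilpotent restricted Lie
algebras: the dimension of the restricted enveloping algebra. -/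
theorem finrank_envelopingAlgebra (n : ℕ) : ∀ (G : Type v) [LieRing G] [LieAlgebra F G]
    [RestrictedLieAlgebra p F G] [FiniteDimensional F G] (k : ℕ)
    (_ : ∀ x : G, (pMap p F)^[k] x = 0), Module.finrank F G = n →
    Module.Finite F (EnvelopingAlgebra p F G) ∧
      Module.finrank F (EnvelopingAlgebra p F G) = p ^ n := by
  induction n with
  | zero =>
    intro G _ _ _ _ k hk hn
    have hsub := Module.finrank_zero_iff.1 hn
    have hbot : (⊥ : Subalgebra F (EnvelopingAlgebra p F G)) = ⊤ := by
      rw [← adjoin_range_envι, eq_comm, eq_bot_iff, Algebra.adjoin_le_iff]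
      rintro _ ⟨x, rfl⟩
      rw [Subsingleton.elim x 0, map_zero]
      exact zero_mem _
    have h1 := Subalgebra.finrank_bot (F := F) (E := EnvelopingAlgebra p F G)
    rw [hbot, ← Subalgebra.finrank_toSubmodule, Algebra.top_toSubmodule, finrank_top] at h1
    exact ⟨Module.finite_of_finrank_pos (by omega), by rw [h1, pow_zero]⟩
  | succ n ih =>
    intro G _ _ _ _ k hk hn
    have : Nontrivial G := Module.nontrivial_of_finrank_pos (R := F) (by omega)
    obtain ⟨φ, h0, hφ, ht⟩ := exists_dual_ne_zero (p := p) (F := F) hk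
    set N := kerSubalgebra φ hφ with hN
    letI := restrict N (pMap_mem_kerSubalgebra hφ ht)
    obtain ⟨-, ⟨e⟩⟩ := envι_kerSubalgebra h0 hφ ht
    have hval : ∀ (k : ℕ) (x : N), (((pMap p F)^[k] x : N) : G) = (pMap p F)^[k] (x : G) := by
      intro k
      induction k with
      | zero => intro x; rfl
      | succ k ih => intro x; exact ih _
    have hfd : FiniteDimensional F N := inferInstanceAs (FiniteDimensional F N.toSubmodule)
    have hrank : Module.finrank F N = n := by
      have h1 : Module.finrank F (LinearMap.range φ) + Module.finrank F (LinearMap.ker φ) =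
          Module.finrank F G := LinearMap.finrank_range_add_finrank_ker φ
      rw [LinearMap.range_eq_top.2 (LinearMap.surjective h0), finrank_top,
        Module.finrank_self] at h1
      have h2 : Module.finrank F N = Module.finrank F (LinearMap.ker φ) := rfl
      omega
    obtain ⟨h1, h2⟩ := ih N k (fun x => Subtype.ext ((hval k x).trans (hk x))) hrank
    refine ⟨Module.Finite.equiv e, ?_⟩
    rw [← e.finrank_eq, Module.finrank_pi_fintype]
    rw [Finset.sum_const, Finset.card_univ, Fintype.card_fin, smul_eq_mul, h2, pow_succ']

theorem envι_injective_of_finite {G : Type v} [LieRing G] [LieAlgebra F G]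
    [RestrictedLieAlgebra p F G] [FiniteDimensional F G] {k : ℕ}
    (hk : ∀ x : G, (pMap p F)^[k] x = 0) : Function.Injective (envι p F G) :=
  envι_injective_of_quotient_finite _ G ⊥
    (fun x hx => by
      rw [LieSubmodule.mem_bot] at hx ⊢
      rw [hx, pMap_zero])
    (fun x hx y _ => by rw [(LieSubmodule.mem_bot x).1 hx, zero_lie])
    inferInstance k (fun x => by rw [hk]; exact zero_mem _) le_rfl

end Induction

/-! ### Nilpotency of the augmentation ideal. -/

section Engel

variable {p : ℕ} [Fact p.Prime] {F : Type u} [Field F] {G : Type v} [LieRing G] [LieAlgebra F G]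
  [RestrictedLieAlgebra p F G] {A : Type w} [Ring A] [Algebra F A]

/-- Engel's theorem for `A` as a `G`-module under left multiplication: each `j x` is nilpotent, and
the lower central series of the module contains the powers of the range of `j`. -/
theorem IsRep.exists_pow_range_eq_bot [FiniteDimensional F G] {j : G →ₗ[F] A} (hj : IsRep p j)
    {k : ℕ} (hk : ∀ x : G, (pMap p F)^[k] x = 0) : ∃ n : ℕ, LinearMap.range j ^ n = ⊥ := by
  letI : LieRingModule G A :=
    { bracket := fun x a => j x * a
      add_lie := fun x y a => by
        change j (x + y) * a = j x * a + j y * a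
        rw [map_add, add_mul]
      lie_add := fun x a b => mul_add _ _ _
      leibniz_lie := fun x y a => by
        change j x * (j y * a) = j ⁅x, y⁆ * a + j y * (j x * a)
        rw [hj.1]; noncomm_ring }
  letI : LieModule F G A :=
    { smul_lie := fun c x a => by
        change j (c • x) * a = c • (j x * a)
        rw [map_smul, smul_mul_assoc]
      lie_smul := fun c x a => mul_smul_comm _ _ _ }
  have hlie : ∀ (x : G) (a : A), ⁅x, a⁆ = j x * a := fun _ _ => rfl
  have hnil : LieModule.IsNilpotent G A := by
    refine (LieModule.isNilpotent_iff_forall (R := F)).2 fun x => ⟨p ^ k, ?_⟩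
    have hpow : ∀ m a, (LieModule.toEnd F G A x ^ m) a = j x ^ m * a := by
      intro m a
      induction m with
      | zero => simp
      | succ m ih =>
        rw [pow_succ', Module.End.mul_apply, ih, pow_succ', mul_assoc]; rfl
    ext a
    rw [hpow, ← hj.map_iterate, hk, map_zero, zero_mul]; rfl
  obtain ⟨n, hn⟩ := (LieModule.isNilpotent_iff F G A).1 hnil
  refine ⟨n, eq_bot_iff.2 ?_⟩
  have hle : ∀ n, LinearMap.range j ^ n ≤
      (LieModule.lowerCentralSeries F G A n : Submodule F A) := by
    intro n
    induction n with
    | zero => exact le_top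
    | succ n ih =>
      rw [pow_succ', Submodule.mul_le]
      rintro _ ⟨x, rfl⟩ a ha
      rw [LieModule.lowerCentralSeries_succ]
      exact LieSubmodule.lie_mem_lie (LieSubmodule.mem_top x) (ih ha)
  exact (hle n).trans (by rw [hn]; exact le_rfl)

/-- The augmentation ideal of an augmented algebra, as a subspace. -/
def aug (ε : A →ₐ[F] F) : Submodule F A := LinearMap.ker ε.toLinearMap

theorem mem_aug {ε : A →ₐ[F] F} {a : A} : a ∈ aug ε ↔ ε a = 0 := LinearMap.mem_ker

theorem aug_mul_top (ε : A →ₐ[F] F) : aug ε * ⊤ = aug ε := by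
  refine le_antisymm (Submodule.mul_le.2 fun a ha b _ => ?_) fun a ha => ?_
  · rw [mem_aug] at ha ⊢
    rw [map_mul, ha, zero_mul]
  · rw [← mul_one a]
    exact Submodule.mul_mem_mul ha trivial

theorem top_mul_aug (ε : A →ₐ[F] F) : ⊤ * aug ε = aug ε := by
  refine le_antisymm (Submodule.mul_le.2 fun a _ b hb => ?_) fun a ha => ?_
  · rw [mem_aug] at hb ⊢
    rw [map_mul, hb, mul_zero]
  · rw [← one_mul a]
    exact Submodule.mul_mem_mul trivial ha

theorem aug_eq_top_mul_range {j : G →ₗ[F] A} (hA : Algebra.adjoin F (Set.range j) = ⊤)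
    {ε : A →ₐ[F] F} (hε : ∀ x, ε (j x) = 0) : aug ε = ⊤ * LinearMap.range j := by
  refine le_antisymm (fun a ha => ?_) (Submodule.mul_le.2 ?_)
  · have key : ∀ a : A, a - algebraMap F A (ε a) ∈ (⊤ : Submodule F A) * LinearMap.range j := by
      intro a
      have ha : a ∈ Algebra.adjoin F (Set.range j) := hA ▸ Algebra.mem_top
      induction ha using Algebra.adjoin_induction with
      | mem a ha =>
        obtain ⟨x, rfl⟩ := ha
        rw [hε, map_zero, sub_zero, ← one_mul (j x)]
        exact Submodule.mul_mem_mul trivial ⟨x, rfl⟩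
      | algebraMap r => simp
      | add a b _ _ ha hb =>
        rw [map_add, map_add, add_sub_add_comm]; exact add_mem ha hb
      | mul a b _ _ ha hb =>
        have : a * b - algebraMap F A (ε (a * b)) =
            a * (b - algebraMap F A (ε b)) + ε b • (a - algebraMap F A (ε a)) := by
          rw [map_mul, mul_comm (ε a), map_mul, smul_sub, Algebra.smul_def, Algebra.smul_def, mul_sub,
            Algebra.commutes (ε b) a]
          abel
        rw [this]
        refine add_mem ?_ (Submodule.smul_mem _ _ ha)
        have h1 := Submodule.mul_mem_mul (M := (⊤ : Submodule F A)) (m := a) trivial hb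
        rw [← mul_assoc] at h1
        exact mul_le_mul_left le_top (LinearMap.range j) h1
    have := key a
    rwa [mem_aug.1 ha, map_zero, sub_zero] at this
  · rintro a _ _ ⟨x, rfl⟩
    rw [mem_aug, map_mul, hε, mul_zero]

theorem aug_pow_eq {j : G →ₗ[F] A} (hA : Algebra.adjoin F (Set.range j) = ⊤)
    {ε : A →ₐ[F] F} (hε : ∀ x, ε (j x) = 0) (n : ℕ) :
    aug ε ^ (n + 1) = ⊤ * LinearMap.range j ^ (n + 1) := by
  have h := aug_eq_top_mul_range hA hε
  induction n with
  | zero => rw [zero_add, pow_one, pow_one, h]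
  | succ n ih =>
    rw [pow_succ', ih, ← mul_assoc, aug_mul_top, h, mul_assoc, ← pow_succ']

theorem IsRep.map_eq_zero [Nontrivial A] {j : G →ₗ[F] A} (hj : IsRep p j)
    {k : ℕ} (hk : ∀ x : G, (pMap p F)^[k] x = 0) (ε : A →ₐ[F] F) (x : G) : ε (j x) = 0 := by
  have h : ε (j x) ^ p ^ k = 0 := by rw [← map_pow, ← hj.map_iterate, hk, map_zero, map_zero]
  exact pow_eq_zero_iff (pow_ne_zero _ (Fact.out : p.Prime).ne_zero) |>.1 h

theorem exists_aug_pow_eq_bot [FiniteDimensional F G] {j : G →ₗ[F] A} (hj : IsRep p j)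
    (hA : Algebra.adjoin F (Set.range j) = ⊤)
    {k : ℕ} (hk : ∀ x : G, (pMap p F)^[k] x = 0) (ε : A →ₐ[F] F) :
    ∃ n : ℕ, aug ε ^ n = ⊥ := by
  have : Nontrivial A := ε.toRingHom.domain_nontrivial
  obtain ⟨n, hn⟩ := hj.exists_pow_range_eq_bot hk
  refine ⟨n + 1, ?_⟩
  rw [aug_pow_eq hA (hj.map_eq_zero hk ε), pow_succ, hn, Submodule.bot_mul, Submodule.mul_bot]

theorem IsEnvelope.exists_augmentation {j : G →ₗ[F] A} (hj : IsEnvelope p j) :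
    ∃ ε : A →ₐ[F] F, ∀ x, ε (j x) = 0 := by
  obtain ⟨ε, hε⟩ := hj.exists_lift (f := (0 : G →ₗ[F] F)) isRep_zero
  exact ⟨ε, hε⟩

end Engel

section Injective

variable {p : ℕ} [Fact p.Prime] {F : Type u} [Field F] [CharP F p] {G : Type v} [LieRing G]
  [LieAlgebra F G] [RestrictedLieAlgebra p F G]

/-- The kernel `K` is central, because the adjoint representation factors through the enveloping
algebra. The quotient by `K` embeds in a finite-dimensional algebra and is p-nilpotent. So `K` is an
abelian ideal to which `envι_injective_of_quotient_finite` applies. -/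
theorem envι_injective_of_isNilpotent [Module.Finite F (EnvelopingAlgebra p F G)] {k : ℕ}
    (hk : ∀ x : G, envι p F G x ^ p ^ k = 0) : Function.Injective (envι p F G) := by
  have hrep := isRep_envι p F (G := G)
  let K : LieIdeal F G :=
    { LinearMap.ker (envι p F G) with
      lie_mem := fun {x m} hm => by
        change envι p F G ⁅x, m⁆ = 0
        have hm : envι p F G m = 0 := hm
        rw [hrep.1, hm, mul_zero, zero_mul, sub_zero] }
  have hmem : ∀ x, x ∈ K ↔ envι p F G x = 0 := fun x => Iff.rfl
  have hK : IsRestrictedIdeal p K := fun x hx => by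
    rw [hmem] at hx ⊢
    rw [hrep.2, hx, zero_pow (Fact.out : p.Prime).ne_zero]
  have had : IsRep p (LieAlgebra.ad F G : G →ₗ[F] Module.End F G) :=
    ⟨fun x y => by
      ext z
      exact lie_lie x y z, fun x => (ad_pMap x).symm⟩
  obtain ⟨g, hg⟩ := exists_lift had
  refine envι_injective_of_quotient_finite _ G K hK (fun x hx y _ => ?_) ?_ k (fun x => ?_) le_rfl
  · have h1 := hg x
    rw [(hmem x).1 hx, map_zero] at h1
    exact (LinearMap.congr_fun h1 y).symm
  · refine FiniteDimensional.of_injective (V₂ := EnvelopingAlgebra p F G)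
      (Submodule.liftQ K.toSubmodule (envι p F G) fun x hx => hx) ?_
    rw [← LinearMap.ker_eq_bot, LinearMap.ker_eq_bot']
    intro q hq
    obtain ⟨x, rfl⟩ := Submodule.Quotient.mk_surjective _ q
    exact (Submodule.Quotient.mk_eq_zero _).2 hq
  · rw [hmem, hrep.map_iterate, hk]

end Injective

/-! ### Orbits of the `p`-map, leading terms and dimensions. -/

section Orbit

variable {p : ℕ} {F : Type u} [Field F] {G : Type v} [LieRing G] [LieAlgebra F G]
  [RestrictedLieAlgebra p F G]

variable (p F) in
/-- The span of the iterates of the `p`-map on one element. -/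
def orbit (y : G) : Submodule F G := Submodule.span F (Set.range fun i => (pMap p F)^[i] y)

theorem iterate_mem_orbit (y : G) (i : ℕ) : (pMap p F)^[i] y ∈ orbit p F y :=
  Submodule.subset_span ⟨i, rfl⟩

theorem mem_orbit_self (y : G) : y ∈ orbit p F y := iterate_mem_orbit y 0

theorem orbit_le {y : G} {V : Submodule F G} : orbit p F y ≤ V ↔ ∀ i, (pMap p F)^[i] y ∈ V := by
  rw [orbit, Submodule.span_le, Set.range_subset_iff]; rfl

theorem orbit_iterate_antitone (y : G) {k l : ℕ} (h : k ≤ l) :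
    orbit p F ((pMap p F)^[l] y) ≤ orbit p F ((pMap p F)^[k] y) := by
  refine orbit_le.2 fun i => ?_
  obtain ⟨d, rfl⟩ := Nat.exists_eq_add_of_le h
  rw [← Function.iterate_add_apply, show i + (k + d) = (i + d) + k by omega,
    Function.iterate_add_apply]
  exact iterate_mem_orbit _ _

theorem orbit_iterate_le (y : G) (k : ℕ) : orbit p F ((pMap p F)^[k] y) ≤ orbit p F y :=
  orbit_le.2 fun i => by rw [← Function.iterate_add_apply]; exact iterate_mem_orbit _ _

theorem orbit_pMap_le (y : G) : orbit p F (pMap p F y) ≤ orbit p F y := orbit_iterate_le y 1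

theorem orbit_sup (y : G) : orbit p F y = Submodule.span F {y} ⊔ orbit p F (pMap p F y) := by
  refine le_antisymm (orbit_le.2 fun i => ?_) (sup_le ?_ (orbit_pMap_le y))
  · cases i with
    | zero => exact Submodule.mem_sup_left (Submodule.mem_span_singleton_self y)
    | succ i => exact Submodule.mem_sup_right (iterate_mem_orbit _ i)
  · rw [Submodule.span_singleton_le_iff_mem]; exact mem_orbit_self y

theorem exists_sub_smul_mem_orbit {u y : G} (hu : u ∈ orbit p F y) :
    ∃ c : F, u - c • y ∈ orbit p F (pMap p F y) := by
  rw [orbit_sup, Submodule.mem_sup] at hu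
  obtain ⟨a, ha, b, hb, rfl⟩ := hu
  obtain ⟨c, rfl⟩ := Submodule.mem_span_singleton.1 ha
  exact ⟨c, by rwa [add_sub_cancel_left]⟩

variable [Fact p.Prime]

theorem lie_eq_zero_of_mem_orbit {x y u v : G} (h : ⁅x, y⁆ = 0) (hu : u ∈ orbit p F x)
    (hv : v ∈ orbit p F y) : ⁅u, v⁆ = 0 := by
  induction hu using Submodule.span_induction with
  | mem u hu =>
    obtain ⟨i, rfl⟩ := hu
    induction hv using Submodule.span_induction with
    | mem v hv => obtain ⟨j, rfl⟩ := hv; exact lie_iterate_eq_zero h i j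
    | zero => exact lie_zero _
    | add a b _ _ ha hb => rw [lie_add, ha, hb, add_zero]
    | smul c a _ ha => rw [lie_smul, ha, smul_zero]
  | zero => exact zero_lie _
  | add a b _ _ ha hb => rw [add_lie, ha, hb, add_zero]
  | smul c a _ ha => rw [smul_lie, ha, smul_zero]

theorem lie_orbit_self {y u v : G} (hu : u ∈ orbit p F y) (hv : v ∈ orbit p F y) : ⁅u, v⁆ = 0 :=
  lie_eq_zero_of_mem_orbit (lie_self y) hu hv

theorem iterate_add_of_mem_orbit {y u v : G} (hu : u ∈ orbit p F y) (hv : v ∈ orbit p F y)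
    (k : ℕ) : (pMap p F)^[k] (u + v) = (pMap p F)^[k] u + (pMap p F)^[k] v :=
  iterate_add_of_lie_eq_zero (lie_orbit_self hu hv) k

theorem iterate_mem_orbit_iterate {y u : G} (hu : u ∈ orbit p F y) (k : ℕ) :
    (pMap p F)^[k] u ∈ orbit p F ((pMap p F)^[k] y) := by
  induction hu using Submodule.span_induction with
  | mem u hu =>
    obtain ⟨i, rfl⟩ := hu
    change (pMap p F)^[k] ((pMap p F)^[i] y) ∈ _
    rw [← Function.iterate_add_apply, add_comm, Function.iterate_add_apply]
    exact iterate_mem_orbit _ _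
  | zero => rw [pMap_iterate_zero]; exact zero_mem _
  | add a b ha hb ha' hb' => rw [iterate_add_of_mem_orbit ha hb]; exact add_mem ha' hb'
  | smul c a _ ha => rw [pMap_iterate_smul]; exact Submodule.smul_mem _ _ ha

theorem iterate_mem_orbit_of_mem {y u : G} (hu : u ∈ orbit p F y) (k : ℕ) :
    (pMap p F)^[k] u ∈ orbit p F y :=
  orbit_iterate_le y k (iterate_mem_orbit_iterate hu k)

/-- The `p`-map is additive on an orbit, and perfectness provides the `p^k`-th roots of the
coefficients. -/
theorem exists_iterate_eq [CharP F p] [PerfectField F] {y u : G} {k : ℕ}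
    (hu : u ∈ orbit p F ((pMap p F)^[k] y)) : ∃ v ∈ orbit p F y, (pMap p F)^[k] v = u := by
  induction hu using Submodule.span_induction with
  | mem u hu =>
    obtain ⟨i, rfl⟩ := hu
    refine ⟨(pMap p F)^[i] y, iterate_mem_orbit _ _, ?_⟩
    change _ = (pMap p F)^[i] ((pMap p F)^[k] y)
    rw [← Function.iterate_add_apply, add_comm, Function.iterate_add_apply]
  | zero => exact ⟨0, zero_mem _, pMap_iterate_zero p F k⟩
  | add a b _ _ ha hb =>
    obtain ⟨v, hv, rfl⟩ := ha
    obtain ⟨w, hw, rfl⟩ := hb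
    exact ⟨v + w, add_mem hv hw, iterate_add_of_mem_orbit hv hw k⟩
  | smul c a _ ha =>
    obtain ⟨v, hv, rfl⟩ := ha
    have : ExpChar F p := ExpChar.prime Fact.out
    have : PerfectRing F p := PerfectField.toPerfectRing p
    obtain ⟨d, rfl⟩ := (bijective_iterateFrobenius F p k).2 c
    exact ⟨d • v, Submodule.smul_mem _ _ hv, by rw [pMap_iterate_smul]; rfl⟩

/-- The orbits of the iterates of `y` filter the orbit of `y` with steps of dimension at most one;
`e` is the level of `u` in this filtration. -/
theorem exists_lead {y u : G} {n : ℕ} (hn : (pMap p F)^[n] y = 0) (hu : u ∈ orbit p F y)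
    (h0 : u ≠ 0) : ∃ (e : ℕ) (c : F), e < n ∧ c ≠ 0 ∧
      u - c • (pMap p F)^[e] y ∈ orbit p F ((pMap p F)^[e + 1] y) := by
  induction n generalizing y with
  | zero =>
    rw [Function.iterate_zero, id_eq] at hn
    subst hn
    have : orbit p F (0 : G) ≤ ⊥ := orbit_le.2 fun i => by
      rw [pMap_iterate_zero]; exact zero_mem _
    exact absurd ((Submodule.mem_bot F).1 (this hu)) h0
  | succ n ih =>
    obtain ⟨c, hc⟩ := exists_sub_smul_mem_orbit hu
    by_cases h : c = 0
    · rw [h, zero_smul, sub_zero] at hc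
      obtain ⟨e, c, he, hc⟩ := ih hn hc
      exact ⟨e + 1, c, by omega, hc⟩
    · exact ⟨0, c, by omega, h, hc⟩

/-- A Nakayama argument. Applying the `p`-map to the given relation expresses each further iterate
through `W` and higher iterates; since these vanish eventually, descending induction puts all of
them in `W`. -/
theorem orbit_le_of_mem_sup {y : G} {n e : ℕ} (hn : (pMap p F)^[n] y = 0) {W : Submodule F G}
    (hW : W ≤ orbit p F y) (hWt : ∀ u ∈ W, pMap p F u ∈ W)
    (h : (pMap p F)^[e] y ∈ W ⊔ orbit p F ((pMap p F)^[e + 1] y)) :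
    orbit p F ((pMap p F)^[e] y) ≤ W := by
  have hWt' : ∀ k, ∀ u ∈ W, (pMap p F)^[k] u ∈ W := by
    intro k
    induction k with
    | zero => exact fun u hu => hu
    | succ k ih => exact fun u hu => ih _ (hWt u hu)
  have key : ∀ k, orbit p F ((pMap p F)^[n - k] ((pMap p F)^[e] y)) ≤ W := by
    intro k
    induction k with
    | zero =>
      rw [Nat.sub_zero, ← Function.iterate_add_apply, add_comm, Function.iterate_add_apply, hn,
        pMap_iterate_zero]
      refine orbit_le.2 fun i => ?_
      rw [pMap_iterate_zero]; exact zero_mem _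
    | succ k ih =>
      by_cases hk : n ≤ k
      · rwa [show n - (k + 1) = n - k by omega]
      obtain ⟨l, hl⟩ : ∃ l, n - k = l + 1 := ⟨n - k - 1, by omega⟩
      rw [show n - (k + 1) = l by omega]
      rw [hl] at ih
      rw [orbit_sup]
      rw [Function.iterate_succ_apply'] at ih
      refine sup_le ?_ ih
      rw [Submodule.span_singleton_le_iff_mem]
      obtain ⟨a, ha, b, hb, hab⟩ := Submodule.mem_sup.1 h
      rw [← hab, iterate_add_of_mem_orbit (hW ha) (orbit_iterate_le _ _ hb)]
      refine add_mem (hWt' _ _ ha) (ih ?_)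
      have := iterate_mem_orbit_iterate hb l
      rwa [Function.iterate_succ_apply', ← Function.iterate_succ_apply,
        Function.iterate_succ_apply'] at this
  have := key n
  rwa [Nat.sub_self] at this

theorem orbit_eq_of_lead {y u : G} {n e : ℕ} {c : F} (hn : (pMap p F)^[n] y = 0) (hc : c ≠ 0)
    (h : u - c • (pMap p F)^[e] y ∈ orbit p F ((pMap p F)^[e + 1] y)) :
    orbit p F u = orbit p F ((pMap p F)^[e] y) := by
  have hu : u ∈ orbit p F ((pMap p F)^[e] y) := by
    have := add_mem (orbit_iterate_antitone y (Nat.le_succ e) h)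
      (Submodule.smul_mem _ c (mem_orbit_self ((pMap p F)^[e] y)))
    rwa [sub_add_cancel] at this
  have hle : orbit p F u ≤ orbit p F ((pMap p F)^[e] y) :=
    orbit_le.2 fun i => iterate_mem_orbit_of_mem hu i
  refine le_antisymm hle (orbit_le_of_mem_sup hn (hle.trans (orbit_iterate_le _ _))
    (fun v hv => iterate_mem_orbit_of_mem hv 1) ?_)
  have h2 := Submodule.smul_mem _ c⁻¹ h
  rw [smul_sub, smul_smul, inv_mul_cancel₀ hc, one_smul] at h2
  refine Submodule.mem_sup.2 ⟨c⁻¹ • u, Submodule.smul_mem _ _ (mem_orbit_self u),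
    -(c⁻¹ • u - (pMap p F)^[e] y), neg_mem h2, by abel⟩

theorem orbit_eq_bot {x : G} (h : x = 0) : orbit p F x = ⊥ :=
  eq_bot_iff.2 (orbit_le.2 fun i => by rw [h, pMap_iterate_zero]; exact zero_mem _)

theorem finrank_sup_orbit [FiniteDimensional F G] {W : Submodule F G} {x : G} {m : ℕ}
    (hWt : ∀ u ∈ orbit p F x, u ∈ W → pMap p F u ∈ W) (hm : (pMap p F)^[m] x ∈ W)
    (hmin : ∀ i < m, (pMap p F)^[i] x ∉ W) :
    Module.finrank F (W ⊔ orbit p F x : Submodule F G) = Module.finrank F W + m := by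
  have hWt' : ∀ k, ∀ u ∈ orbit p F x, u ∈ W → (pMap p F)^[k] u ∈ W := by
    intro k
    induction k with
    | zero => exact fun u _ h => h
    | succ k ih => exact fun u hu h => ih _ (iterate_mem_orbit_of_mem hu 1) (hWt u hu h)
  have hle : orbit p F ((pMap p F)^[m] x) ≤ W :=
    orbit_le.2 fun i => hWt' i _ (iterate_mem_orbit _ _) hm
  have key : ∀ k ≤ m, Module.finrank F (W ⊔ orbit p F ((pMap p F)^[m - k] x) : Submodule F G) =
      Module.finrank F W + k := by
    intro k hk
    induction k with
    | zero => rw [Nat.sub_zero, sup_eq_left.2 hle, add_zero]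
    | succ k ih =>
      obtain ⟨l, hl⟩ : ∃ l, m - k = l + 1 := ⟨m - k - 1, by omega⟩
      rw [show m - (k + 1) = l by omega, orbit_sup, ← Function.iterate_succ_apply' (pMap p F),
        sup_comm (Submodule.span F _), ← sup_assoc]
      rw [hl] at ih
      -- A relation at level `l` would, after `m - 1 - l` applications of the `p`-map, put `x^[p]^(m
      -- - 1)` in `W`.
      have hnot : (pMap p F)^[l] x ∉ W ⊔ orbit p F ((pMap p F)^[l + 1] x) := by
        intro hmem
        obtain ⟨w, hw, b, hb, hab⟩ := Submodule.mem_sup.1 hmem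
        have hbx := orbit_iterate_le x _ hb
        have hwx : w ∈ orbit p F x := by
          rw [eq_sub_of_add_eq hab]
          exact sub_mem (iterate_mem_orbit _ _) hbx
        refine hmin (m - 1) (by omega) ?_
        rw [show m - 1 = (m - 1 - l) + l by omega, Function.iterate_add_apply, ← hab,
          iterate_add_of_mem_orbit hwx hbx]
        refine add_mem (hWt' _ _ hwx hw) (hle ?_)
        have := iterate_mem_orbit_iterate hb (m - 1 - l)
        rwa [← Function.iterate_add_apply, show m - 1 - l + (l + 1) = m by omega] at this
      have hne : (pMap p F)^[l] x ≠ 0 := fun h => hnot (h ▸ zero_mem _)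
      have hdis : Disjoint (W ⊔ orbit p F ((pMap p F)^[l + 1] x))
          (Submodule.span F {(pMap p F)^[l] x}) := (Submodule.disjoint_span_singleton' hne).2 hnot
      have := Submodule.finrank_sup_add_finrank_inf_eq (W ⊔ orbit p F ((pMap p F)^[l + 1] x))
          (Submodule.span F {(pMap p F)^[l] x})
      rw [hdis.eq_bot, finrank_bot, finrank_span_singleton hne, ih (by omega)] at this
      omega
  have := key m le_rfl
  rwa [Nat.sub_self] at this

theorem finrank_orbit [FiniteDimensional F G] {x : G} {m : ℕ} (hm : (pMap p F)^[m] x = 0)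
    (hmin : ∀ i < m, (pMap p F)^[i] x ≠ 0) : Module.finrank F (orbit p F x) = m := by
  have := finrank_sup_orbit (p := p) (W := (⊥ : Submodule F G)) (x := x) (m := m)
    (fun u _ hu => by
      rw [Submodule.mem_bot] at hu ⊢
      rw [hu, pMap_zero]) ((Submodule.mem_bot F).2 hm)
    (fun i hi h => hmin i hi ((Submodule.mem_bot F).1 h))
  rwa [bot_sup_eq, finrank_bot, zero_add] at this

theorem finrank_orbit_le [FiniteDimensional F G] {x : G} {m : ℕ} (hm : (pMap p F)^[m] x = 0) :
    Module.finrank F (orbit p F x) ≤ m := by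
  classical
  have hex : ∃ m, (pMap p F)^[m] x = 0 := ⟨m, hm⟩
  rw [finrank_orbit (Nat.find_spec hex) fun i hi => Nat.find_min hex hi]
  exact Nat.find_min' hex hm

theorem iterate_finrank_orbit [FiniteDimensional F G] {x : G} {k : ℕ}
    (hk : (pMap p F)^[k] x = 0) (i : ℕ) :
    (pMap p F)^[i] x = 0 ↔ Module.finrank F (orbit p F x) ≤ i := by
  classical
  have hex : ∃ m, (pMap p F)^[m] x = 0 := ⟨k, hk⟩
  refine ⟨fun h => finrank_orbit_le h, fun h => ?_⟩
  rw [finrank_orbit (Nat.find_spec hex) fun i hi => Nat.find_min hex hi] at h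
  obtain ⟨d, rfl⟩ := Nat.exists_eq_add_of_le h
  rw [add_comm, Function.iterate_add_apply, Nat.find_spec hex, pMap_iterate_zero]

end Orbit

/-! ### Two-generator presentations determine the algebra. -/

section Presentation

variable {p : ℕ} {F : Type u} [Field F] {G : Type v} [LieRing G] [LieAlgebra F G]
  [RestrictedLieAlgebra p F G]

variable (p) in
/-- Two generators of a restricted Lie algebra of dimension `m + n` with the relations
`⁅x, y⁆ = c • y^[p]^r`, `x^[p]^m = d • y^[p]^s` and `y^[p]^n = 0`, such that all `p`-th powers are
central. -/
structure IsPresentation (m n r s : ℕ) (c d : F) (x y : G) : Prop where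
  span : orbit p F x ⊔ orbit p F y = ⊤
  finrank_eq : Module.finrank F G = m + n
  central : ∀ i j, 0 < i ∨ 0 < j → ⁅(pMap p F)^[i] x, (pMap p F)^[j] y⁆ = 0
  lie_eq : ⁅x, y⁆ = c • (pMap p F)^[r] y
  iterate_left : (pMap p F)^[m] x = d • (pMap p F)^[s] y
  iterate_right : (pMap p F)^[n] y = 0

namespace IsPresentation

variable {m n r s : ℕ} {c d : F} {x y : G}

/-- The family of iterates of the generators. -/
def family (p : ℕ) (F : Type u) [Field F] [LieAlgebra F G] [RestrictedLieAlgebra p F G]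
    (m n : ℕ) (x y : G) : Fin m ⊕ Fin n → G :=
  Sum.elim (fun i => (pMap p F)^[i] x) fun j => (pMap p F)^[j] y

variable [Fact p.Prime]

theorem iterate_left_add (h : IsPresentation p m n r s c d x y) (i : ℕ) :
    (pMap p F)^[m + i] x = d ^ p ^ i • (pMap p F)^[i + s] y := by
  rw [add_comm, Function.iterate_add_apply, h.iterate_left, pMap_iterate_smul,
    ← Function.iterate_add_apply]

theorem iterate_right_add (h : IsPresentation p m n r s c d x y) (i : ℕ) :
    (pMap p F)^[n + i] y = 0 := by
  rw [add_comm, Function.iterate_add_apply, h.iterate_right, pMap_iterate_zero]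

theorem span_family (h : IsPresentation p m n r s c d x y) :
    ⊤ ≤ Submodule.span F (Set.range (family p F m n x y)) := by
  have hy : ∀ j, (pMap p F)^[j] y ∈ Submodule.span F (Set.range (family p F m n x y)) := by
    intro j
    rcases lt_or_ge j n with hj | hj
    · exact Submodule.subset_span ⟨Sum.inr ⟨j, hj⟩, rfl⟩
    · obtain ⟨l, rfl⟩ := Nat.exists_eq_add_of_le hj
      rw [h.iterate_right_add]; exact zero_mem _
  rw [← h.span]
  refine sup_le (orbit_le.2 fun i => ?_) (orbit_le.2 hy)
  rcases lt_or_ge i m with hi | hi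
  · exact Submodule.subset_span ⟨Sum.inl ⟨i, hi⟩, rfl⟩
  · obtain ⟨l, rfl⟩ := Nat.exists_eq_add_of_le hi
    rw [h.iterate_left_add]; exact Submodule.smul_mem _ _ (hy _)

/-- The basis of iterates of the generators. -/
noncomputable def basis (h : IsPresentation p m n r s c d x y) :
    Module.Basis (Fin m ⊕ Fin n) F G :=
  basisOfTopLeSpanOfCardEqFinrank (family p F m n x y) h.span_family (by
    rw [h.finrank_eq, Fintype.card_sum, Fintype.card_fin, Fintype.card_fin])

theorem basis_apply (h : IsPresentation p m n r s c d x y) (k : Fin m ⊕ Fin n) :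
    h.basis k = family p F m n x y k := by
  rw [basis, coe_basisOfTopLeSpanOfCardEqFinrank]

theorem mem_span (h : IsPresentation p m n r s c d x y) (g : G) : g ∈ Submodule.span F
    ((Set.range fun i => (pMap p F)^[i] x) ∪ Set.range fun i => (pMap p F)^[i] y) := by
  rw [Submodule.span_union]
  change g ∈ orbit p F x ⊔ orbit p F y
  rw [h.span]; trivial

variable {H : Type w} [LieRing H] [LieAlgebra F H] [RestrictedLieAlgebra p F H]

/-- Restricted Lie algebras with the same presentation are isomorphic. -/
theorem isIso (h : IsPresentation p m n r s c d x y) {x' y' : H}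
    (h' : IsPresentation p m n r s c d x' y') : IsIso p F G H := by
  have e₀ : ∃ e : G ≃ₗ[F] H, ∀ k, e (family p F m n x y k) = family p F m n x' y' k :=
    ⟨h.basis.equiv h'.basis (Equiv.refl _), fun k => by
      rw [← h.basis_apply, ← h'.basis_apply, Module.Basis.equiv_apply, Equiv.refl_apply]⟩
  obtain ⟨e, he⟩ := e₀
  have hy : ∀ j, e ((pMap p F)^[j] y) = (pMap p F)^[j] y' := by
    intro j
    rcases lt_or_ge j n with hj | hj
    · exact he (Sum.inr ⟨j, hj⟩)
    · obtain ⟨l, rfl⟩ := Nat.exists_eq_add_of_le hj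
      rw [h.iterate_right_add, h'.iterate_right_add, map_zero]
  have hx : ∀ i, e ((pMap p F)^[i] x) = (pMap p F)^[i] x' := by
    intro i
    rcases lt_or_ge i m with hi | hi
    · exact he (Sum.inl ⟨i, hi⟩)
    · obtain ⟨l, rfl⟩ := Nat.exists_eq_add_of_le hi
      rw [h.iterate_left_add, h'.iterate_left_add, map_smul, hy]
  have hxy : ∀ i j, e ⁅(pMap p F)^[i] x, (pMap p F)^[j] y⁆ =
      ⁅(pMap p F)^[i] x', (pMap p F)^[j] y'⁆ := by
    intro i j
    by_cases hij : 0 < i ∨ 0 < j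
    · rw [h.central i j hij, h'.central i j hij, map_zero]
    · obtain ⟨rfl, rfl⟩ : i = 0 ∧ j = 0 := by omega
      change e ⁅x, y⁆ = ⁅x', y'⁆
      rw [h.lie_eq, h'.lie_eq, map_smul, hy]
  have hlie : ∀ a b, e ⁅a, b⁆ = ⁅e a, e b⁆ := by
    intro a b
    induction h.mem_span a using Submodule.span_induction with
    | mem a ha =>
      induction h.mem_span b using Submodule.span_induction with
      | mem b hb =>
        rcases ha with ⟨i, rfl⟩ | ⟨i, rfl⟩ <;> rcases hb with ⟨j, rfl⟩ | ⟨j, rfl⟩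
        · simp only [hx, lie_iterate_self, map_zero]
        · simp only [hx, hy, hxy]
        · simp only [hx, hy]
          rw [← lie_skew, map_neg, hxy, lie_skew]
        · simp only [hy, lie_iterate_self, map_zero]
      | zero => simp
      | add b b' _ _ hb hb' => rw [lie_add, map_add, map_add, lie_add, hb, hb']
      | smul k b _ hb => rw [lie_smul, map_smul, map_smul, lie_smul, hb]
    | zero => simp
    | add b b' _ _ hb hb' => rw [add_lie, map_add, map_add, add_lie, hb, hb']
    | smul k b _ hb => rw [smul_lie, map_smul, map_smul, smul_lie, hb]
  let E : G ≃ₗ⁅F⁆ H := { e with map_lie' := fun {a b} => hlie a b }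
  refine ⟨E, fun g => ?_⟩
  have hEx : ∀ i, E ((pMap p F)^[i] x) = (pMap p F)^[i] x' := hx
  have hEy : ∀ i, E ((pMap p F)^[i] y) = (pMap p F)^[i] y' := hy
  induction h.mem_span g using Submodule.span_induction with
  | mem a ha =>
    rcases ha with ⟨i, rfl⟩ | ⟨i, rfl⟩
    · change E (pMap p F ((pMap p F)^[i] x)) = pMap p F (E ((pMap p F)^[i] x))
      rw [← Function.iterate_succ_apply' (pMap p F), hEx, hEx, Function.iterate_succ_apply']
    · change E (pMap p F ((pMap p F)^[i] y)) = pMap p F (E ((pMap p F)^[i] y))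
      rw [← Function.iterate_succ_apply' (pMap p F), hEy, hEy, Function.iterate_succ_apply']
  | zero => rw [pMap_zero, map_zero, pMap_zero]
  | add a b _ _ ha hb =>
    rw [pMap_add, map_add, map_add, map_add, pMap_add, ha, hb, map_sum]
    congr 1
    exact Finset.sum_congr rfl fun i _ => map_jacobsonS (E : G →ₗ⁅F⁆ H) a b i
  | smul k a _ ha => rw [pMap_smul, map_smul, map_smul, pMap_smul, ha]

end IsPresentation

end Presentation

/-! ### The restricted commutator ideal and the abelianization. -/

section Closure

variable {p : ℕ} {F : Type u} [Field F] {G : Type v} [LieRing G] [LieAlgebra F G]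
  [RestrictedLieAlgebra p F G]

theorem subset_closure (S : Set G) : S ⊆ closure p F S := by
  rw [closure, LieSubalgebra.coe_sInf]
  exact Set.subset_iInter₂ fun K hK => hK.1

theorem closure_le {S : Set G} {K : LieSubalgebra F G} (hS : S ⊆ K)
    (hK : ∀ x ∈ K, pMap p F x ∈ K) : closure p F S ≤ K := sInf_le ⟨hS, hK⟩

theorem pMap_mem_closure {S : Set G} {x : G} (hx : x ∈ closure p F S) :
    pMap p F x ∈ closure p F S := by
  rw [← SetLike.mem_coe, closure, LieSubalgebra.coe_sInf, Set.mem_iInter₂]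
  exact fun K hK => hK.2 x (closure_le hK.1 hK.2 hx)

variable (p F G) in
/-- The restricted ideal generated by all commutators. -/
noncomputable def commIdeal : LieIdeal F G :=
  { (closure p F {g : G | ∃ x y : G, ⁅x, y⁆ = g}).toSubmodule with
    lie_mem := fun {x m} _ => subset_closure _ ⟨x, m, rfl⟩ }

theorem lie_mem_commIdeal (x y : G) : ⁅x, y⁆ ∈ commIdeal p F G := subset_closure _ ⟨x, y, rfl⟩

theorem isRestrictedIdeal_commIdeal : IsRestrictedIdeal p (commIdeal p F G) :=
  fun _ hx => pMap_mem_closure hx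

end Closure

section Abelianization

variable {p : ℕ} {F : Type u} [Field F] {G : Type v} [LieRing G] [LieAlgebra F G]
  [RestrictedLieAlgebra p F G] {A : Type w} [Ring A] [Algebra F A]

theorem mul_comm_of_adjoin_eq_top {S : Set A} (hS : Algebra.adjoin F S = ⊤)
    (h : ∀ x ∈ S, ∀ y ∈ S, x * y = y * x) (a b : A) : a * b = b * a := by
  have key : ∀ c : A, (∀ x ∈ S, x * c = c * x) → ∀ b, b * c = c * b := by
    intro c hc b
    have hb : b ∈ Algebra.adjoin F S := hS ▸ Algebra.mem_top
    induction hb using Algebra.adjoin_induction with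
    | mem x hx => exact hc x hx
    | algebraMap r => exact Algebra.commutes r c
    | add x y _ _ hx hy => rw [add_mul, mul_add, hx, hy]
    | mul x y _ _ hx hy => rw [mul_assoc, hy, ← mul_assoc, hx, mul_assoc]
  exact key b (fun x hx => (key x (fun y hy => h y hy x hx) b).symm) a

theorem IsEnvelope.mul_comm {j : G →ₗ[F] A} (hj : IsEnvelope p j)
    (h : ∀ x y : G, ⁅x, y⁆ = 0) (a b : A) : a * b = b * a := by
  refine mul_comm_of_adjoin_eq_top hj.adjoin_eq_top ?_ a b
  rintro _ ⟨x, rfl⟩ _ ⟨y, rfl⟩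
  rw [← sub_eq_zero, ← hj.isRep.1, h, map_zero]

/-- The restricted quotient by the ideal generated by commutators. -/
@[reducible] noncomputable def abelianization :
    RestrictedLieAlgebra p F (G ⧸ commIdeal p F G) :=
  quotient (commIdeal p F G) isRestrictedIdeal_commIdeal

attribute [local instance] abelianization

theorem lie_abelianization (x y : G ⧸ commIdeal p F G) : ⁅x, y⁆ = 0 := by
  obtain ⟨x, rfl⟩ := LieSubmodule.Quotient.surjective_mk' _ x
  obtain ⟨y, rfl⟩ := LieSubmodule.Quotient.surjective_mk' _ y
  exact (LieSubmodule.Quotient.mk_eq_zero').2 (lie_mem_commIdeal x y)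

theorem envι_abelianization_mul_comm (a b : EnvelopingAlgebra p F (G ⧸ commIdeal p F G)) :
    a * b = b * a := isEnvelope_envι.mul_comm lie_abelianization a b

theorem IsEnvelope.exists_abelianization {j : G →ₗ[F] A} (hj : IsEnvelope p j) :
    ∃ π : A →ₐ[F] EnvelopingAlgebra p F (G ⧸ commIdeal p F G),
      (∀ x : G, π (j x) = envι p F (G ⧸ commIdeal p F G) (LieSubmodule.Quotient.mk x)) ∧
        Function.Surjective π := by
  have hrep := isRep_envι p F (G := G ⧸ commIdeal p F G)
  obtain ⟨π, hπ⟩ := hj.exists_lift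
    (f := envι p F (G ⧸ commIdeal p F G) ∘ₗ
      (LieSubmodule.Quotient.mk' (commIdeal p F G) : G →ₗ[F] G ⧸ commIdeal p F G))
    ⟨fun x y => hrep.1 (LieSubmodule.Quotient.mk x) (LieSubmodule.Quotient.mk y), fun x => hrep.2 (LieSubmodule.Quotient.mk x)⟩
  refine ⟨π, hπ, ?_⟩
  rw [← AlgHom.range_eq_top, eq_top_iff, ← adjoin_range_envι, Algebra.adjoin_le_iff]
  rintro _ ⟨q, rfl⟩
  obtain ⟨x, rfl⟩ := LieSubmodule.Quotient.surjective_mk' _ q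
  exact ⟨j x, hπ x⟩

/-- `A / zA` is commutative, so it receives a map from the enveloping algebra of the abelianization;
conversely `z` is a commutator and dies there. This identifies the kernel of `π`. -/
theorem IsEnvelope.exists_eq_mul_iff {j : G →ₗ[F] A} (hj : IsEnvelope p j)
    {π : A →ₐ[F] EnvelopingAlgebra p F (G ⧸ commIdeal p F G)}
    (hπ : ∀ x : G, π (j x) = envι p F (G ⧸ commIdeal p F G) (LieSubmodule.Quotient.mk x))
    {z : A} (hz : ∀ a, z * a = a * z) (hz' : ∃ a b, z = a * b - b * a)
    (hcomm : ∀ a b, ∃ c, a * b - b * a = z * c) (hp : p ≠ 0) (a : A) :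
    π a = 0 ↔ ∃ c, a = z * c := by
  constructor
  swap
  · rintro ⟨c, rfl⟩
    obtain ⟨u, v, rfl⟩ := hz'
    rw [map_mul, map_sub, map_mul, map_mul, envι_abelianization_mul_comm (π u), sub_self, zero_mul]
  intro ha
  let I : Ideal A :=
    { carrier := {a | ∃ c, a = z * c}
      add_mem' := by
        rintro _ _ ⟨c, rfl⟩ ⟨d, rfl⟩
        exact ⟨c + d, (mul_add _ _ _).symm⟩
      zero_mem' := ⟨0, (mul_zero z).symm⟩
      smul_mem' := by
        rintro b _ ⟨c, rfl⟩
        exact ⟨b * c, by rw [smul_eq_mul, ← mul_assoc, ← hz, mul_assoc]⟩ }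
  have hI : ∀ a, a ∈ I ↔ ∃ c, a = z * c := fun _ => Iff.rfl
  have : I.IsTwoSided := ⟨by
    rintro _ b ⟨c, rfl⟩
    exact ⟨c * b, mul_assoc _ _ _⟩⟩
  have hmk : ∀ a, Ideal.Quotient.mkₐ F I a = 0 ↔ ∃ c, a = z * c := fun a =>
    Ideal.Quotient.eq_zero_iff_mem
  have hQ : ∀ a b, Ideal.Quotient.mkₐ F I a * Ideal.Quotient.mkₐ F I b =
      Ideal.Quotient.mkₐ F I b * Ideal.Quotient.mkₐ F I a := fun a b => by
    rw [← sub_eq_zero, ← map_mul, ← map_mul, ← map_sub, hmk]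
    exact hcomm a b
  let K : LieSubalgebra F G :=
    { LinearMap.ker ((Ideal.Quotient.mkₐ F I).toLinearMap ∘ₗ j) with
      lie_mem' := fun {x y} _ _ => by
        change Ideal.Quotient.mkₐ F I (j ⁅x, y⁆) = 0
        rw [hj.isRep.1, map_sub, map_mul, map_mul, hQ, sub_self] }
  have hK : commIdeal p F G ≤ LinearMap.ker ((Ideal.Quotient.mkₐ F I).toLinearMap ∘ₗ j) := by
    refine closure_le (K := K) ?_ fun x hx => ?_
    · rintro _ ⟨x, y, rfl⟩
      change Ideal.Quotient.mkₐ F I (j ⁅x, y⁆) = 0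
      rw [hj.isRep.1, map_sub, map_mul, map_mul, hQ, sub_self]
    · change Ideal.Quotient.mkₐ F I (j x) = 0 at hx
      change Ideal.Quotient.mkₐ F I (j (pMap p F x)) = 0
      rw [hj.isRep.2, map_pow, hx, zero_pow hp]
  obtain ⟨g, hg⟩ := RestrictedLieAlgebra.exists_lift (p := p)
    (f := Submodule.liftQ (commIdeal p F G).toSubmodule
      ((Ideal.Quotient.mkₐ F I).toLinearMap ∘ₗ j) hK) (G := G ⧸ commIdeal p F G) (by
        refine ⟨fun x y => ?_, fun x => ?_⟩
        · obtain ⟨x, rfl⟩ := LieSubmodule.Quotient.surjective_mk' _ x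
          obtain ⟨y, rfl⟩ := LieSubmodule.Quotient.surjective_mk' _ y
          change Ideal.Quotient.mkₐ F I (j ⁅x, y⁆) = Ideal.Quotient.mkₐ F I (j x) *
            Ideal.Quotient.mkₐ F I (j y) - Ideal.Quotient.mkₐ F I (j y) *
            Ideal.Quotient.mkₐ F I (j x)
          rw [hj.isRep.1, map_sub, map_mul, map_mul]
        · obtain ⟨x, rfl⟩ := LieSubmodule.Quotient.surjective_mk' _ x
          change Ideal.Quotient.mkₐ F I (j (pMap p F x)) = Ideal.Quotient.mkₐ F I (j x) ^ p
          rw [hj.isRep.2, map_pow])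
  have hcomp : g.comp π = Ideal.Quotient.mkₐ F I := by
    refine AlgHom.ext_of_adjoin_eq_top hj.adjoin_eq_top ?_
    rintro _ ⟨x, rfl⟩
    rw [AlgHom.comp_apply, hπ, hg]
    rfl
  rw [← hmk, ← hcomp, AlgHom.comp_apply, ha, map_zero]

end Abelianization

/-! ### Augmented algebras with nilpotent augmentation ideal. -/

section Local

variable {F : Type u} [Field F] {A : Type w} [Ring A] [Algebra F A] {ε : A →ₐ[F] F}

theorem sub_algebraMap_mem_aug (a : A) : a - algebraMap F A (ε a) ∈ aug ε := by
  rw [mem_aug, map_sub, AlgHom.commutes]; exact sub_self _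

theorem isNilpotent_of_mem_aug {n : ℕ} (hn : aug ε ^ n = ⊥) {a : A} (ha : a ∈ aug ε) :
    a ^ n = 0 := by
  rw [← Submodule.mem_bot F, ← hn]
  exact Submodule.pow_mem_pow _ ha n

theorem isUnit_of_augmentation_ne_zero {n : ℕ} (hn : aug ε ^ n = ⊥) {a : A} (ha : ε a ≠ 0) :
    IsUnit a := by
  have h1 : IsUnit (algebraMap F A (ε a)) := (isUnit_iff_ne_zero.2 ha).map _
  have h2 : IsNilpotent (a - algebraMap F A (ε a)) :=
    ⟨n, isNilpotent_of_mem_aug hn (sub_algebraMap_mem_aug a)⟩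
  have h3 := h2.isUnit_add_left_of_commute h1 (Algebra.commutes (ε a) _).symm
  rwa [add_sub_cancel] at h3

/-- Otherwise `a - b` would be a unit annihilated by `f`. Scalar coefficients of congruences are
compared this way below. -/
theorem augmentation_eq_zero_of_mul_eq {n : ℕ} (hn : aug ε ^ n = ⊥) {f a b : A} (hf : f ≠ 0)
    (h : f * a = f * b) (hb : ε b = 0) : ε a = 0 := by
  by_contra ha
  have hu : IsUnit (a - b) := isUnit_of_augmentation_ne_zero hn (by rwa [map_sub, hb, sub_zero])
  refine hf ((hu.mul_left_eq_zero).1 ?_)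
  rw [mul_sub, h, sub_self]

theorem top_eq_one_sup_aug (ε : A →ₐ[F] F) : (⊤ : Submodule F A) = 1 ⊔ aug ε := by
  refine (eq_top_iff.2 fun a _ => ?_).symm
  rw [← add_sub_cancel (algebraMap F A (ε a)) a]
  exact Submodule.add_mem_sup (Submodule.algebraMap_mem _) (sub_algebraMap_mem_aug a)

theorem aug_pow_le {T : Submodule F A} (hT : T ≤ aug ε) (h : aug ε ≤ T ⊔ aug ε ^ 2) (k : ℕ) :
    aug ε ^ k ≤ T ^ k ⊔ aug ε ^ (k + 1) := by
  induction k with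
  | zero => exact le_sup_of_le_left (by simp)
  | succ k ih =>
    have hTk : T ^ k ≤ aug ε ^ k := pow_le_pow_left' hT k
    calc aug ε ^ (k + 1) = aug ε ^ k * aug ε := pow_succ _ _
      _ ≤ (T ^ k ⊔ aug ε ^ (k + 1)) * (T ⊔ aug ε ^ 2) := mul_le_mul' ih h
      _ ≤ T ^ (k + 1) ⊔ aug ε ^ (k + 1 + 1) := by
        rw [Submodule.sup_mul, Submodule.mul_sup, Submodule.mul_sup]
        refine sup_le (sup_le (le_sup_of_le_left (pow_succ _ _).ge)
          (le_sup_of_le_right ?_)) (le_sup_of_le_right (sup_le ?_ ?_))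
        · rw [show k + 1 + 1 = k + 2 by rfl, pow_add]; exact mul_le_mul' hTk le_rfl
        · rw [pow_succ _ (k + 1)]; exact mul_le_mul' le_rfl hT
        · rw [pow_succ (aug ε) 1, pow_one, ← mul_assoc, ← pow_succ]
          refine (mul_le_mul' le_rfl (le_top : aug ε ≤ ⊤)).trans ?_
          rw [pow_succ _ (k + 1), mul_assoc, aug_mul_top]

/-- Nakayama for a nilpotent ideal: the powers of ω lie in `S` by descending induction from `ω^n =
0`, since `ω^k` is `T^k` modulo `ω^(k+1)`. -/
theorem Subalgebra.eq_top_of_aug_le {n : ℕ} (hn : aug ε ^ n = ⊥) {S : Subalgebra F A}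
    {T : Submodule F A} (hTS : T ≤ Subalgebra.toSubmodule S) (hT : T ≤ aug ε)
    (h : aug ε ≤ T ⊔ aug ε ^ 2) : S = ⊤ := by
  have hpow := aug_pow_le hT h
  have hTk : ∀ k, T ^ k ≤ Subalgebra.toSubmodule S := by
    intro k
    induction k with
    | zero => rw [pow_zero, Submodule.one_le]; exact S.one_mem
    | succ k ih =>
      rw [pow_succ]
      exact Submodule.mul_le.2 fun a ha b hb => S.mul_mem (ih ha) (hTS hb)
  have hdown : ∀ i, aug ε ^ (n - i) ≤ Subalgebra.toSubmodule S := by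
    intro i
    induction i with
    | zero => rw [Nat.sub_zero, hn]; exact bot_le
    | succ i ih =>
      by_cases hi : n ≤ i
      · rwa [show n - (i + 1) = n - i by omega]
      refine (hpow _).trans (sup_le (hTk _) ?_)
      rwa [show n - (i + 1) + 1 = n - i by omega]
  have h0 := hdown n
  refine eq_top_iff.2 fun a _ => ?_
  rw [← add_sub_cancel (algebraMap F A (ε a)) a]
  refine S.add_mem (S.algebraMap_mem _) ?_
  have h1 := hdown (n - 1)
  rcases Nat.eq_zero_or_pos n with rfl | hpos
  · have : (1 : A) ∈ (⊥ : Submodule F A) := by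
      rw [← hn, pow_zero]; exact Submodule.one_le.1 le_rfl
    have h10 : (1 : A) = 0 := (Submodule.mem_bot F).1 this
    rw [← mul_one (a - _), h10, mul_zero]; exact S.zero_mem
  · rw [show n - (n - 1) = 1 by omega, pow_one] at h1
    exact h1 (sub_algebraMap_mem_aug a)

end Local

/-! ### The data of a noncommutative envelope that refer to the algebra alone. -/

section Frame

variable {F : Type u} [Field F] {A : Type w} [Ring A] [Algebra F A]

/-- The properties of the restricted enveloping algebra of a nonabelian metacyclic `p`-nilpotent
restricted Lie algebra that do not mention the Lie algebra. -/
structure IsFrame (p ν : ℕ) (ε : A →ₐ[F] F) (z : A) : Prop where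
  exists_pow : ∃ n, aug ε ^ n = ⊥
  central : ∀ a, z * a = a * z
  isComm : ∃ a b, z = a * b - b * a
  comm : ∀ a b, ∃ c, a * b - b * a = z * c
  pos : 0 < ν
  pow_eq_zero_iff : ∀ i, z ^ p ^ i = 0 ↔ ν ≤ i
  finrank_eq : Module.finrank F A =
    p ^ ν * Module.finrank F (A ⧸ LinearMap.range (LinearMap.mulLeft F z))
  gen : ∃ X Y, aug ε ≤ Submodule.span F {X, Y} ⊔ aug ε ^ 2

theorem IsFrame.ne_zero {p ν : ℕ} {ε : A →ₐ[F] F} {z : A} (h : IsFrame p ν ε z) : z ≠ 0 := by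
  intro h0
  have := (h.pow_eq_zero_iff 0).1 (by rw [h0, pow_zero, pow_one])
  have := h.pos
  omega

theorem IsFrame.augmentation_eq_zero {p ν : ℕ} {ε : A →ₐ[F] F} {z : A} (h : IsFrame p ν ε z) :
    ε z = 0 := by
  obtain ⟨a, b, rfl⟩ := h.isComm
  rw [map_sub, map_mul, map_mul, mul_comm, sub_self]

end Frame

/-! ### What a frame says about a Lie algebra with the given envelope. -/

section Envelope

variable {p : ℕ} [Fact p.Prime] {F : Type u} [Field F] [CharP F p] {G : Type v} [LieRing G]
  [LieAlgebra F G] [RestrictedLieAlgebra p F G] {A : Type w} [Ring A] [Algebra F A]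
  [FiniteDimensional F G] {j : G →ₗ[F] A} {k : ℕ}

theorem IsEnvelope.injective (hj : IsEnvelope p j) (hk : ∀ x : G, (pMap p F)^[k] x = 0) :
    Function.Injective j := by
  obtain ⟨e, he⟩ := hj
  intro x y hxy
  refine envι_injective_of_finite hk (e.injective ?_)
  rw [he, he, hxy]

theorem IsEnvelope.finrank_eq (hj : IsEnvelope p j) (hk : ∀ x : G, (pMap p F)^[k] x = 0) :
    Module.Finite F A ∧ Module.finrank F A = p ^ Module.finrank F G := by
  obtain ⟨e, he⟩ := hj
  obtain ⟨h1, h2⟩ := finrank_envelopingAlgebra _ G k hk rfl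
  exact ⟨Module.Finite.equiv e.toLinearEquiv, by rw [← h2]; exact e.toLinearEquiv.finrank_eq.symm⟩

theorem restrict_iterate (K : LieSubalgebra F G) (hK : ∀ x ∈ K, pMap p F x ∈ K) (i : ℕ) (x : K) :
    letI := restrict K hK
    (((pMap p F)^[i] x : K) : G) = (pMap p F)^[i] (x : G) := by
  letI := restrict K hK
  induction i generalizing x with
  | zero => rfl
  | succ i ih => exact ih _

/-- A restricted subalgebra that generates modulo the square of the augmentation ideal is the
whole restricted Lie algebra. -/
theorem IsEnvelope.eq_top_of_generates (hj : IsEnvelope p j)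
    (hk : ∀ x : G, (pMap p F)^[k] x = 0) {ε : A →ₐ[F] F} (K : LieSubalgebra F G)
    (hK : ∀ x ∈ K, pMap p F x ∈ K) (h : ∀ x, ∃ y ∈ K, j x - j y ∈ aug ε ^ 2) : K = ⊤ := by
  letI := restrict K hK
  have : FiniteDimensional F K := inferInstanceAs (FiniteDimensional F K.toSubmodule)
  obtain ⟨hfin, hrank⟩ := hj.finrank_eq hk
  have hnt : Nontrivial A := ε.toRingHom.domain_nontrivial
  have hε : ∀ x, ε (j x) = 0 := hj.isRep.map_eq_zero hk ε
  obtain ⟨n, hn⟩ := exists_aug_pow_eq_bot hj.isRep hj.adjoin_eq_top hk ε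
  have hrep : IsRep p (j ∘ₗ K.toSubmodule.subtype : K →ₗ[F] A) :=
    ⟨fun x y => hj.isRep.1 x y, fun x => hj.isRep.2 x⟩
  obtain ⟨g, hg⟩ := RestrictedLieAlgebra.exists_lift hrep
  have haug : aug ε ≤ Submodule.map j K.toSubmodule ⊔ aug ε ^ 2 := by
    have h1 : LinearMap.range j ≤ Submodule.map j K.toSubmodule ⊔ aug ε ^ 2 := by
      rintro _ ⟨x, rfl⟩
      obtain ⟨y, hy, hxy⟩ := h x
      rw [← add_sub_cancel (j y) (j x)]
      exact Submodule.add_mem_sup ⟨y, hy, rfl⟩ hxy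
    have h2 := aug_eq_top_mul_range hj.adjoin_eq_top hε
    refine h2.le.trans ?_
    rw [top_eq_one_sup_aug ε, Submodule.sup_mul, one_mul]
    refine sup_le h1 (le_sup_of_le_right ?_)
    rw [pow_two]
    refine mul_le_mul' le_rfl ?_
    rintro _ ⟨x, rfl⟩
    exact hε x
  have hsurj : g.range = ⊤ := by
    refine Subalgebra.eq_top_of_aug_le hn (T := Submodule.map j K.toSubmodule) ?_ ?_ haug
    · rintro _ ⟨x, hx, rfl⟩
      exact ⟨envι p F K ⟨x, hx⟩, hg _⟩
    · rintro _ ⟨x, hx, rfl⟩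
      exact hε x
  obtain ⟨hfin', hrank'⟩ := finrank_envelopingAlgebra (p := p) (F := F) _ K k
    (fun x => Subtype.ext ((restrict_iterate K hK k x).trans (hk x))) rfl
  -- The envelope of `K` maps onto `A`; comparing `p ^ dim K` with `p ^ dim G` forces `K = G`.
  have hle := LinearMap.finrank_le_finrank_of_surjective (f := g.toLinearMap)
    ((AlgHom.range_eq_top g).1 hsurj)
  rw [hrank, hrank'] at hle
  have hle' := (Nat.pow_le_pow_iff_right (Fact.out : p.Prime).one_lt).1 hle
  have : K.toSubmodule = ⊤ := Submodule.eq_top_of_finrank_eq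
    (le_antisymm (Submodule.finrank_le _) hle')
  exact LieSubalgebra.toSubmodule_injective this

attribute [local instance] abelianization

/-- `zA` is the kernel of the map to the envelope of the abelianization. Poincaré-Birkhoff-Witt for
the latter supplies both the dimension count and the fact that an element of `G` dying there lies in
the commutator ideal. -/
theorem IsEnvelope.finrank_commIdeal (hj : IsEnvelope p j) (hk : ∀ x : G, (pMap p F)^[k] x = 0)
    {z : A} (hz : ∀ a, z * a = a * z) (hz' : ∃ a b, z = a * b - b * a)
    (hcomm : ∀ a b, ∃ c, a * b - b * a = z * c) :
    (∀ x, x ∈ commIdeal p F G ↔ ∃ c, j x = z * c) ∧ Module.finrank F A =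
      p ^ Module.finrank F (commIdeal p F G) *
        Module.finrank F (A ⧸ LinearMap.range (LinearMap.mulLeft F z)) := by
  obtain ⟨π, hπ, hπs⟩ := hj.exists_abelianization
  have hker := hj.exists_eq_mul_iff hπ hz hz' hcomm (Fact.out : p.Prime).ne_zero
  have hk' : ∀ x : G ⧸ commIdeal p F G, (pMap p F)^[k] x = 0 := by
    intro q
    obtain ⟨x, rfl⟩ := LieSubmodule.Quotient.surjective_mk' _ q
    refine (quotient_pMap_mk _ isRestrictedIdeal_commIdeal k x).trans ?_
    rw [hk]; rfl
  refine ⟨fun x => ?_, ?_⟩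
  · rw [← hker, hπ, ← LieSubmodule.Quotient.mk_eq_zero']
    refine ⟨fun h => by rw [h, map_zero], fun h => envι_injective_of_finite hk' ?_⟩
    rw [h, map_zero]
  · have hrange : LinearMap.range (LinearMap.mulLeft F z) = LinearMap.ker π.toLinearMap := by
      ext a
      rw [LinearMap.mem_ker, AlgHom.toLinearMap_apply, hker]
      exact ⟨fun ⟨c, hc⟩ => ⟨c, hc.symm⟩, fun ⟨c, hc⟩ => ⟨c, hc.symm⟩⟩
    rw [(Submodule.quotEquivOfEq _ _ hrange).finrank_eq,
      (LinearMap.quotKerEquivOfSurjective π.toLinearMap hπs).finrank_eq,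
      (finrank_envelopingAlgebra _ (G ⧸ commIdeal p F G) k hk' rfl).2, (hj.finrank_eq hk).2,
      ← pow_add]
    congr 1
    have := Submodule.finrank_quotient_add_finrank (commIdeal p F G).toSubmodule
    rw [add_comm] at this
    exact this.symm

variable {ν : ℕ} {ε : A →ₐ[F] F} {z : A}

theorem IsFrame.mem_commIdeal_iff (hA : IsFrame p ν ε z) (hj : IsEnvelope p j)
    (hk : ∀ x : G, (pMap p F)^[k] x = 0) (x : G) :
    x ∈ commIdeal p F G ↔ ∃ c, j x = z * c :=
  (hj.finrank_commIdeal hk hA.central hA.isComm hA.comm).1 x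

theorem IsFrame.finrank_commIdeal (hA : IsFrame p ν ε z) (hj : IsEnvelope p j)
    (hk : ∀ x : G, (pMap p F)^[k] x = 0) : Module.finrank F (commIdeal p F G) = ν := by
  have h1 := (hj.finrank_commIdeal hk hA.central hA.isComm hA.comm).2
  have h2 := (hj.finrank_eq hk).2
  have hp := (Fact.out : p.Prime)
  have hpos : 0 < Module.finrank F (A ⧸ LinearMap.range (LinearMap.mulLeft F z)) := by
    rcases Nat.eq_zero_or_pos
      (Module.finrank F (A ⧸ LinearMap.range (LinearMap.mulLeft F z))) with h | h
    · rw [h, mul_zero, h2] at h1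
      exact absurd h1 (pow_ne_zero _ hp.ne_zero)
    · exact h
  rw [hA.finrank_eq] at h1
  exact (Nat.pow_right_injective hp.two_le (Nat.eq_of_mul_eq_mul_right hpos h1)).symm

theorem IsFrame.iterate_eq_zero_iff (hA : IsFrame p ν ε z) (hj : IsEnvelope p j)
    (hk : ∀ x : G, (pMap p F)^[k] x = 0) {x : G} {u : A} (hu : ε u ≠ 0) (h : j x = z * u)
    (i : ℕ) : (pMap p F)^[i] x = 0 ↔ ν ≤ i := by
  obtain ⟨n, hn⟩ := hA.exists_pow
  have hunit := (isUnit_of_augmentation_ne_zero hn hu).pow (p ^ i)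
  rw [← hA.pow_eq_zero_iff, ← map_eq_zero_iff j (hj.injective hk), hj.isRep.map_iterate, h,
    Commute.mul_pow (hA.central u), hunit.mul_left_eq_zero]

/-- The orbit is contained in the commutator ideal, and both have dimension `ν`: `x` is a unit
multiple of the central element `z`, so its iterates vanish exactly when those of `z` do. -/
theorem IsFrame.commIdeal_eq_orbit (hA : IsFrame p ν ε z) (hj : IsEnvelope p j)
    (hk : ∀ x : G, (pMap p F)^[k] x = 0) {x : G} {u : A} (hu : ε u ≠ 0) (h : j x = z * u) :
    (commIdeal p F G).toSubmodule = orbit p F x := by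
  have hle : orbit p F x ≤ (commIdeal p F G).toSubmodule := by
    refine orbit_le.2 fun i => ?_
    induction i with
    | zero => exact (hA.mem_commIdeal_iff hj hk x).2 ⟨u, h⟩
    | succ i ih =>
      rw [Function.iterate_succ_apply']; exact isRestrictedIdeal_commIdeal _ ih
  refine (Submodule.eq_of_le_of_finrank_eq hle ?_).symm
  have h1 : Module.finrank F (commIdeal p F G).toSubmodule = ν := hA.finrank_commIdeal hj hk
  rw [h1]
  have h2 := hA.iterate_eq_zero_iff hj hk hu h
  exact finrank_orbit ((h2 ν).2 le_rfl) fun i hi h3 => by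
    have := (h2 i).1 h3
    omega

end Envelope

/-! ### Calculus of `p`-th powers modulo zω. -/

section PowerCalculus

variable {p ν : ℕ} {F : Type u} [Field F] {A : Type w} [Ring A] [Algebra F A] {ε : A →ₐ[F] F}
  {z : A}

/-- The subspace `z ω`, where `ω` is the augmentation ideal. -/
def mulAug (ε : A →ₐ[F] F) (z : A) : Submodule F A :=
  Submodule.map (LinearMap.mulLeft F z) (aug ε)

theorem mem_mulAug {a : A} : a ∈ mulAug ε z ↔ ∃ v, ε v = 0 ∧ z * v = a := Iff.rfl

theorem augmentation_eq_zero_of_mem_mulAug {a : A} (ha : a ∈ mulAug ε z) : ε a = 0 := by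
  obtain ⟨v, hv, rfl⟩ := mem_mulAug.1 ha
  rw [map_mul, hv, mul_zero]

theorem mul_mem_mulAug_right {a : A} (ha : a ∈ mulAug ε z) (b : A) : a * b ∈ mulAug ε z := by
  obtain ⟨v, hv, rfl⟩ := mem_mulAug.1 ha
  exact ⟨v * b, mem_aug.2 (by rw [map_mul, hv, zero_mul]), (mul_assoc _ _ _).symm⟩

theorem mem_aug_sq_of_mem {a b : A} (ha : ε a = 0) (hb : ε b = 0) : a * b ∈ aug ε ^ 2 := by
  rw [pow_two]
  exact Submodule.mul_mem_mul ha hb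

theorem augmentation_eq_zero_of_mem_sq {a : A} (ha : a ∈ aug ε ^ 2) : ε a = 0 := by
  rw [pow_two] at ha
  exact (Submodule.mul_le.2 fun a ha b _ => by
    rw [mem_aug] at ha ⊢
    rw [map_mul, ha, zero_mul] : aug ε * aug ε ≤ aug ε) ha

theorem mul_mem_aug_sq_right {a : A} (ha : a ∈ aug ε ^ 2) (b : A) : a * b ∈ aug ε ^ 2 := by
  have : aug ε ^ 2 * ⊤ = aug ε ^ 2 := by rw [pow_two, mul_assoc, aug_mul_top]
  rw [← this]
  exact Submodule.mul_mem_mul ha trivial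

theorem mul_mem_aug_sq_left {a : A} (ha : a ∈ aug ε ^ 2) (b : A) : b * a ∈ aug ε ^ 2 := by
  have : ⊤ * aug ε ^ 2 = aug ε ^ 2 := by rw [pow_two, ← mul_assoc, top_mul_aug]
  rw [← this]
  exact Submodule.mul_mem_mul trivial ha

theorem aug_pow_le_sq (k : ℕ) : aug ε ^ (2 + k) ≤ aug ε ^ 2 := by
  rw [pow_add]
  exact Submodule.mul_le.2 fun a ha b _ => mul_mem_aug_sq_right ha b

namespace IsFrame

theorem mul_mem_mulAug_left (hA : IsFrame p ν ε z) {a : A} (b : A) (ha : a ∈ mulAug ε z) :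
    b * a ∈ mulAug ε z := by
  obtain ⟨v, hv, rfl⟩ := mem_mulAug.1 ha
  exact ⟨b * v, mem_aug.2 (by rw [map_mul, hv, mul_zero]), by
    rw [LinearMap.mulLeft_apply, ← mul_assoc, ← mul_assoc, hA.central]⟩

theorem commutator_mul_mem (hA : IsFrame p ν ε z) {c : A} (hc : ε c = 0) (a b : A) :
    (a * b - b * a) * c ∈ mulAug ε z := by
  obtain ⟨d, hd⟩ := hA.comm a b
  exact ⟨d * c, mem_aug.2 (by rw [map_mul, hc, mul_zero]), by
    rw [hd, LinearMap.mulLeft_apply, mul_assoc]⟩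

theorem mul_commutator_mem (hA : IsFrame p ν ε z) {c : A} (hc : ε c = 0) (a b : A) :
    c * (a * b - b * a) ∈ mulAug ε z := by
  obtain ⟨d, hd⟩ := hA.comm a b
  exact ⟨c * d, mem_aug.2 (by rw [map_mul, hc, zero_mul]), by
    rw [hd, LinearMap.mulLeft_apply, ← mul_assoc, ← mul_assoc, hA.central]⟩

/-- The square of the augmentation ideal is central modulo `z ω`. -/
theorem commutator_mem (hA : IsFrame p ν ε z) {b : A} (hb : b ∈ aug ε ^ 2) (a : A) :
    a * b - b * a ∈ mulAug ε z := by
  rw [pow_two] at hb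
  induction hb using Submodule.mul_induction_on' with
  | mem_mul_mem m hm n hn =>
    have : a * (m * n) - m * n * a = (a * m - m * a) * n + m * (a * n - n * a) := by noncomm_ring
    rw [this]
    exact add_mem (hA.commutator_mul_mem hn _ _) (hA.mul_commutator_mem hm _ _)
  | add x _ y _ hx hy =>
    have : a * (x + y) - (x + y) * a = (a * x - x * a) + (a * y - y * a) := by noncomm_ring
    rw [this]
    exact add_mem hx hy

/-- Reordering `(ab)^(n+1)` costs the term `a^n (b^n a - a b^n) b`, where the commutator lies in
`zA` and `a^n` in ω. This needs `n > 0`, the case `n = 0` being trivial. -/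
theorem mul_pow_sub_mem (hA : IsFrame p ν ε z) {a : A} (ha : ε a = 0) (b : A) {n : ℕ} (hn : 0 < n) :
    (a * b) ^ n - a ^ n * b ^ n ∈ mulAug ε z := by
  induction n with
  | zero => omega
  | succ n ih =>
    rcases Nat.eq_zero_or_pos n with rfl | hpos
    · simp
    have : (a * b) ^ (n + 1) - a ^ (n + 1) * b ^ (n + 1) =
        ((a * b) ^ n - a ^ n * b ^ n) * (a * b) + a ^ n * (b ^ n * a - a * b ^ n) * b := by
      rw [pow_succ, pow_succ a, pow_succ b]; noncomm_ring
    rw [this]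
    refine add_mem (mul_mem_mulAug_right (ih hpos) _)
      (mul_mem_mulAug_right (hA.mul_commutator_mem ?_ _ _) _)
    rw [map_pow, ha, zero_pow hpos.ne']

/-- The two-sided ideal `z ω`. -/
def mulAugIdeal (hA : IsFrame p ν ε z) : Ideal A :=
  { mulAug ε z with smul_mem' := fun b _ ha => hA.mul_mem_mulAug_left b ha }

theorem add_pow_char_pow_sub_mem [Fact p.Prime] [CharP F p] (hA : IsFrame p ν ε z) (a : A) {b : A}
    (hb : b ∈ aug ε ^ 2) (r : ℕ) :
    (a + b) ^ p ^ r - (a ^ p ^ r + b ^ p ^ r) ∈ mulAug ε z := by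
  have hI : ∀ a, a ∈ hA.mulAugIdeal ↔ a ∈ mulAug ε z := fun _ => Iff.rfl
  have : hA.mulAugIdeal.IsTwoSided :=
    ⟨fun {a} b ha => (hI _).2 (mul_mem_mulAug_right ((hI a).1 ha) b)⟩
  have hmk : ∀ a, Ideal.Quotient.mkₐ F hA.mulAugIdeal a = 0 ↔ a ∈ mulAug ε z := fun a =>
    Ideal.Quotient.eq_zero_iff_mem
  have hnt : Nontrivial (A ⧸ hA.mulAugIdeal) := by
    refine ⟨Ideal.Quotient.mkₐ F hA.mulAugIdeal 1, 0, fun h => ?_⟩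
    have := augmentation_eq_zero_of_mem_mulAug ((hmk 1).1 h)
    rw [map_one] at this
    exact one_ne_zero this
  have : CharP (A ⧸ hA.mulAugIdeal) p :=
    charP_of_injective_algebraMap (algebraMap F (A ⧸ hA.mulAugIdeal)).injective p
  have : ExpChar (A ⧸ hA.mulAugIdeal) p := ExpChar.prime Fact.out
  rw [← hmk, map_sub, map_add, map_pow, map_pow, map_pow, map_add, sub_eq_zero]
  -- In the quotient by zω the image of `b` is central, because `b ∈ ω²`; so Frobenius is additive
  -- here.
  refine add_pow_expChar_pow_of_commute _ _ ?_
  rw [Commute, SemiconjBy, ← sub_eq_zero, ← map_mul, ← map_mul, ← map_sub, hmk]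
  exact hA.commutator_mem hb a

theorem add_pow_char_sub_mem [Fact p.Prime] [CharP F p] (hA : IsFrame p ν ε z) (a : A) {b : A}
    (hb : b ∈ aug ε ^ 2) : (a + b) ^ p - (a ^ p + b ^ p) ∈ mulAug ε z := by
  simpa only [pow_one] using hA.add_pow_char_pow_sub_mem a hb 1

variable {G : Type v} [LieRing G] [LieAlgebra F G] [RestrictedLieAlgebra p F G]

/-- If the `p`-th powers of the generators are central, then every `p`-th power is central modulo
`z ω`. -/
theorem exists_central_sub_pow_mem [Fact p.Prime] [CharP F p] (hA : IsFrame p ν ε z)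
    {j : G →ₗ[F] A} (hj : Algebra.adjoin F (Set.range j) = ⊤) (hε : ∀ x, ε (j x) = 0)
    (hcen : ∀ x a, j x ^ p * a = a * j x ^ p) (a : A) :
    ∃ c, (∀ b, c * b = b * c) ∧ a ^ p - c ∈ mulAug ε z := by
  have hadd : ∀ a b : A, (∃ c, (∀ b, c * b = b * c) ∧ a ^ p - c ∈ mulAug ε z) →
      (∃ c, (∀ b, c * b = b * c) ∧ b ^ p - c ∈ mulAug ε z) → b ∈ aug ε ^ 2 →
      ∃ c, (∀ b, c * b = b * c) ∧ (a + b) ^ p - c ∈ mulAug ε z := by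
    rintro a b ⟨c, hc, hac⟩ ⟨d, hd, hbd⟩ hb
    refine ⟨c + d, fun e => by rw [add_mul, mul_add, hc, hd], ?_⟩
    have := add_mem (hA.add_pow_char_sub_mem a hb) (add_mem hac hbd)
    convert this using 1
    abel
  have hR : LinearMap.range j ≤ aug ε := by rintro _ ⟨x, rfl⟩; exact hε x
  have hsup : aug ε ≤ LinearMap.range j ⊔ aug ε ^ 2 := by
    refine (aug_eq_top_mul_range hj hε).le.trans ?_
    rw [top_eq_one_sup_aug ε, Submodule.sup_mul, one_mul, pow_two]
    exact sup_le le_sup_left (le_sup_of_le_right (mul_le_mul' le_rfl hR))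
  -- For products of Lie algebra elements, `(j x * m) ^ p` is `j x ^ p * m ^ p` modulo zω, and both
  -- factors are central modulo zω by induction.
  have hmon : ∀ k, ∀ a ∈ LinearMap.range j ^ (k + 1),
      ∃ c, (∀ b, c * b = b * c) ∧ a ^ p - c ∈ mulAug ε z := by
    intro k
    induction k with
    | zero =>
      intro a ha
      rw [zero_add, pow_one] at ha
      obtain ⟨x, rfl⟩ := ha
      exact ⟨j x ^ p, hcen x, by rw [sub_self]; exact zero_mem _⟩
    | succ k ih =>
      intro a ha
      have hk2 : LinearMap.range j ^ (k + 1 + 1) ≤ aug ε ^ 2 := by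
        refine (pow_le_pow_left' hR _).trans ?_
        rw [show k + 1 + 1 = 2 + k by omega]
        exact aug_pow_le_sq k
      rw [pow_succ'] at ha hk2
      induction ha using Submodule.mul_induction_on' with
      | mem_mul_mem r hr m hm =>
        obtain ⟨x, rfl⟩ := hr
        obtain ⟨c, hc, hmc⟩ := ih m hm
        refine ⟨j x ^ p * c, fun b => by
          rw [mul_assoc, hc, ← mul_assoc, hcen, mul_assoc], ?_⟩
        have h1 := hA.mul_pow_sub_mem (hε x) m (Fact.out : p.Prime).pos
        have h2 := hA.mul_mem_mulAug_left (j x ^ p) hmc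
        have := add_mem h1 h2
        rwa [mul_sub, sub_add_sub_cancel] at this
      | add a ha b hb ha' hb' => exact hadd a b ha' hb' (hk2 hb)
  obtain ⟨n, hn⟩ := hA.exists_pow
  -- Descending induction along the powers of ω, each element being a sum of Lie monomials plus an
  -- element of the next power; beyond degree one these next terms lie in ω², as `hadd` requires.
  have hdown : ∀ i, ∀ a ∈ aug ε ^ (n - i + 1),
      ∃ c, (∀ b, c * b = b * c) ∧ a ^ p - c ∈ mulAug ε z := by
    intro i
    induction i with
    | zero =>
      intro a ha
      rw [Nat.sub_zero, pow_succ, hn, Submodule.bot_mul, Submodule.mem_bot] at ha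
      refine ⟨0, fun b => by rw [zero_mul, mul_zero], ?_⟩
      rw [ha, zero_pow (Fact.out : p.Prime).ne_zero, sub_zero]; exact zero_mem _
    | succ i ih =>
      intro a ha
      by_cases hi : n ≤ i
      · exact ih a (by rwa [show n - i = n - (i + 1) by omega])
      obtain ⟨r, hr, a', ha', rfl⟩ := Submodule.mem_sup.1 (aug_pow_le hR hsup _ ha)
      refine hadd r a' (hmon _ r hr) (ih a' (by rwa [show n - i = n - (i + 1) + 1 by omega])) ?_
      rw [show n - (i + 1) + 1 + 1 = 2 + (n - (i + 1)) by omega] at ha'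
      exact aug_pow_le_sq _ ha'
  obtain ⟨c, hc, hac⟩ := hdown n (a - algebraMap F A (ε a)) (by
    rw [Nat.sub_self, zero_add, pow_one]; exact sub_algebraMap_mem_aug a)
  have hnt : Nontrivial A := ε.toRingHom.domain_nontrivial
  have : CharP A p := charP_of_injective_algebraMap (algebraMap F A).injective p
  have : ExpChar A p := ExpChar.prime Fact.out
  refine ⟨algebraMap F A (ε a ^ p) + c, fun b => by
    rw [add_mul, mul_add, hc, Algebra.commutes], ?_⟩
  have h1 : a ^ p = algebraMap F A (ε a ^ p) + (a - algebraMap F A (ε a)) ^ p := by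
    rw [map_pow, ← add_pow_expChar_of_commute p (Algebra.commutes _ _), add_sub_cancel]
  rwa [h1, add_sub_add_left_eq_sub]

/-- Expansion of a high power of `u + f a + g b`. -/
theorem exists_pow_expansion [Fact p.Prime] [CharP F p] (hA : IsFrame p ν ε z)
    {j : G →ₗ[F] A} (hj : Algebra.adjoin F (Set.range j) = ⊤) (hε : ∀ x, ε (j x) = 0)
    (hcen : ∀ x a, j x ^ p * a = a * j x ^ p) {u f g a b : A} (hu : ∀ c, u ^ p * c = c * u ^ p)
    (hf : ∀ c, f ^ p * c = c * f ^ p) (hg : ∀ c, g ^ p * c = c * g ^ p) (hf0 : ε f = 0)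
    (hg0 : ε g = 0) (hfa : f * a ∈ aug ε ^ 2) (hgb : g * b ∈ aug ε ^ 2) (k : ℕ) :
    ∃ c d v, ε c = ε a ^ p ^ (k + 1) ∧ ε d = ε b ^ p ^ (k + 1) ∧ ε v = 0 ∧
      (u + f * a + g * b) ^ p ^ (k + 1) =
        u ^ p ^ (k + 1) + f ^ p ^ (k + 1) * c + g ^ p ^ (k + 1) * d + z ^ p ^ k * v := by
  have hp := (Fact.out : p.Prime)
  obtain ⟨c, hc, hac⟩ := hA.exists_central_sub_pow_mem hj hε hcen a
  obtain ⟨d, hd, hbd⟩ := hA.exists_central_sub_pow_mem hj hε hcen b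
  -- The first `p`-th power is known only modulo zω. Once `a ^ p` and `b ^ p` have been replaced by
  -- the central `c` and `d`, all summands commute, and the remaining `p^k`-th power can be taken
  -- termwise, turning `z v` into `z^(p^k) v^(p^k)`.
  have h1 : (u + f * a + g * b) ^ p - (u ^ p + f ^ p * c + g ^ p * d) ∈ mulAug ε z := by
    have e1 := hA.add_pow_char_sub_mem (u + f * a) hgb
    have e2 := hA.add_pow_char_sub_mem u hfa
    have e3 := hA.mul_pow_sub_mem hf0 a hp.pos
    have e4 := hA.mul_pow_sub_mem hg0 b hp.pos
    have e5 := hA.mul_mem_mulAug_left (f ^ p) hac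
    have e6 := hA.mul_mem_mulAug_left (g ^ p) hbd
    have := add_mem (add_mem (add_mem e1 e2) (add_mem e3 e4)) (add_mem e5 e6)
    convert this using 1
    noncomm_ring
  obtain ⟨v, hv, hzv⟩ := mem_mulAug.1 h1
  have hnt : Nontrivial A := ε.toRingHom.domain_nontrivial
  have : CharP A p := charP_of_injective_algebraMap (algebraMap F A).injective p
  have : ExpChar A p := ExpChar.prime Fact.out
  have hεc : ε c = ε a ^ p := by
    have := augmentation_eq_zero_of_mem_mulAug hac
    rw [map_sub, map_pow, sub_eq_zero] at this
    exact this.symm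
  have hεd : ε d = ε b ^ p := by
    have := augmentation_eq_zero_of_mem_mulAug hbd
    rw [map_sub, map_pow, sub_eq_zero] at this
    exact this.symm
  refine ⟨c ^ p ^ k, d ^ p ^ k, v ^ p ^ k, ?_, ?_, ?_, ?_⟩
  · rw [map_pow, hεc, ← pow_mul, pow_succ']
  · rw [map_pow, hεd, ← pow_mul, pow_succ']
  · rw [map_pow, hv, zero_pow (pow_ne_zero _ hp.ne_zero)]
  have hsum : (u + f * a + g * b) ^ p = (u ^ p + f ^ p * c) + g ^ p * d + z * v := by
    rw [hzv]; abel
  have hfc : ∀ e, f ^ p * c * e = e * (f ^ p * c) := fun e => by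
    rw [mul_assoc, hc, ← mul_assoc, hf, mul_assoc]
  have hgd : ∀ e, g ^ p * d * e = e * (g ^ p * d) := fun e => by
    rw [mul_assoc, hd, ← mul_assoc, hg, mul_assoc]
  rw [pow_succ', pow_mul, hsum, add_pow_expChar_pow_of_commute p k, add_pow_expChar_pow_of_commute p k,
    add_pow_expChar_pow_of_commute p k, Commute.mul_pow (hf c), Commute.mul_pow (hg d),
    Commute.mul_pow (hA.central v), pow_mul, pow_mul, pow_mul]
  · exact hu _
  · exact (hgd _).symm
  · change _ * _ = _ * _
    rw [add_mul, mul_add, add_mul, mul_add, hu, hfc, hgd]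

end IsFrame

end PowerCalculus

/-! ### Two-generated abelian algebras. -/

section AbelianPresentation

variable {p : ℕ} [Fact p.Prime] {F : Type u} [Field F] [CharP F p] [PerfectField F] {M : Type v}
  [LieRing M] [LieAlgebra F M] [RestrictedLieAlgebra p F M] [FiniteDimensional F M]

/-- A two-generated abelian `p`-nilpotent restricted Lie algebra is a direct sum of two cyclic
ones. -/
theorem exists_isPresentation_of_abelian (hab : ∀ x y : M, ⁅x, y⁆ = 0) {k : ℕ}
    (hk : ∀ x : M, (pMap p F)^[k] x = 0) {x y : M} (hxy : orbit p F x ⊔ orbit p F y = ⊤) :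
    ∃ (a b : M) (m n : ℕ), IsPresentation p m n 0 0 (0 : F) 0 a b ∧
      (∀ i, (∀ g : M, (pMap p F)^[i] g = 0) ↔ m ≤ i) := by
  classical
  -- Take `y` with the longer orbit; its length `N` will be the exponent of `M`.
  wlog hle : Module.finrank F (orbit p F x) ≤ Module.finrank F (orbit p F y) generalizing x y
  · exact this (sup_comm (orbit p F x) _ ▸ hxy) (le_of_not_ge hle)
  obtain ⟨N, hN⟩ : ∃ N, N = Module.finrank F (orbit p F y) := ⟨_, rfl⟩
  have hyN : ∀ i, (pMap p F)^[i] y = 0 ↔ N ≤ i := fun i => by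
    rw [hN]; exact iterate_finrank_orbit (hk y) i
  have hadd : ∀ i (u v : M), (pMap p F)^[i] (u + v) = (pMap p F)^[i] u + (pMap p F)^[i] v :=
    fun i u v => iterate_add_of_lie_eq_zero (hab u v) i
  have hxN : (pMap p F)^[N] x = 0 := (iterate_finrank_orbit (hk x) N).2 (hN ▸ hle)
  have hexp : ∀ g : M, (pMap p F)^[N] g = 0 := by
    intro g
    have hg : g ∈ orbit p F x ⊔ orbit p F y := hxy ▸ Submodule.mem_top
    obtain ⟨u, hu, v, hv, rfl⟩ := Submodule.mem_sup.1 hg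
    rw [hadd]
    have h1 := iterate_mem_orbit_iterate hu N
    have h2 := iterate_mem_orbit_iterate hv N
    rw [orbit_eq_bot hxN, Submodule.mem_bot] at h1
    rw [orbit_eq_bot ((hyN N).2 le_rfl), Submodule.mem_bot] at h2
    rw [h1, h2, add_zero]
  have hex : ∃ m, (pMap p F)^[m] x ∈ orbit p F y := ⟨N, by rw [hxN]; exact zero_mem _⟩
  obtain ⟨m, hm, hmin⟩ : ∃ m, (pMap p F)^[m] x ∈ orbit p F y ∧
      ∀ i < m, (pMap p F)^[i] x ∉ orbit p F y :=
    ⟨Nat.find hex, Nat.find_spec hex, fun i hi => Nat.find_min hex hi⟩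
  -- If `x^[p]^m` had leading exponent `e < m` in `y`, then `N - 1 - e` further applications would
  -- kill the left side, since the exponent reaches `N`, but leave a nonzero multiple of `y^[p]^(N -
  -- 1)`.
  have hmem : (pMap p F)^[m] x ∈ orbit p F ((pMap p F)^[m] y) := by
    by_cases h0 : (pMap p F)^[m] x = 0
    · rw [h0]; exact zero_mem _
    obtain ⟨e, c, he, hc, hlead⟩ := exists_lead ((hyN N).2 le_rfl) hm h0
    have hem : m ≤ e := by
      by_contra! hlt
      have h1 := iterate_mem_orbit_iterate hlead (N - 1 - e)
      have h2 : (pMap p F)^[N - 1 - e] ((pMap p F)^[m] x) = 0 := by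
        rw [← Function.iterate_add_apply, show N - 1 - e + m = (N - 1 - e + m - N) + N by omega,
          Function.iterate_add_apply, hxN, pMap_iterate_zero]
      have h3 : (pMap p F)^[N - 1 - e] ((pMap p F)^[e + 1] y) = 0 := by
        rw [← Function.iterate_add_apply, hyN]; omega
      rw [orbit_eq_bot h3, Submodule.mem_bot, sub_eq_add_neg, hadd, h2, zero_add,
        ← neg_smul, pMap_iterate_smul, smul_eq_zero, ← Function.iterate_add_apply, hyN] at h1
      rcases h1 with h1 | h1
      · exact (pow_ne_zero _ (neg_ne_zero.2 hc)) h1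
      · omega
    have := add_mem (orbit_iterate_antitone y (by omega : m ≤ e + 1) hlead)
      (Submodule.smul_mem _ c (orbit_iterate_antitone y hem (mem_orbit_self _)))
    rwa [sub_add_cancel] at this
  obtain ⟨v, hv, hvx⟩ := exists_iterate_eq hmem
  -- Subtracting a `p^m`-th root makes the two orbits independent. The scalar `-1` is its own
  -- `p^m`-th power; for `p = 2` because `-1 = 1`.
  have hb : (pMap p F)^[m] (x - v) = 0 := by
    rw [sub_eq_add_neg, hadd, ← neg_one_smul F v, pMap_iterate_smul, hvx]
    rcases (Fact.out : p.Prime).eq_two_or_odd' with h2 | hodd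
    · subst h2
      have : (2 : F) = 0 := CharTwo.two_eq_zero
      rw [CharTwo.neg_eq, one_pow, one_smul, ← two_smul F, this, zero_smul]
    · rw [hodd.pow.neg_one_pow, neg_one_smul, add_neg_cancel]
  refine ⟨y, x - v, N, m, ⟨?_, ?_, fun _ _ _ => hab _ _, by rw [hab, zero_smul], ?_, hb⟩, ?_⟩
  · refine eq_top_iff.2 (hxy ▸ sup_le (orbit_le.2 fun i => ?_) le_sup_left)
    have h1 : (pMap p F)^[i] x = (pMap p F)^[i] v + (pMap p F)^[i] (x - v) := by
      rw [← hadd, add_sub_cancel]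
    rw [h1]
    exact Submodule.add_mem_sup (iterate_mem_orbit_of_mem hv i) (iterate_mem_orbit _ _)
  · rw [← finrank_top (R := F) (M := M), ← hxy, sup_comm, hN]
    exact finrank_sup_orbit (fun u _ hu => iterate_mem_orbit_of_mem hu 1) hm hmin
  · rw [(hyN N).2 le_rfl, zero_smul]
  · intro i
    refine ⟨fun h => (hyN i).1 (h y), fun h g => ?_⟩
    rw [show i = (i - N) + N by omega, Function.iterate_add_apply, hexp, pMap_iterate_zero]

end AbelianPresentation

/-! ### Kernels of powers of Frobenius on truncated polynomial algebras. -/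

section FrobeniusKernel

variable {p : ℕ} [Fact p.Prime] {F : Type u} [Field F] [CharP F p] {M : Type v}
  [LieRing M] [LieAlgebra F M] [RestrictedLieAlgebra p F M] [FiniteDimensional F M]

/-- `B` is a truncated polynomial algebra in `ι a`, `ι b`: the monomials span, and the dimension
makes them a basis. Taking `p^r`-th powers multiplies exponents by `p^r`, so only monomials
divisible by `a^(p^(m-r))` or `b^(p^(n-r))` can occur in `f`. Truncated subtraction is intended: for
`r ≥ m` the divisor is `a` itself. -/
theorem mem_span_of_pow_eq_zero {B : Type w} [CommRing B] [Algebra F B] {ι : M →ₗ[F] B}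
    (hι : IsEnvelope p ι) {k : ℕ} (hk : ∀ x : M, (pMap p F)^[k] x = 0) {a b : M} {m n : ℕ}
    (h : IsPresentation p m n 0 0 (0 : F) 0 a b) {r : ℕ} {f : B} (hf : f ^ p ^ r = 0) :
    f ∈ Submodule.span F {e | ∃ (g : M) (c : B), (pMap p F)^[r] g = 0 ∧ e = ι g * c} := by
  classical
  have hp := (Fact.out : p.Prime)
  obtain ⟨hfin, hrank⟩ := hι.finrank_eq hk
  have hα : ι a ^ p ^ m = 0 := by
    rw [← hι.isRep.map_iterate, h.iterate_left, zero_smul, map_zero]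
  have hβ : ι b ^ p ^ n = 0 := by rw [← hι.isRep.map_iterate, h.iterate_right, map_zero]
  let mon : Fin (p ^ m) × Fin (p ^ n) → B := fun q => ι a ^ (q.1 : ℕ) * ι b ^ (q.2 : ℕ)
  have hmon : ∀ q, mon q = ι a ^ (q.1 : ℕ) * ι b ^ (q.2 : ℕ) := fun _ => rfl
  have hadj : Algebra.adjoin F {ι a, ι b} = ⊤ := by
    refine eq_top_iff.2 (hι.adjoin_eq_top ▸ Algebra.adjoin_le ?_)
    rintro _ ⟨g, rfl⟩
    have ha : ι a ∈ Algebra.adjoin F {ι a, ι b} := Algebra.subset_adjoin (by simp)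
    have hb : ι b ∈ Algebra.adjoin F {ι a, ι b} := Algebra.subset_adjoin (by simp)
    induction h.mem_span g using Submodule.span_induction with
    | mem g hg =>
      rcases hg with ⟨i, rfl⟩ | ⟨i, rfl⟩
      · change ι ((pMap p F)^[i] a) ∈ _
        rw [hι.isRep.map_iterate]; exact pow_mem ha _
      · change ι ((pMap p F)^[i] b) ∈ _
        rw [hι.isRep.map_iterate]; exact pow_mem hb _
    | zero => rw [map_zero]; exact zero_mem _
    | add g g' _ _ hg hg' => rw [map_add]; exact add_mem hg hg'
    | smul c g _ hg => rw [map_smul]; exact Subalgebra.smul_mem _ hg c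
  have hspan : ⊤ ≤ Submodule.span F (Set.range mon) := by
    rw [← Algebra.top_toSubmodule, ← hadj, Algebra.adjoin_eq_span, Submodule.span_le]
    intro e he
    obtain ⟨i, l, rfl⟩ := (Submonoid.mem_closure_pair _ _ _).1 he
    by_cases hi : i < p ^ m
    · by_cases hl : l < p ^ n
      · exact Submodule.subset_span ⟨(⟨i, hi⟩, ⟨l, hl⟩), rfl⟩
      · rw [pow_eq_zero_of_le (not_lt.1 hl) hβ, mul_zero]; exact zero_mem _
    · rw [pow_eq_zero_of_le (not_lt.1 hi) hα, zero_mul]; exact zero_mem _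
  let bas : Module.Basis (Fin (p ^ m) × Fin (p ^ n)) F B :=
    basisOfTopLeSpanOfCardEqFinrank mon hspan (by
      rw [hrank, h.finrank_eq, Fintype.card_prod, Fintype.card_fin, Fintype.card_fin, pow_add])
  have hbas : ∀ q, bas q = mon q := fun q => by
    rw [coe_basisOfTopLeSpanOfCardEqFinrank]
  have hnt : Nontrivial B :=
    Module.nontrivial_of_finrank_pos (R := F) (by rw [hrank]; exact pow_pos hp.pos _)
  have : CharP B p := charP_of_injective_algebraMap (algebraMap F B).injective p
  have : ExpChar B p := ExpChar.prime hp
  have hpr := pow_pos hp.pos r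
  have hsum : f = ∑ q, bas.repr f q • mon q := by
    simp only [← hbas]; exact (bas.sum_repr f).symm
  have hzero : ∀ q : Fin (p ^ m) × Fin (p ^ n), (q.1 : ℕ) * p ^ r < p ^ m →
      (q.2 : ℕ) * p ^ r < p ^ n → bas.repr f q = 0 := by
    intro q h1 h2
    have hq : ∀ q' : Fin (p ^ m) × Fin (p ^ n),
        bas.repr (mon q' ^ p ^ r) (⟨q.1 * p ^ r, h1⟩, ⟨q.2 * p ^ r, h2⟩) =
          if q' = q then 1 else 0 := by
      intro q'
      have hpow : mon q' ^ p ^ r = ι a ^ ((q'.1 : ℕ) * p ^ r) * ι b ^ ((q'.2 : ℕ) * p ^ r) := by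
        rw [hmon, mul_pow, pow_mul, pow_mul]
      by_cases h1' : (q'.1 : ℕ) * p ^ r < p ^ m
      · by_cases h2' : (q'.2 : ℕ) * p ^ r < p ^ n
        · have : mon q' ^ p ^ r = bas (⟨q'.1 * p ^ r, h1'⟩, ⟨q'.2 * p ^ r, h2'⟩) := by
            rw [hbas, hpow]
          rw [this, Module.Basis.repr_self, Finsupp.single_apply]
          congr 1
          rw [eq_iff_iff, Prod.ext_iff, Prod.ext_iff]
          simp only [Fin.ext_iff, Nat.mul_left_inj hpr.ne']
        · rw [hpow, pow_eq_zero_of_le (not_lt.1 h2') hβ, mul_zero, map_zero, Finsupp.zero_apply,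
            if_neg]
          rintro rfl
          exact h2' h2
      · rw [hpow, pow_eq_zero_of_le (not_lt.1 h1') hα, zero_mul, map_zero, Finsupp.zero_apply,
          if_neg]
        rintro rfl
        exact h1' h1
    have h3 : bas.repr (f ^ p ^ r) (⟨q.1 * p ^ r, h1⟩, ⟨q.2 * p ^ r, h2⟩) =
        bas.repr f q ^ p ^ r := by
      conv_lhs => rw [hsum]
      rw [sum_pow_char_pow p r, map_sum, Finsupp.finset_sum_apply, Finset.sum_eq_single q]
      · rw [smul_pow, map_smul, Finsupp.smul_apply, hq, if_pos rfl, smul_eq_mul, mul_one]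
      · intro q' _ hne
        rw [smul_pow, map_smul, Finsupp.smul_apply, hq, if_neg hne, smul_zero]
      · exact fun h => absurd (Finset.mem_univ q) h
    rw [hf, map_zero, Finsupp.zero_apply] at h3
    exact (pow_eq_zero_iff hpr.ne').1 h3.symm
  have hle : ∀ {i s : ℕ}, p ^ s ≤ i * p ^ r → p ^ (s - r) ≤ i := by
    intro i s hi
    rcases le_total r s with hrs | hrs
    · rw [← Nat.sub_add_cancel hrs, pow_add] at hi
      exact Nat.le_of_mul_le_mul_right hi hpr
    · rw [Nat.sub_eq_zero_of_le hrs, pow_zero]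
      by_contra! h0
      have : i = 0 := by omega
      rw [this, zero_mul] at hi
      have := pow_pos hp.pos s
      omega
  have hkill : ∀ {g : M} {s : ℕ}, (pMap p F)^[s] g = 0 →
      (pMap p F)^[r] ((pMap p F)^[s - r] g) = 0 := by
    intro g s hs
    rw [← Function.iterate_add_apply, show r + (s - r) = (r + (s - r) - s) + s by omega,
      Function.iterate_add_apply, hs, pMap_iterate_zero]
  rw [hsum]
  refine Submodule.sum_mem _ fun q _ => ?_
  by_cases h1 : (q.1 : ℕ) * p ^ r < p ^ m
  · by_cases h2 : (q.2 : ℕ) * p ^ r < p ^ n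
    · rw [hzero q h1 h2, zero_smul]; exact zero_mem _
    · refine Submodule.smul_mem _ _ (Submodule.subset_span
        ⟨(pMap p F)^[n - r] b, ι b ^ ((q.2 : ℕ) - p ^ (n - r)) * ι a ^ (q.1 : ℕ),
          hkill h.iterate_right, ?_⟩)
      rw [hι.isRep.map_iterate, ← mul_assoc, ← pow_add, Nat.add_sub_cancel' (hle (not_lt.1 h2)),
        mul_comm]
  · refine Submodule.smul_mem _ _ (Submodule.subset_span
        ⟨(pMap p F)^[m - r] a, ι a ^ ((q.1 : ℕ) - p ^ (m - r)) * ι b ^ (q.2 : ℕ),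
          hkill (by rw [h.iterate_left, zero_smul]), ?_⟩)
    rw [hι.isRep.map_iterate, ← mul_assoc, ← pow_add, Nat.add_sub_cancel' (hle (not_lt.1 h1))]

end FrobeniusKernel

/-! ### Linear parts of elements of the enveloping algebra. -/

section LinearPart

variable {p ν : ℕ} [Fact p.Prime] {F : Type u} [Field F] [CharP F p] {G : Type v} [LieRing G]
  [LieAlgebra F G] [RestrictedLieAlgebra p F G] {A : Type w} [Ring A] [Algebra F A]
  [FiniteDimensional F G] {j : G →ₗ[F] A} {k : ℕ} {ε : A →ₐ[F] F} {z : A}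

/-- Constants drop out of a commutator, so `z` is a commutator of elements of ω. -/
theorem IsFrame.mem_aug_sq (hA : IsFrame p ν ε z) : z ∈ aug ε ^ 2 := by
  obtain ⟨a, b, hab⟩ := hA.isComm
  have : z = (a - algebraMap F A (ε a)) * (b - algebraMap F A (ε b)) -
      (b - algebraMap F A (ε b)) * (a - algebraMap F A (ε a)) := by
    rw [hab, sub_mul, mul_sub, mul_sub, sub_mul, mul_sub, mul_sub, Algebra.commutes (ε a) b,
      Algebra.commutes (ε b) a, ← map_mul (algebraMap F A), mul_comm (ε a), map_mul]
    abel
  rw [this]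
  exact sub_mem (mem_aug_sq_of_mem (sub_algebraMap_mem_aug a) (sub_algebraMap_mem_aug b))
    (mem_aug_sq_of_mem (sub_algebraMap_mem_aug b) (sub_algebraMap_mem_aug a))

attribute [local instance] abelianization

/-- The preimage in `G` of the sum of the two orbits is a restricted subalgebra that generates
modulo ω², hence all of `G`. -/
theorem IsEnvelope.orbit_abelianization (hj : IsEnvelope p j)
    (hk : ∀ x : G, (pMap p F)^[k] x = 0) {x y : G}
    (hgen : ∀ g, ∃ c d : F, j g - j (c • x + d • y) ∈ aug ε ^ 2) :
    orbit p F (LieSubmodule.Quotient.mk x : G ⧸ commIdeal p F G) ⊔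
      orbit p F (LieSubmodule.Quotient.mk y : G ⧸ commIdeal p F G) = ⊤ := by
  set V := orbit p F (LieSubmodule.Quotient.mk x : G ⧸ commIdeal p F G) ⊔
      orbit p F (LieSubmodule.Quotient.mk y : G ⧸ commIdeal p F G) with hV
  have hVt : ∀ v ∈ V, pMap p F v ∈ V := by
    intro v hv
    obtain ⟨a, ha, b, hb, rfl⟩ := Submodule.mem_sup.1 hv
    rw [pMap_add_of_lie_eq_zero (lie_abelianization a b)]
    exact Submodule.add_mem_sup (iterate_mem_orbit_of_mem ha 1) (iterate_mem_orbit_of_mem hb 1)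
  let K : LieSubalgebra F G :=
    { V.comap (LieSubmodule.Quotient.mk' (commIdeal p F G) : G →ₗ[F] G ⧸ commIdeal p F G) with
      lie_mem' := fun {a b} _ _ => by
        change LieSubmodule.Quotient.mk (N := commIdeal p F G) ⁅a, b⁆ ∈ V
        rw [(LieSubmodule.Quotient.mk_eq_zero').2 (lie_mem_commIdeal a b)]
        exact zero_mem _ }
  have hK : ∀ g, g ∈ K ↔ LieSubmodule.Quotient.mk (N := commIdeal p F G) g ∈ V := fun _ => Iff.rfl
  have htop := hj.eq_top_of_generates hk (ε := ε) K (fun g hg => hVt _ hg) fun g => by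
    obtain ⟨c, d, h⟩ := hgen g
    refine ⟨c • x + d • y, ?_, h⟩
    rw [hK]
    exact Submodule.add_mem_sup (Submodule.smul_mem _ c (mem_orbit_self _))
      (Submodule.smul_mem _ d (mem_orbit_self _))
  refine eq_top_iff.2 fun q _ => ?_
  obtain ⟨g, rfl⟩ := LieSubmodule.Quotient.surjective_mk' _ q
  have : g ∈ K := htop ▸ LieSubalgebra.mem_top g
  exact this

theorem quotient_iterate_eq_zero_iff (r : ℕ) (g : G) :
    (pMap p F)^[r] (LieSubmodule.Quotient.mk g : G ⧸ commIdeal p F G) = 0 ↔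
      (pMap p F)^[r] g ∈ commIdeal p F G := by
  rw [quotient_pMap_mk (commIdeal p F G) isRestrictedIdeal_commIdeal r g,
    LieSubmodule.Quotient.mk_eq_zero']

theorem iterate_add_mem_commIdeal {r : ℕ} {g h : G} (hg : (pMap p F)^[r] g ∈ commIdeal p F G)
    (hh : (pMap p F)^[r] h ∈ commIdeal p F G) : (pMap p F)^[r] (g + h) ∈ commIdeal p F G := by
  rw [← quotient_iterate_eq_zero_iff] at hg hh ⊢
  change (pMap p F)^[r] ((LieSubmodule.Quotient.mk g : G ⧸ commIdeal p F G) +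
    LieSubmodule.Quotient.mk h) = 0
  rw [iterate_add_of_lie_eq_zero (lie_abelianization _ _), hg, hh, add_zero]

/-- An element with a `p^r`-th power in `z A` lies, modulo `z A`, in the ideal generated by the
elements of the Lie algebra with the same property. -/
theorem IsFrame.exists_mem_span [PerfectField F] (hA : IsFrame p ν ε z) (hj : IsEnvelope p j)
    (hk : ∀ x : G, (pMap p F)^[k] x = 0) {x y : G}
    (hgen : ∀ g, ∃ c d : F, j g - j (c • x + d • y) ∈ aug ε ^ 2) {r : ℕ} {Y : A}
    (hY : ∃ c, Y ^ p ^ r = z * c) :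
    ∃ Y' ∈ Submodule.span F {e | ∃ (g : G) (b : A), (pMap p F)^[r] g ∈ commIdeal p F G ∧
      e = j g * b}, ∃ c, Y = Y' + z * c := by
  obtain ⟨π, hπ, hπs⟩ := hj.exists_abelianization
  have hker := hj.exists_eq_mul_iff hπ hA.central hA.isComm hA.comm (Fact.out : p.Prime).ne_zero
  have hk' : ∀ x : G ⧸ commIdeal p F G, (pMap p F)^[k] x = 0 := by
    intro q
    obtain ⟨x, rfl⟩ := LieSubmodule.Quotient.surjective_mk' _ q
    refine (quotient_iterate_eq_zero_iff k x).2 ?_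
    rw [hk]; exact zero_mem _
  obtain ⟨a, b, m, n, hpres, -⟩ := exists_isPresentation_of_abelian
    (lie_abelianization (p := p) (F := F) (G := G)) hk' (hj.orbit_abelianization hk hgen)
  letI : CommRing (EnvelopingAlgebra p F (G ⧸ commIdeal p F G)) :=
    { (inferInstance : Ring (EnvelopingAlgebra p F (G ⧸ commIdeal p F G))) with
      mul_comm := envι_abelianization_mul_comm }
  have h1 := mem_span_of_pow_eq_zero (B := EnvelopingAlgebra p F (G ⧸ commIdeal p F G))
    isEnvelope_envι hk' hpres (r := r) (f := π Y) (by rw [← map_pow]; exact (hker _).2 hY)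
  have h2 : ∀ e ∈ Submodule.span F {e | ∃ (g : G ⧸ commIdeal p F G)
      (c : EnvelopingAlgebra p F (G ⧸ commIdeal p F G)), (pMap p F)^[r] g = 0 ∧
        e = envι p F (G ⧸ commIdeal p F G) g * c},
      ∃ Y' ∈ Submodule.span F {e | ∃ (g : G) (b : A), (pMap p F)^[r] g ∈ commIdeal p F G ∧
        e = j g * b}, π Y' = e := by
    intro e he
    induction he using Submodule.span_induction with
    | mem e he =>
      obtain ⟨q, c, hq, rfl⟩ := he
      obtain ⟨g, rfl⟩ := LieSubmodule.Quotient.surjective_mk' _ q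
      obtain ⟨b, rfl⟩ := hπs c
      refine ⟨j g * b, Submodule.subset_span ⟨g, b, (quotient_iterate_eq_zero_iff r g).1 hq, rfl⟩, ?_⟩
      rw [map_mul, hπ]; rfl
    | zero => exact ⟨0, zero_mem _, map_zero _⟩
    | add a b _ _ ha hb =>
      obtain ⟨a', ha', rfl⟩ := ha
      obtain ⟨b', hb', rfl⟩ := hb
      exact ⟨a' + b', add_mem ha' hb', map_add _ _ _⟩
    | smul c a _ ha =>
      obtain ⟨a', ha', rfl⟩ := ha
      exact ⟨c • a', Submodule.smul_mem _ c ha', map_smul _ _ _⟩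
  obtain ⟨Y', hY', hπY⟩ := h2 _ h1
  obtain ⟨c, hc⟩ := (hker (Y - Y')).1 (by rw [map_sub, hπY, sub_self])
  exact ⟨Y', hY', c, by rw [← hc]; abel⟩

/-- For `j g * b` the constant of `b` yields the linear part. The rest, `j g * (b - ε b)`, is in ω²,
and its `p^r`-th power is congruent to a product of an element of `zA` and one of ω. Additivity of
Frobenius on ω² modulo zω handles sums. -/
theorem IsFrame.exists_linear_part (hA : IsFrame p ν ε z) (hj : IsEnvelope p j)
    (hk : ∀ x : G, (pMap p F)^[k] x = 0) {r : ℕ} {Y : A}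
    (hY : Y ∈ Submodule.span F {e | ∃ (g : G) (b : A), (pMap p F)^[r] g ∈ commIdeal p F G ∧
      e = j g * b}) :
    ∃ h q, (pMap p F)^[r] h ∈ commIdeal p F G ∧ q ∈ aug ε ^ 2 ∧ q ^ p ^ r ∈ mulAug ε z ∧
      Y = j h + q := by
  have hp := (Fact.out : p.Prime)
  have hnt : Nontrivial A := ε.toRingHom.domain_nontrivial
  have hε : ∀ x, ε (j x) = 0 := hj.isRep.map_eq_zero hk ε
  induction hY using Submodule.span_induction with
  | mem e he =>
    obtain ⟨g, b, hg, rfl⟩ := he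
    refine ⟨ε b • g, j g * (b - algebraMap F A (ε b)), ?_,
      mem_aug_sq_of_mem (hε g) (sub_algebraMap_mem_aug b), ?_, ?_⟩
    · rw [pMap_iterate_smul]; exact Submodule.smul_mem _ _ hg
    · have h1 := hA.mul_pow_sub_mem (hε g) (b - algebraMap F A (ε b)) (pow_pos hp.pos r)
      rw [← hj.isRep.map_iterate] at h1
      obtain ⟨c, hc⟩ := (hA.mem_commIdeal_iff hj hk _).1 hg
      have h2 : j ((pMap p F)^[r] g) * (b - algebraMap F A (ε b)) ^ p ^ r ∈ mulAug ε z := by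
        refine ⟨c * (b - algebraMap F A (ε b)) ^ p ^ r, ?_, ?_⟩
        · rw [SetLike.mem_coe, mem_aug, map_mul, map_pow,
            mem_aug.1 (sub_algebraMap_mem_aug b), zero_pow (pow_ne_zero _ hp.ne_zero), mul_zero]
        · rw [hc, LinearMap.mulLeft_apply, mul_assoc]
      rw [← sub_add_cancel ((j g * (b - algebraMap F A (ε b))) ^ p ^ r)]
      exact add_mem h1 h2
    · rw [map_smul, mul_sub, ← Algebra.commutes, ← Algebra.smul_def, add_sub_cancel]
  | zero =>
    refine ⟨0, 0, by rw [pMap_iterate_zero]; exact zero_mem _, zero_mem _, ?_, by simp⟩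
    rw [zero_pow (pow_ne_zero _ hp.ne_zero)]; exact zero_mem _
  | add a b _ _ ha hb =>
    obtain ⟨g, q, hg, hq, hq', rfl⟩ := ha
    obtain ⟨h, s, hh, hs, hs', rfl⟩ := hb
    refine ⟨g + h, q + s, iterate_add_mem_commIdeal hg hh, add_mem hq hs, ?_, ?_⟩
    · rw [← sub_add_cancel ((q + s) ^ p ^ r)]
      exact add_mem (hA.add_pow_char_pow_sub_mem q hs r) (add_mem hq' hs')
    · rw [map_add]; abel
  | smul c a _ ha =>
    obtain ⟨g, q, hg, hq, hq', rfl⟩ := ha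
    refine ⟨c • g, c • q, ?_, Submodule.smul_mem _ _ hq, ?_, by rw [map_smul, smul_add]⟩
    · rw [pMap_iterate_smul]; exact Submodule.smul_mem _ _ hg
    · rw [smul_pow]; exact Submodule.smul_mem _ _ hq'

/-- The linear part of an element with a `p^r`-th power in `z A`. -/
theorem IsFrame.exists_linear_part_pow [PerfectField F] (hA : IsFrame p ν ε z)
    (hj : IsEnvelope p j) (hk : ∀ x : G, (pMap p F)^[k] x = 0) {x y : G}
    (hgen : ∀ g, ∃ c d : F, j g - j (c • x + d • y) ∈ aug ε ^ 2) {r : ℕ} (hr : 0 < r) {Y : A}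
    (hY : ∃ c, Y ^ p ^ r = z * c) :
    ∃ h, Y - j h ∈ aug ε ^ 2 ∧ Y ^ p ^ r - j h ^ p ^ r ∈ mulAug ε z := by
  have hp := (Fact.out : p.Prime)
  obtain ⟨Y', hY', c, rfl⟩ := hA.exists_mem_span hj hk hgen hY
  obtain ⟨h, q, -, hq, hq', rfl⟩ := hA.exists_linear_part hj hk hY'
  have hz2 := mul_mem_aug_sq_right hA.mem_aug_sq c
  refine ⟨h, ?_, ?_⟩
  · rw [add_assoc, add_sub_cancel_left]
    exact add_mem hq hz2
  · have h1 := hA.add_pow_char_pow_sub_mem (j h + q) hz2 r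
    have h2 := hA.add_pow_char_pow_sub_mem (j h) hq r
    -- As `r > 0`, at least two factors `z` occur: one is kept, the other lies in ω.
    have h3 : (z * c) ^ p ^ r ∈ mulAug ε z := by
      obtain ⟨s, hs⟩ : ∃ s, p ^ r = s + 1 + 1 := by
        refine ⟨p ^ r - 2, ?_⟩
        have := Nat.pow_le_pow_left hp.two_le r
        have h2 : 2 ^ 1 ≤ 2 ^ r := Nat.pow_le_pow_right (by norm_num) hr
        omega
      refine ⟨z ^ (s + 1) * c ^ p ^ r, ?_, ?_⟩
      · rw [SetLike.mem_coe, mem_aug, map_mul, map_pow, hA.augmentation_eq_zero,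
          zero_pow (Nat.succ_ne_zero s), zero_mul]
      · rw [Commute.mul_pow (hA.central c), LinearMap.mulLeft_apply, ← mul_assoc, ← pow_succ', hs]
    have := add_mem (add_mem h1 h2) (add_mem h3 hq')
    convert this using 1
    abel

end LinearPart

/-! ### Images of orbits in the algebra; centrality of `p`-th powers. -/

section OrbitMap

variable {p : ℕ} [Fact p.Prime] {F : Type u} [Field F] {G : Type v} [LieRing G]
  [LieAlgebra F G] [RestrictedLieAlgebra p F G] {A : Type w} [Ring A] [Algebra F A]
  {j : G →ₗ[F] A} {ε : A →ₐ[F] F}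

theorem IsRep.exists_map_eq_mul (hj : IsRep p j) {y w : G} (hw : w ∈ orbit p F y) :
    ∃ v, j w = j y * v := by
  induction hw using Submodule.span_induction with
  | mem w hw =>
    obtain ⟨i, rfl⟩ := hw
    obtain ⟨s, hs⟩ := Nat.exists_eq_add_of_le'
      (Nat.one_le_pow i p (Fact.out : p.Prime).pos)
    exact ⟨j y ^ s, by
      change j ((pMap p F)^[i] y) = _
      rw [hj.map_iterate, hs, pow_succ']⟩
  | zero => exact ⟨0, by simp⟩
  | add a b _ _ ha hb =>
    obtain ⟨c, hc⟩ := ha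
    obtain ⟨d, hd⟩ := hb
    exact ⟨c + d, by rw [map_add, hc, hd, mul_add]⟩
  | smul r a _ ha =>
    obtain ⟨c, hc⟩ := ha
    exact ⟨r • c, by rw [map_smul, hc, mul_smul_comm]⟩

theorem IsRep.exists_map_eq_mul_aug (hj : IsRep p j) (hε : ∀ x, ε (j x) = 0) {y w : G}
    (hw : w ∈ orbit p F (pMap p F y)) : ∃ v, ε v = 0 ∧ j w = j y * v := by
  obtain ⟨v, hv⟩ := hj.exists_map_eq_mul hw
  obtain ⟨s, hs⟩ := Nat.exists_eq_add_of_le' (Fact.out : p.Prime).two_le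
  refine ⟨j y ^ (s + 1) * v, ?_, ?_⟩
  · rw [map_mul, map_pow, hε, zero_pow (Nat.succ_ne_zero s), zero_mul]
  · rw [hv, hj.2, ← mul_assoc, ← pow_succ', hs]

theorem IsRep.aug_le_range_sup (hj : Algebra.adjoin F (Set.range j) = ⊤)
    (hε : ∀ x, ε (j x) = 0) : aug ε ≤ LinearMap.range j ⊔ aug ε ^ 2 := by
  have hR : LinearMap.range j ≤ aug ε := by rintro _ ⟨x, rfl⟩; exact hε x
  refine (aug_eq_top_mul_range hj hε).le.trans ?_
  rw [top_eq_one_sup_aug ε, Submodule.sup_mul, one_mul, pow_two]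
  exact sup_le le_sup_left (le_sup_of_le_right (mul_le_mul' le_rfl hR))

/-- `y` commutes with `⁅y, x⁆`, which lies in its orbit, so `y^[p]` commutes with `x`. Then `x`
commutes with the orbit of `y^[p]`, in particular with `⁅x, y⁆`, so `x^[p]` commutes with `y`. -/
theorem lie_iterate_eq_zero_of_lie_mem {x y : G} (h : ⁅x, y⁆ ∈ orbit p F (pMap p F y)) (i l : ℕ)
    (hil : 0 < i ∨ 0 < l) : ⁅(pMap p F)^[i] x, (pMap p F)^[l] y⁆ = 0 := by
  have h1 : ⁅pMap p F y, x⁆ = 0 := lie_pMap_eq_zero_of_lie_lie (by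
    rw [← lie_skew y x, lie_neg, neg_eq_zero]
    exact lie_orbit_self (mem_orbit_self y) (orbit_pMap_le y h))
  have h2 : ⁅pMap p F x, y⁆ = 0 := lie_pMap_eq_zero_of_lie_lie (by
    refine lie_eq_zero_of_mem_orbit (x := x) (y := pMap p F y) ?_ (mem_orbit_self x) h
    rw [← lie_skew, h1, neg_zero])
  rcases hil with hi | hl
  · obtain ⟨i, rfl⟩ := Nat.exists_eq_add_of_le' hi
    exact lie_iterate_eq_zero h2 i l
  · obtain ⟨l, rfl⟩ := Nat.exists_eq_add_of_le' hl
    refine lie_iterate_eq_zero (y := pMap p F y) ?_ i l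
    rw [← lie_skew, h1, neg_zero]

theorem iterate_not_mem_orbit_succ {y : G} {n r : ℕ} (hn : (pMap p F)^[n] y = 0)
    (hr : (pMap p F)^[r] y ≠ 0) : (pMap p F)^[r] y ∉ orbit p F ((pMap p F)^[r + 1] y) := by
  intro h
  have := orbit_le_of_mem_sup hn (W := ⊥) bot_le (fun u hu => by
    rw [Submodule.mem_bot] at hu ⊢
    rw [hu, pMap_zero]) (by rwa [bot_sup_eq])
  exact hr ((Submodule.mem_bot F).1 (this (mem_orbit_self _)))

end OrbitMap

/-! ### Pairs of generators modulo the square of the augmentation ideal. -/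

section Generators

variable {p ν : ℕ} [Fact p.Prime] {F : Type u} [Field F] [CharP F p] {G : Type v} [LieRing G]
  [LieAlgebra F G] [RestrictedLieAlgebra p F G] {A : Type w} [Ring A] [Algebra F A]
  [FiniteDimensional F G] {j : G →ₗ[F] A} {k : ℕ} {ε : A →ₐ[F] F} {z : A} {x y : G}

/-- The elements `x` and `y` generate modulo the square of the augmentation ideal. -/
def Generates (ε : A →ₐ[F] F) (j : G →ₗ[F] A) (x y : G) : Prop :=
  ∀ g, ∃ c d : F, j g - j (c • x + d • y) ∈ aug ε ^ 2

theorem Generates.symm (h : Generates ε j x y) : Generates ε j y x := fun g => by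
  obtain ⟨c, d, hg⟩ := h g
  exact ⟨d, c, by rwa [add_comm]⟩

theorem Generates.of_sub_mem (h : Generates ε j x y) {g : G} {a b : F} (hb : b ≠ 0)
    (hg : j g - j (a • x + b • y) ∈ aug ε ^ 2) : Generates ε j x g := fun e => by
  obtain ⟨c, d, he⟩ := h e
  refine ⟨c - d * b⁻¹ * a, d * b⁻¹, ?_⟩
  have := sub_mem he (Submodule.smul_mem _ (d * b⁻¹) hg)
  convert this using 1
  have hd : d * b⁻¹ * b = d := by rw [mul_assoc, inv_mul_cancel₀ hb, mul_one]
  rw [← map_sub, ← map_sub, ← map_sub, ← map_smul, ← map_sub]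
  congr 1
  rw [smul_sub, smul_add, smul_smul, smul_smul, hd, sub_smul]
  abel

theorem generates_of_aug_le (hε : ∀ x, ε (j x) = 0) {X Y : A}
    (h : aug ε ≤ Submodule.span F {X, Y} ⊔ aug ε ^ 2) (hX : X - j x ∈ aug ε ^ 2)
    (hY : Y - j y ∈ aug ε ^ 2) : Generates ε j x y := fun g => by
  obtain ⟨a, ha, b, hb, hab⟩ := Submodule.mem_sup.1 (h (hε g : j g ∈ aug ε))
  obtain ⟨c, d, rfl⟩ := Submodule.mem_span_pair.1 ha
  refine ⟨c, d, ?_⟩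
  have := add_mem (add_mem (Submodule.smul_mem _ c hX) (Submodule.smul_mem _ d hY)) hb
  convert this using 1
  rw [← hab, map_add, map_smul, map_smul, smul_sub, smul_sub]
  abel

theorem exists_sub_map_mem (hj : Algebra.adjoin F (Set.range j) = ⊤)
    (hε : ∀ x, ε (j x) = 0) {a : A} (ha : ε a = 0) : ∃ x, a - j x ∈ aug ε ^ 2 := by
  obtain ⟨_, ⟨x, rfl⟩, b, hb, hab⟩ := Submodule.mem_sup.1 (IsRep.aug_le_range_sup hj hε ha)
  exact ⟨x, by rwa [← hab, add_sub_cancel_left]⟩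

theorem Generates.aug_le (h : Generates ε j x y) (hj : Algebra.adjoin F (Set.range j) = ⊤)
    (hε : ∀ x, ε (j x) = 0) : aug ε ≤ Submodule.span F {j x, j y} ⊔ aug ε ^ 2 := by
  refine (IsRep.aug_le_range_sup hj hε).trans (sup_le ?_ le_sup_right)
  rintro _ ⟨g, rfl⟩
  obtain ⟨c, d, hg⟩ := h g
  rw [← add_sub_cancel (j (c • x + d • y)) (j g)]
  refine Submodule.add_mem_sup (Submodule.mem_span_pair.2 ⟨c, d, ?_⟩) hg
  rw [map_add, map_smul, map_smul]

/-- Two generators give the augmentation ideal as a right ideal. -/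
theorem Generates.exists_eq_of_mem_sq (h : Generates ε j x y)
    (hj : Algebra.adjoin F (Set.range j) = ⊤) (hε : ∀ x, ε (j x) = 0) {n : ℕ}
    (hn : aug ε ^ n = ⊥) {q : A} (hq : q ∈ aug ε ^ 2) :
    ∃ a b, ε a = 0 ∧ ε b = 0 ∧ q = j x * a + j y * b := by
  have hle := h.aug_le hj hε
  set T : Submodule F A := Submodule.span F {j x, j y} * ⊤ with hT
  have hspan : Submodule.span F {j x, j y} ≤ T := fun a ha => by
    rw [← mul_one a]; exact Submodule.mul_mem_mul ha trivial
  have hstep : ∀ i, aug ε ^ (i + 1) ≤ T ⊔ aug ε ^ (i + 2) := by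
    intro i
    calc aug ε ^ (i + 1) = aug ε * aug ε ^ i := pow_succ' _ _
      _ ≤ (Submodule.span F {j x, j y} ⊔ aug ε ^ 2) * aug ε ^ i := mul_le_mul' hle le_rfl
      _ ≤ T ⊔ aug ε ^ (i + 2) := by
        rw [Submodule.sup_mul, ← pow_add, add_comm 2 i]
        exact sup_le_sup (mul_le_mul' le_rfl le_top) le_rfl
  have hdown : ∀ i, aug ε ^ (n - i + 1) ≤ T := by
    intro i
    induction i with
    | zero => rw [Nat.sub_zero, pow_succ, hn, Submodule.bot_mul]; exact bot_le
    | succ i ih =>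
      by_cases hi : n ≤ i
      · rwa [show n - (i + 1) = n - i by omega]
      · refine (hstep _).trans (sup_le le_rfl ?_)
        rwa [show n - (i + 1) + 2 = n - i + 1 by omega]
  have haug : aug ε ≤ T := by
    have := hdown n
    rwa [Nat.sub_self, zero_add, pow_one] at this
  have hsq : aug ε ^ 2 ≤ Submodule.span F {j x, j y} * aug ε := by
    rw [pow_two]
    refine (mul_le_mul' haug le_rfl).trans ?_
    rw [hT, mul_assoc, top_mul_aug]
  replace hq := hsq hq
  induction hq using Submodule.mul_induction_on' with
  | mem_mul_mem m hm v hv =>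
    obtain ⟨c, d, rfl⟩ := Submodule.mem_span_pair.1 hm
    refine ⟨c • v, d • v, ?_, ?_, ?_⟩
    · rw [map_smul, mem_aug.1 hv, smul_zero]
    · rw [map_smul, mem_aug.1 hv, smul_zero]
    · rw [add_mul, smul_mul_assoc, smul_mul_assoc, mul_smul_comm, mul_smul_comm]
  | add q _ q' _ h1 h2 =>
    obtain ⟨a, b, ha, hb, rfl⟩ := h1
    obtain ⟨a', b', ha', hb', rfl⟩ := h2
    refine ⟨a + a', b + b', by rw [map_add, ha, ha', add_zero], by rw [map_add, hb, hb', add_zero],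
      ?_⟩
    rw [mul_add, mul_add]; abel

theorem IsFrame.exists_generates (hA : IsFrame p ν ε z) (hj : IsEnvelope p j)
    (hk : ∀ x : G, (pMap p F)^[k] x = 0) : ∃ x y, Generates ε j x y := by
  have hnt : Nontrivial A := ε.toRingHom.domain_nontrivial
  have hε : ∀ x, ε (j x) = 0 := hj.isRep.map_eq_zero hk ε
  obtain ⟨X, Y, hXY⟩ := hA.gen
  have hXY' : aug ε ≤ Submodule.span F {X - algebraMap F A (ε X), Y - algebraMap F A (ε Y)} ⊔
      aug ε ^ 2 := by
    intro a ha
    obtain ⟨b, hb, e, he, rfl⟩ := Submodule.mem_sup.1 (hXY ha)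
    obtain ⟨c, d, rfl⟩ := Submodule.mem_span_pair.1 hb
    refine Submodule.add_mem_sup (Submodule.mem_span_pair.2 ⟨c, d, ?_⟩) he
    have h1 : ε (c • X + d • Y) = 0 := by
      have h2 := mem_aug.1 ha
      rwa [map_add, augmentation_eq_zero_of_mem_sq he, add_zero] at h2
    have h3 : algebraMap F A (ε (c • X + d • Y)) = 0 := by rw [h1, map_zero]
    rw [map_add, map_smul, map_smul, smul_eq_mul, smul_eq_mul, map_add, map_mul, map_mul,
      ← Algebra.smul_def, ← Algebra.smul_def] at h3
    rw [smul_sub, smul_sub, ← add_sub_add_comm, h3, sub_zero]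
  obtain ⟨x, hx⟩ := exists_sub_map_mem hj.adjoin_eq_top hε (sub_algebraMap_mem_aug (ε := ε) X)
  obtain ⟨y, hy⟩ := exists_sub_map_mem hj.adjoin_eq_top hε (sub_algebraMap_mem_aug (ε := ε) Y)
  exact ⟨x, y, generates_of_aug_le hε hXY' hx hy⟩

theorem IsFrame.exists_lie_ne_zero (hA : IsFrame p ν ε z) (hj : IsEnvelope p j)
    (hk : ∀ x : G, (pMap p F)^[k] x = 0) : ∃ x y : G, ⁅x, y⁆ ≠ 0 := by
  by_contra! h
  have h1 : (commIdeal p F G).toSubmodule ≤ ⊥ := by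
    refine closure_le (K := (⊥ : LieSubalgebra F G)) ?_ ?_
    · rintro _ ⟨x, y, rfl⟩
      rw [h]; exact zero_mem _
    · intro x hx
      rw [LieSubalgebra.mem_bot] at hx ⊢
      rw [hx, pMap_zero]
  have h2 : Module.finrank F (commIdeal p F G).toSubmodule = ν := hA.finrank_commIdeal hj hk
  rw [le_bot_iff.1 h1, finrank_bot] at h2
  have := hA.pos
  omega

/-- If `b ≠ 0`, then `y` is redundant modulo ω², so `G` is the orbit of `x` and abelian, which `ν >
0` excludes. -/
theorem IsFrame.eq_zero_of_generates (hA : IsFrame p ν ε z) (hj : IsEnvelope p j)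
    (hk : ∀ x : G, (pMap p F)^[k] x = 0) (h : Generates ε j x y) {a b : F}
    (hab : j (a • x + b • y) ∈ aug ε ^ 2) : b = 0 := by
  by_contra hb
  let K : LieSubalgebra F G :=
    { orbit p F x with
      lie_mem' := fun {u v} hu hv => by
        rw [AddSubsemigroup.mem_carrier] at *
        have : ⁅u, v⁆ = 0 := lie_orbit_self hu hv
        rw [this]; exact zero_mem (orbit p F x) }
  have hK : ∀ g, g ∈ K ↔ g ∈ orbit p F x := fun _ => Iff.rfl
  have htop := hj.eq_top_of_generates hk (ε := ε) K
    (fun g hg => iterate_mem_orbit_of_mem (y := x) hg 1) fun g => by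
      obtain ⟨c, d, hg⟩ := h g
      refine ⟨(c - d * b⁻¹ * a) • x, Submodule.smul_mem _ _ (mem_orbit_self x), ?_⟩
      have := add_mem hg (Submodule.smul_mem _ (d * b⁻¹) hab)
      convert this using 1
      have hd : d * b⁻¹ * b = d := by rw [mul_assoc, inv_mul_cancel₀ hb, mul_one]
      rw [← map_sub, ← map_sub, ← map_smul, ← map_add]
      congr 1
      rw [smul_add, smul_smul, smul_smul, hd, sub_smul]
      abel
  obtain ⟨u, v, huv⟩ := hA.exists_lie_ne_zero hj hk
  refine huv (lie_orbit_self (p := p) (F := F) (y := x) ?_ ?_)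
  · rw [← hK, htop]; exact LieSubalgebra.mem_top u
  · rw [← hK, htop]; exact LieSubalgebra.mem_top v

end Generators

/-! ### Consequences of central `p`-th powers. -/

section Central

variable {p : ℕ} [Fact p.Prime] {F : Type u} [Field F] {G : Type v} [LieRing G]
  [LieAlgebra F G] [RestrictedLieAlgebra p F G] {x y : G}

theorem mem_span_of_sup_eq_top (h : orbit p F x ⊔ orbit p F y = ⊤) (g : G) : g ∈ Submodule.span F
    ((Set.range fun i => (pMap p F)^[i] x) ∪ Set.range fun i => (pMap p F)^[i] y) := by
  rw [Submodule.span_union]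
  change g ∈ orbit p F x ⊔ orbit p F y
  rw [h]; trivial

theorem lie_mem_of_central (h : orbit p F x ⊔ orbit p F y = ⊤)
    (hc : ∀ i l, 0 < i ∨ 0 < l → ⁅(pMap p F)^[i] x, (pMap p F)^[l] y⁆ = 0) {W : Submodule F G}
    (hW : ⁅x, y⁆ ∈ W) (a b : G) : ⁅a, b⁆ ∈ W := by
  have hxy : ∀ i l, ⁅(pMap p F)^[i] x, (pMap p F)^[l] y⁆ ∈ W := by
    intro i l
    by_cases hil : 0 < i ∨ 0 < l
    · rw [hc i l hil]; exact zero_mem _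
    · obtain ⟨rfl, rfl⟩ : i = 0 ∧ l = 0 := by omega
      exact hW
  induction mem_span_of_sup_eq_top h a using Submodule.span_induction with
  | mem a ha =>
    induction mem_span_of_sup_eq_top h b using Submodule.span_induction with
    | mem b hb =>
      rcases ha with ⟨i, rfl⟩ | ⟨i, rfl⟩ <;> rcases hb with ⟨l, rfl⟩ | ⟨l, rfl⟩
      · simp only [lie_iterate_self]; exact zero_mem _
      · exact hxy i l
      · rw [← lie_skew]; exact neg_mem (hxy l i)
      · simp only [lie_iterate_self]; exact zero_mem _
    | zero => rw [lie_zero]; exact zero_mem _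
    | add b b' _ _ hb hb' => rw [lie_add]; exact add_mem hb hb'
    | smul k b _ hb => rw [lie_smul]; exact Submodule.smul_mem _ _ hb
  | zero => rw [zero_lie]; exact zero_mem _
  | add b b' _ _ hb hb' => rw [add_lie]; exact add_mem hb hb'
  | smul k b _ hb => rw [smul_lie]; exact Submodule.smul_mem _ _ hb

theorem commIdeal_le_of_central (h : orbit p F x ⊔ orbit p F y = ⊤)
    (hc : ∀ i l, 0 < i ∨ 0 < l → ⁅(pMap p F)^[i] x, (pMap p F)^[l] y⁆ = 0) {W : Submodule F G}
    (hW : ⁅x, y⁆ ∈ W) (hWt : ∀ w ∈ W, pMap p F w ∈ W) : (commIdeal p F G).toSubmodule ≤ W := by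
  let K : LieSubalgebra F G :=
    { W with lie_mem' := fun {a b} _ _ => lie_mem_of_central h hc hW a b }
  refine closure_le (K := K) ?_ hWt
  rintro _ ⟨a, b, rfl⟩
  exact lie_mem_of_central h hc hW a b

theorem lie_eq_zero_of_mem_orbit_pMap (h : orbit p F x ⊔ orbit p F y = ⊤)
    (hc : ∀ i l, 0 < i ∨ 0 < l → ⁅(pMap p F)^[i] x, (pMap p F)^[l] y⁆ = 0) {w : G}
    (hw : w ∈ orbit p F (pMap p F x) ⊔ orbit p F (pMap p F y)) (g : G) : ⁅w, g⁆ = 0 := by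
  have hg : g ∈ orbit p F x ⊔ orbit p F y := h ▸ Submodule.mem_top
  obtain ⟨a, ha, b, hb, rfl⟩ := Submodule.mem_sup.1 hg
  obtain ⟨u, hu, v, hv, rfl⟩ := Submodule.mem_sup.1 hw
  have h1 : ⁅u, b⁆ = 0 := lie_eq_zero_of_mem_orbit (hc 1 0 (Or.inl one_pos)) hu hb
  have h2 : ⁅a, v⁆ = 0 := lie_eq_zero_of_mem_orbit (hc 0 1 (Or.inr one_pos)) ha hv
  rw [add_lie, lie_add, lie_add, h1, lie_orbit_self (orbit_pMap_le x hu) ha,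
    lie_orbit_self (orbit_pMap_le y hv) hb, ← lie_skew v a, h2]
  simp

/-- All brackets lie in the orbit of `y^[p]`, which is central; so double brackets vanish and `p`-th
powers are central. -/
theorem pMap_sup_of_central (h : orbit p F x ⊔ orbit p F y = ⊤)
    (hc : ∀ i l, 0 < i ∨ 0 < l → ⁅(pMap p F)^[i] x, (pMap p F)^[l] y⁆ = 0)
    (hlie : ⁅x, y⁆ ∈ orbit p F (pMap p F y)) (a b : G) : ⁅pMap p F a, b⁆ = 0 := by
  refine lie_pMap_eq_zero_of_lie_lie ?_
  rw [← lie_skew, lie_eq_zero_of_mem_orbit_pMap h hc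
    (Submodule.mem_sup_right (lie_mem_of_central h hc hlie a b)), neg_zero]

theorem commIdeal_pMap_add_sub_mem (a b : G) :
    pMap p F (a + b) - (pMap p F a + pMap p F b) ∈ commIdeal p F G := by
  letI := abelianization (p := p) (F := F) (G := G)
  rw [← LieSubmodule.Quotient.mk_eq_zero']
  have := pMap_add_of_lie_eq_zero (p := p) (F := F) (lie_abelianization (p := p) (F := F)
    (LieSubmodule.Quotient.mk a : G ⧸ commIdeal p F G) (LieSubmodule.Quotient.mk b))
  exact sub_eq_zero.2 this

end Central

/-- Leading terms of the relations between two generators of a nonabelian metacyclic restricted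
Lie algebra. -/
structure IsLead (p : ℕ) {F : Type u} [Field F] {G : Type v} [LieRing G] [LieAlgebra F G]
    [RestrictedLieAlgebra p F G] (m n r s : ℕ) (c d : F) (x y : G) : Prop where
  span : orbit p F x ⊔ orbit p F y = ⊤
  finrank_eq : Module.finrank F G = m + n
  central : ∀ i l, 0 < i ∨ 0 < l → ⁅(pMap p F)^[i] x, (pMap p F)^[l] y⁆ = 0
  pos : 0 < r
  ne_zero : c ≠ 0
  lie_sub_mem : ⁅x, y⁆ - c • (pMap p F)^[r] y ∈ orbit p F ((pMap p F)^[r + 1] y)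
  left_sub_mem : (pMap p F)^[m] x - d • (pMap p F)^[s] y ∈ orbit p F ((pMap p F)^[s + 1] y)
  le : s ≤ m
  lt : s < m → r < s ∧ d ≠ 0
  left_min : ∀ i < m, (pMap p F)^[i] x ∉ orbit p F y
  right_iff : ∀ i, (pMap p F)^[i] y = 0 ↔ n ≤ i

/-! ### Existence of leading terms. -/

section Lead

variable {p ν : ℕ} [Fact p.Prime] {F : Type u} [Field F] [CharP F p] {G : Type v} [LieRing G]
  [LieAlgebra F G] [RestrictedLieAlgebra p F G] {A : Type w} [Ring A] [Algebra F A]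
  [FiniteDimensional F G] {j : G →ₗ[F] A} {k : ℕ} {ε : A →ₐ[F] F} {z : A} {x y : G}

/-- Some element of the Lie algebra has its `p^r`-th power in `z A` but not in `z ω`. -/
def HasPower (p : ℕ) (ε : A →ₐ[F] F) (z : A) (j : G →ₗ[F] A) (r : ℕ) : Prop :=
  ∃ h u, ε u ≠ 0 ∧ j h ^ p ^ r = z * u

theorem IsFrame.commIdeal_eq_of_pow (hA : IsFrame p ν ε z) (hj : IsEnvelope p j)
    (hk : ∀ x : G, (pMap p F)^[k] x = 0) {r : ℕ} {u : A} (hu : ε u ≠ 0)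
    (hy : j y ^ p ^ r = z * u) :
    (commIdeal p F G).toSubmodule = orbit p F ((pMap p F)^[r] y) :=
  hA.commIdeal_eq_orbit hj hk hu (by rw [hj.isRep.map_iterate, hy])

theorem IsFrame.sup_eq_top (hA : IsFrame p ν ε z) (hj : IsEnvelope p j)
    (hk : ∀ x : G, (pMap p F)^[k] x = 0) (hgen : Generates ε j x y) {r : ℕ} {u : A}
    (hu : ε u ≠ 0) (hy : j y ^ p ^ r = z * u) : orbit p F x ⊔ orbit p F y = ⊤ := by
  have hN := hA.commIdeal_eq_of_pow hj hk hu hy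
  have hNy : (commIdeal p F G).toSubmodule ≤ orbit p F x ⊔ orbit p F y :=
    hN.le.trans (le_sup_of_le_right (orbit_iterate_le y r))
  let K : LieSubalgebra F G :=
    { orbit p F x ⊔ orbit p F y with
      lie_mem' := fun {a b} _ _ => hNy (lie_mem_commIdeal a b) }
  have hK : ∀ g, g ∈ K ↔ g ∈ orbit p F x ⊔ orbit p F y := fun _ => Iff.rfl
  have htop := hj.eq_top_of_generates hk (ε := ε) K (fun g hg => by
    obtain ⟨a, ha, b, hb, rfl⟩ := Submodule.mem_sup.1 ((hK g).1 hg)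
    rw [hK, ← sub_add_cancel (pMap p F (a + b)) (pMap p F a + pMap p F b)]
    exact add_mem (hNy (commIdeal_pMap_add_sub_mem a b))
      (Submodule.add_mem_sup (iterate_mem_orbit_of_mem ha 1) (iterate_mem_orbit_of_mem hb 1)))
    fun g => by
      obtain ⟨c, d, h⟩ := hgen g
      exact ⟨c • x + d • y, Submodule.add_mem_sup (Submodule.smul_mem _ c (mem_orbit_self _))
        (Submodule.smul_mem _ d (mem_orbit_self _)), h⟩
  refine eq_top_iff.2 fun g _ => ?_
  rw [← hK, htop]; exact LieSubalgebra.mem_top g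

theorem IsFrame.exists_isLead (hA : IsFrame p ν ε z) (hj : IsEnvelope p j)
    (hk : ∀ x : G, (pMap p F)^[k] x = 0) (hgen : Generates ε j x y) {r : ℕ} (hr : 0 < r) {u : A}
    (hu : ε u ≠ 0) (hy : j y ^ p ^ r = z * u) (hmax : ∀ r', r < r' → ¬ HasPower p ε z j r') :
    ∃ (m s : ℕ) (c d : F), IsLead p m (r + ν) r s c d x y := by
  classical
  have hnt : Nontrivial A := ε.toRingHom.domain_nontrivial
  have hε : ∀ x, ε (j x) = 0 := hj.isRep.map_eq_zero hk ε
  have hN := hA.commIdeal_eq_of_pow hj hk hu hy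
  have hspan := hA.sup_eq_top hj hk hgen hu hy
  have hlie : ⁅x, y⁆ ∈ orbit p F ((pMap p F)^[r] y) := hN ▸ lie_mem_commIdeal x y
  have hcen := lie_iterate_eq_zero_of_lie_mem (orbit_iterate_antitone y (k := 1) hr hlie)
  have hord : ∀ i, (pMap p F)^[i] ((pMap p F)^[r] y) = 0 ↔ ν ≤ i :=
    hA.iterate_eq_zero_iff hj hk hu (by rw [hj.isRep.map_iterate, hy])
  have hr0 : (pMap p F)^[r] y ≠ 0 := fun h => by
    have := (hord 0).1 h
    have := hA.pos
    omega
  have hright : ∀ i, (pMap p F)^[i] y = 0 ↔ r + ν ≤ i := by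
    intro i
    rcases le_or_gt r i with hi | hi
    · obtain ⟨l, rfl⟩ := Nat.exists_eq_add_of_le' hi
      rw [Function.iterate_add_apply, hord]; omega
    · refine ⟨fun h => absurd ?_ hr0, fun h => by omega⟩
      rw [show r = (r - i) + i by omega, Function.iterate_add_apply, h, pMap_iterate_zero]
  obtain ⟨c, hc⟩ := exists_sub_smul_mem_orbit hlie
  rw [← Function.iterate_succ_apply' (pMap p F)] at hc
  -- If `c = 0`, the commutator ideal would lie in the orbit of `y^[p]^(r+1)`, yet it equals the
  -- orbit of `y^[p]^r`.
  have hc0 : c ≠ 0 := by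
    rintro rfl
    rw [zero_smul, sub_zero] at hc
    refine iterate_not_mem_orbit_succ (hk y) hr0 ?_
    refine commIdeal_le_of_central hspan hcen hc (fun w hw => iterate_mem_orbit_of_mem hw 1) ?_
    rw [hN]; exact mem_orbit_self _
  -- `m` is the first exponent that carries `x` into the orbit of `y`.
  have hex : ∃ m, (pMap p F)^[m] x ∈ orbit p F y := ⟨k, by rw [hk]; exact zero_mem _⟩
  obtain ⟨m, hm, hmin⟩ : ∃ m, (pMap p F)^[m] x ∈ orbit p F y ∧
      ∀ i < m, (pMap p F)^[i] x ∉ orbit p F y :=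
    ⟨Nat.find hex, Nat.find_spec hex, fun i hi => Nat.find_min hex hi⟩
  have hrank : Module.finrank F G = m + (r + ν) := by
    have h1 := finrank_sup_orbit (W := orbit p F y) (x := x) (m := m)
      (fun u _ hu => iterate_mem_orbit_of_mem hu 1) hm hmin
    rw [finrank_orbit ((hright _).2 le_rfl) fun i hi h => by have := (hright i).1 h; omega,
      sup_comm, hspan, finrank_top] at h1
    omega
  have hsd : ∃ (s : ℕ) (d : F), (pMap p F)^[m] x - d • (pMap p F)^[s] y ∈ orbit p F ((pMap p F)^[s + 1] y) ∧
      s ≤ m ∧ (s < m → r < s ∧ d ≠ 0) := by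
    have hself : (pMap p F)^[m] x ∈ orbit p F ((pMap p F)^[m] y) →
        ∃ (s : ℕ) (d : F), (pMap p F)^[m] x - d • (pMap p F)^[s] y ∈ orbit p F ((pMap p F)^[s + 1] y) ∧
          s ≤ m ∧ (s < m → r < s ∧ d ≠ 0) := by
      intro h
      obtain ⟨d, hd⟩ := exists_sub_smul_mem_orbit h
      rw [← Function.iterate_succ_apply' (pMap p F)] at hd
      exact ⟨m, d, hd, le_rfl, fun h => absurd h (lt_irrefl m)⟩
    by_cases h0 : (pMap p F)^[m] x = 0
    · exact hself (by rw [h0]; exact zero_mem _)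
    obtain ⟨e, d, he, hd, hlead⟩ := exists_lead (hk y) hm h0
    have hmem : (pMap p F)^[m] x ∈ orbit p F ((pMap p F)^[e] y) := by
      have := add_mem (orbit_iterate_antitone y (Nat.le_succ e) hlead)
        (Submodule.smul_mem _ d (mem_orbit_self ((pMap p F)^[e] y)))
      rwa [sub_add_cancel] at this
    rcases le_or_gt m e with hem | hem
    · exact hself (orbit_iterate_antitone y hem hmem)
    refine ⟨e, d, hlead, hem.le, fun _ => ⟨?_, hd⟩⟩
    -- If `e < m` and `e ≤ r`, applying the `p`-map `r - e` more times makes `x^[p]^(m + r - e)` a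
    -- nonzero multiple of `y^[p]^r` to leading order. So `j x` has a power equal to `z` times a
    -- unit with exponent beyond `r`, against maximality.
    by_contra! hle
    refine hmax (m + (r - e)) (by omega) ⟨x, ?_⟩
    have h1 := iterate_mem_orbit_iterate hlead (r - e)
    rw [← Function.iterate_add_apply, show r - e + (e + 1) = r + 1 by omega, sub_eq_add_neg,
      ← neg_smul, iterate_add_of_mem_orbit hm (Submodule.smul_mem _ _ (iterate_mem_orbit _ _)),
      pMap_iterate_smul, ← Function.iterate_add_apply, ← Function.iterate_add_apply,
      show r - e + e = r by omega, Function.iterate_succ_apply'] at h1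
    obtain ⟨v, hv, hjv⟩ := hj.isRep.exists_map_eq_mul_aug hε h1
    rw [map_add, map_smul, hj.isRep.map_iterate, hj.isRep.map_iterate, hy] at hjv
    set δ := (-d) ^ p ^ (r - e) with hδ
    have hδ0 : δ ≠ 0 := pow_ne_zero _ (neg_ne_zero.2 hd)
    refine ⟨u * v - δ • u, ?_, ?_⟩
    · rw [map_sub, map_mul, hv, mul_zero, map_smul, zero_sub, neg_ne_zero, smul_eq_mul]
      exact mul_ne_zero hδ0 hu
    · rw [mul_sub, ← mul_assoc, ← hjv, mul_smul_comm, add_comm m, add_sub_cancel_right]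
  obtain ⟨s, d, h1, h2, h3⟩ := hsd
  exact ⟨m, s, c, d, hspan, hrank, hcen, hr, hc0, hc, h1, h2, h3, hmin, hright⟩

end Lead

/-! ### From leading terms to exact relations. -/

section Normalization

variable {p : ℕ} [Fact p.Prime] {F : Type u} [Field F] [CharP F p] [PerfectField F] {G : Type v}
  [LieRing G] [LieAlgebra F G] [RestrictedLieAlgebra p F G] {m n r s : ℕ} {c d : F} {x y : G}

/-- The higher terms have roots of exponent `p^r` and `p^m` in the central orbits of `x^[p]` and
`y^[p]`. Adding such elements to the generators corrects the power sides of the relations and leaves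
the bracket unchanged. -/
theorem IsLead.exists_isPresentation (h : IsLead p m n r s c d x y) :
    ∃ x' y' : G, IsPresentation p m n r s c d x' y' := by
  have hcent : ∀ {w : G}, w ∈ orbit p F (pMap p F x) ⊔ orbit p F (pMap p F y) → ∀ g : G,
      ⁅w, g⁆ = 0 := fun hw g => lie_eq_zero_of_mem_orbit_pMap h.span h.central hw g
  have hcent' : ∀ {w : G}, w ∈ orbit p F (pMap p F x) ⊔ orbit p F (pMap p F y) → ∀ g : G,
      ⁅g, w⁆ = 0 := fun hw g => by rw [← lie_skew, hcent hw, neg_zero]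
  have hyn : (pMap p F)^[n] y = 0 := (h.right_iff n).2 le_rfl
  have hpos : ∀ (u : G) {i : ℕ}, 0 < i → ∀ {v : G}, v ∈ orbit p F u →
      (pMap p F)^[i] v ∈ orbit p F (pMap p F u) := fun u i hi v hv =>
    orbit_iterate_antitone u (k := 1) hi (iterate_mem_orbit_iterate hv i)
  -- the new right generator
  obtain ⟨w, hw, hwr⟩ := exists_iterate_eq (y := pMap p F y) (k := r)
    (Submodule.smul_mem _ c⁻¹ h.lie_sub_mem)
  have hyw : ∀ i, (pMap p F)^[i] (y + w) = (pMap p F)^[i] y + (pMap p F)^[i] w :=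
    iterate_add_of_mem_orbit (mem_orbit_self y) (orbit_pMap_le y hw)
  have horb : orbit p F (y + w) = orbit p F y :=
    orbit_eq_of_lead (e := 0) hyn one_ne_zero (by simpa using hw)
  have hxy : ⁅x, y + w⁆ = c • (pMap p F)^[r] (y + w) := by
    rw [lie_add, hcent' (Submodule.mem_sup_right hw), add_zero, hyw, hwr, smul_add, smul_smul,
      mul_inv_cancel₀ h.ne_zero, one_smul, add_sub_cancel]
  have herr : (pMap p F)^[m] x - d • (pMap p F)^[s] (y + w) ∈
      orbit p F ((pMap p F)^[s + 1] y) := by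
    have := sub_mem h.left_sub_mem (Submodule.smul_mem _ d (iterate_mem_orbit_iterate hw s))
    rw [hyw, smul_add, ← sub_sub]
    exact this
  -- the new left generator
  have hv : ∃ v, v ∈ orbit p F (pMap p F x) ⊔ orbit p F (pMap p F y) ∧
      (pMap p F)^[m] v = -((pMap p F)^[m] x - d • (pMap p F)^[s] (y + w)) ∧
      orbit p F x ≤ orbit p F (x + v) ⊔ orbit p F y ∧
      (∀ i, (pMap p F)^[i] v ∈ orbit p F (pMap p F x) ⊔ orbit p F (pMap p F y)) := by
    -- For `s < m` the coefficient `d` is nonzero, so the orbit of `y^[p]^(s+1)`, where the error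
    -- lives, is that of `x^[p]^(m+1)`, and the root is taken in the orbit of `x^[p]`. For `s = m`
    -- it is taken in the orbit of `y^[p]`.
    rcases h.le.lt_or_eq with hlt | heq
    · obtain ⟨-, hd⟩ := h.lt hlt
      have hdp := pow_ne_zero p hd
      have hmem : ∀ {i}, (pMap p F)^[i] y ∈ orbit p F y := iterate_mem_orbit _ _
      have hmx : (pMap p F)^[m] x ∈ orbit p F y := by
        rw [← sub_add_cancel ((pMap p F)^[m] x) (d • (pMap p F)^[s] y)]
        exact add_mem (orbit_iterate_le _ _ h.left_sub_mem) (Submodule.smul_mem _ _ hmem)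
      have h1 : orbit p F ((pMap p F)^[m + 1] x) = orbit p F ((pMap p F)^[s + 1] y) := by
        have h2 := iterate_mem_orbit_iterate h.left_sub_mem 1
        rw [sub_eq_add_neg, iterate_add_of_mem_orbit hmx
          (neg_mem (Submodule.smul_mem _ d hmem)), ← neg_smul, pMap_iterate_smul,
          ← Function.iterate_add_apply, ← Function.iterate_add_apply,
          ← Function.iterate_add_apply, add_comm 1 m, add_comm 1 s, add_comm 1 (s + 1)] at h2
        refine orbit_eq_of_lead hyn (c := -(-d) ^ p ^ 1)
          (neg_ne_zero.2 (pow_ne_zero _ (neg_ne_zero.2 hd))) ?_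
        rwa [neg_smul, sub_neg_eq_add]
      obtain ⟨v, hv, hvm⟩ := exists_iterate_eq (y := pMap p F x) (k := m)
        (u := -((pMap p F)^[m] x - d • (pMap p F)^[s] (y + w))) (by
          rw [← Function.iterate_succ_apply, Nat.succ_eq_add_one, h1]; exact neg_mem herr)
      refine ⟨v, Submodule.mem_sup_left hv, hvm, le_sup_of_le_left ?_, fun i =>
        Submodule.mem_sup_left (iterate_mem_orbit_of_mem hv i)⟩
      by_cases hx : ∃ k, (pMap p F)^[k] x = 0
      · obtain ⟨k, hk⟩ := hx
        exact (orbit_eq_of_lead (e := 0) hk one_ne_zero (by simpa using hv)).ge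
      · refine absurd ⟨n + m, ?_⟩ hx
        rw [Function.iterate_add_apply]
        have := iterate_mem_orbit_iterate hmx n
        rwa [orbit_eq_bot hyn, Submodule.mem_bot] at this
    · subst heq
      obtain ⟨v, hv, hvm⟩ := exists_iterate_eq (y := pMap p F y) (k := s)
        (u := -((pMap p F)^[s] x - d • (pMap p F)^[s] (y + w))) (neg_mem herr)
      refine ⟨v, Submodule.mem_sup_right hv, hvm, orbit_le.2 fun i => ?_, fun i =>
        Submodule.mem_sup_right (iterate_mem_orbit_of_mem hv i)⟩
      have hadd : (pMap p F)^[i] (x + v) = (pMap p F)^[i] x + (pMap p F)^[i] v :=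
        iterate_add_of_lie_eq_zero (hcent' (Submodule.mem_sup_right hv) x) i
      rw [← add_sub_cancel_right ((pMap p F)^[i] x) ((pMap p F)^[i] v), ← hadd, sub_eq_add_neg]
      exact Submodule.add_mem_sup (iterate_mem_orbit _ _)
        (neg_mem (orbit_pMap_le y (iterate_mem_orbit_of_mem hv i)))
  obtain ⟨v, hv, hvm, hvx, hvi⟩ := hv
  have hxv : ∀ i, (pMap p F)^[i] (x + v) = (pMap p F)^[i] x + (pMap p F)^[i] v :=
    iterate_add_of_lie_eq_zero (hcent' hv x)
  refine ⟨x + v, y + w, ?_, h.finrank_eq, fun i l hil => ?_, ?_, ?_, ?_⟩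
  · rw [horb]
    exact eq_top_iff.2 (h.span ▸ sup_le hvx le_sup_right)
  · rcases hil with hi | hl
    · refine hcent ?_ _
      rw [hxv]
      exact add_mem (Submodule.mem_sup_left (hpos x hi (mem_orbit_self x))) (hvi i)
    · refine hcent' (Submodule.mem_sup_right (hpos y hl ?_)) _
      rw [← horb]; exact mem_orbit_self _
  · rw [add_lie, hcent hv, add_zero, hxy]
  · rw [hxv, hvm]; abel
  · rw [hyw, hyn, zero_add]
    have := iterate_mem_orbit_iterate hw n
    rwa [← Function.iterate_succ_apply, Function.iterate_succ_apply', hyn, pMap_zero,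
      orbit_eq_bot rfl, Submodule.mem_bot] at this

end Normalization

/-! ### Reading the leading coefficients in the enveloping algebra. -/

section Comparison

variable {p ν : ℕ} [Fact p.Prime] {F : Type u} [Field F] [CharP F p] {G : Type v} [LieRing G]
  [LieAlgebra F G] [RestrictedLieAlgebra p F G] {A : Type w} [Ring A] [Algebra F A]
  [FiniteDimensional F G] {j : G →ₗ[F] A} {k : ℕ} {ε : A →ₐ[F] F} {z : A}
  {m n r s s' : ℕ} {c c' d d' : F} {x y : G}

theorem IsEnvelope.mul_comm_of_lie_eq_zero (hj : IsEnvelope p j) {g : G}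
    (hg : ∀ h : G, ⁅g, h⁆ = 0) (a : A) : j g * a = a * j g := by
  have ha : a ∈ Algebra.adjoin F (Set.range j) := hj.adjoin_eq_top ▸ Algebra.mem_top
  induction ha using Algebra.adjoin_induction with
  | mem a ha =>
    obtain ⟨h, rfl⟩ := ha
    rw [← sub_eq_zero, ← hj.isRep.1, hg, map_zero]
  | algebraMap r => exact (Algebra.commutes r _).symm
  | add a b _ _ ha hb => rw [add_mul, mul_add, ha, hb]
  | mul a b _ _ ha hb => rw [← mul_assoc, ha, mul_assoc, hb, ← mul_assoc]

theorem IsLead.lie_mem (h : IsLead p m n r s c d x y) :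
    ⁅x, y⁆ ∈ orbit p F ((pMap p F)^[r] y) := by
  rw [← sub_add_cancel ⁅x, y⁆ (c • (pMap p F)^[r] y)]
  exact add_mem (orbit_iterate_antitone y (Nat.le_succ r) h.lie_sub_mem)
    (Submodule.smul_mem _ c (mem_orbit_self _))

theorem IsLead.pow_central (h : IsLead p m n r s c d x y) (hj : IsEnvelope p j) (g : G) (a : A) :
    j g ^ p * a = a * j g ^ p := by
  rw [← hj.isRep.2]
  exact hj.mul_comm_of_lie_eq_zero (pMap_sup_of_central h.span h.central
    (orbit_iterate_antitone y (k := 1) h.pos h.lie_mem) g) a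

theorem IsLead.pow_pow_central (h : IsLead p m n r s c d x y) (hj : IsEnvelope p j) (g : G)
    {i : ℕ} (hi : 0 < i) (a : A) : j g ^ p ^ i * a = a * j g ^ p ^ i := by
  obtain ⟨i, rfl⟩ := Nat.exists_eq_add_of_le' hi
  have := h.pow_central hj ((pMap p F)^[i] g) a
  rwa [hj.isRep.map_iterate, ← pow_mul, ← pow_succ] at this

theorem IsLead.left_mem (h : IsLead p m n r s c d x y) :
    (pMap p F)^[m] x ∈ orbit p F ((pMap p F)^[s] y) := by
  rw [← sub_add_cancel ((pMap p F)^[m] x) (d • (pMap p F)^[s] y)]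
  exact add_mem (orbit_iterate_antitone y (Nat.le_succ s) h.left_sub_mem)
    (Submodule.smul_mem _ d (mem_orbit_self _))

/-- A leading exponent `e < m - r` of `u` would, after `m - 1 - e ≥ r` applications of the `p`-map,
put `x^[p]^(m - 1)` in the orbit of `y`. -/
theorem IsLead.mem_orbit_of_iterate_mem (h : IsLead p m n r s c d x y)
    (hk : ∀ x : G, (pMap p F)^[k] x = 0) {u : G} (hu : u ∈ orbit p F x)
    (hur : (pMap p F)^[r] u ∈ orbit p F y) : u ∈ orbit p F ((pMap p F)^[m - r] x) := by
  by_cases h0 : u = 0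
  · rw [h0]; exact zero_mem _
  obtain ⟨e, b, he, hb, hlead⟩ := exists_lead (hk x) hu h0
  have hmem : u ∈ orbit p F ((pMap p F)^[e] x) := by
    rw [← sub_add_cancel u (b • (pMap p F)^[e] x)]
    exact add_mem (orbit_iterate_antitone x (Nat.le_succ e) hlead)
      (Submodule.smul_mem _ b (mem_orbit_self _))
  by_cases hem : m - r ≤ e
  · exact orbit_iterate_antitone x hem hmem
  exfalso
  refine h.left_min (m - 1) (by omega) ?_
  have h1 := iterate_mem_orbit_iterate hlead (m - 1 - e)
  rw [sub_eq_add_neg, ← neg_smul, iterate_add_of_mem_orbit hu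
      (Submodule.smul_mem _ _ (iterate_mem_orbit _ _)), pMap_iterate_smul,
    ← Function.iterate_add_apply, ← Function.iterate_add_apply,
    show m - 1 - e + e = m - 1 by omega, show m - 1 - e + (e + 1) = m by omega] at h1
  have h2 : orbit p F ((pMap p F)^[m] x) ≤ orbit p F y := orbit_le.2 fun i =>
    iterate_mem_orbit_of_mem (orbit_iterate_le _ _ h.left_mem) i
  have h3 : (pMap p F)^[m - 1 - e] u ∈ orbit p F y := by
    rw [show m - 1 - e = (m - 1 - e - r) + r by omega, Function.iterate_add_apply]
    exact iterate_mem_orbit_of_mem hur _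
  have h4 := sub_mem (h2 h1) h3
  rw [add_sub_cancel_left] at h4
  exact (Submodule.smul_mem_iff _ (pow_ne_zero _ (neg_ne_zero.2 hb))).1 h4

/-- Split `g` along the two orbits. The `p`-map is additive modulo the commutator ideal, which lies
in the orbit of `y`, so the `x`-part of `g` has its `p^r`-th power there and
`mem_orbit_of_iterate_mem` applies. -/
theorem IsFrame.exists_eq_of_mem_span (hA : IsFrame p ν ε z) (hj : IsEnvelope p j)
    (hk : ∀ x : G, (pMap p F)^[k] x = 0) (h : IsLead p m n r s c d x y) {u : A}
    (hu : ε u ≠ 0) (hy : j y ^ p ^ r = z * u) {Y : A}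
    (hY : Y ∈ Submodule.span F {e | ∃ (g : G) (b : A), (pMap p F)^[r] g ∈ commIdeal p F G ∧
      e = j g * b}) : ∃ a b, Y = j y * a + j x ^ p ^ (m - r) * b := by
  have hN := hA.commIdeal_eq_of_pow hj hk hu hy
  induction hY using Submodule.span_induction with
  | mem e he =>
    obtain ⟨g, b, hg, rfl⟩ := he
    have hgtop : g ∈ orbit p F x ⊔ orbit p F y := h.span ▸ Submodule.mem_top
    obtain ⟨u, hu, v, hv, rfl⟩ := Submodule.mem_sup.1 hgtop
    have hur : (pMap p F)^[r] u ∈ orbit p F y := by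
      have h1 : (pMap p F)^[r] (u + v) - ((pMap p F)^[r] u + (pMap p F)^[r] v) ∈
          commIdeal p F G := by
        letI := abelianization (p := p) (F := F) (G := G)
        rw [← LieSubmodule.Quotient.mk_eq_zero']
        have := iterate_add_of_lie_eq_zero (p := p) (F := F) (lie_abelianization (p := p) (F := F)
          (LieSubmodule.Quotient.mk u : G ⧸ commIdeal p F G) (LieSubmodule.Quotient.mk v)) r
        rw [quotient_pMap_mk (commIdeal p F G) isRestrictedIdeal_commIdeal r u,
          quotient_pMap_mk (commIdeal p F G) isRestrictedIdeal_commIdeal r v] at this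
        have h3 := quotient_pMap_mk (commIdeal p F G) isRestrictedIdeal_commIdeal r (u + v)
        exact sub_eq_zero.2 (h3.symm.trans this)
      have h2 : (pMap p F)^[r] u + (pMap p F)^[r] v ∈ orbit p F y := by
        have h3 : (pMap p F)^[r] u + (pMap p F)^[r] v ∈ (commIdeal p F G).toSubmodule := by
          have := sub_mem hg h1
          rwa [sub_sub_cancel] at this
        rw [hN] at h3
        exact orbit_iterate_le y r h3
      have := sub_mem h2 (iterate_mem_orbit_of_mem hv r)
      rwa [add_sub_cancel_right] at this
    obtain ⟨e, he⟩ := hj.isRep.exists_map_eq_mul (h.mem_orbit_of_iterate_mem hk hu hur)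
    obtain ⟨e', he'⟩ := hj.isRep.exists_map_eq_mul hv
    refine ⟨e' * b, e * b, ?_⟩
    rw [map_add, he, he', hj.isRep.map_iterate, add_mul, mul_assoc, mul_assoc, add_comm]
  | zero => exact ⟨0, 0, by simp⟩
  | add a b _ _ ha hb =>
    obtain ⟨e, f, rfl⟩ := ha
    obtain ⟨e', f', rfl⟩ := hb
    exact ⟨e + e', f + f', by rw [mul_add, mul_add]; abel⟩
  | smul q a _ ha =>
    obtain ⟨e, f, rfl⟩ := ha
    exact ⟨q • e, q • f, by rw [smul_add, mul_smul_comm, mul_smul_comm]⟩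

/-- With `m = 0`, `x` would lie in the orbit of `y` and commute with it, but `⁅x, y⁆` has a nonzero
leading term. -/
theorem IsLead.left_pos (h : IsLead p m n r s c d x y) (hr : (pMap p F)^[r] y ≠ 0) : 0 < m := by
  rcases Nat.eq_zero_or_pos m with rfl | hm
  · exfalso
    have hx : x ∈ orbit p F y := orbit_iterate_le _ _ h.left_mem
    have h1 := h.lie_sub_mem
    rw [lie_orbit_self hx (mem_orbit_self y), zero_sub, neg_mem_iff] at h1
    exact iterate_not_mem_orbit_succ ((h.right_iff n).2 le_rfl) hr
      ((Submodule.smul_mem_iff _ h.ne_zero).1 h1)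
  · exact hm

set_option maxHeartbeats 1600000 in
/-- Leading coefficients are determined by the relations in the enveloping algebra. -/
theorem IsFrame.isLead_of_relations [PerfectField F] (hA : IsFrame p ν ε z) (hj : IsEnvelope p j)
    (hk : ∀ x : G, (pMap p F)^[k] x = 0) (h : IsLead p m n r s' c' d' x y)
    (hgen : Generates ε j x y) {u : A} (hu : ε u ≠ 0) (hy : j y ^ p ^ r = z * u) {X Y : A}
    (hX : X - j x ∈ aug ε ^ 2) (hY : Y - j y ∈ aug ε ^ 2)
    (hYr : Y ^ p ^ r - j y ^ p ^ r ∈ mulAug ε z)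
    (hXY : X * Y - Y * X - c • Y ^ p ^ r ∈ mulAug ε z)
    (hXm : ∃ e, ε e = 0 ∧ X ^ p ^ m = d • Y ^ p ^ s + Y ^ p ^ s * e) (hss : s ≤ s')
    (hlt : s < m → r < s ∧ d ≠ 0) : IsLead p m n r s c d x y := by
  have hp := (Fact.out : p.Prime)
  have hnt : Nontrivial A := ε.toRingHom.domain_nontrivial
  have hε : ∀ x, ε (j x) = 0 := hj.isRep.map_eq_zero hk ε
  obtain ⟨N, hN⟩ := hA.exists_pow
  have hyr0 : (pMap p F)^[r] y ≠ 0 := fun h0 => by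
    have h1 := hj.isRep.map_iterate r y
    rw [h0, map_zero, hy] at h1
    exact hA.ne_zero (((isUnit_of_augmentation_ne_zero hN hu).mul_left_eq_zero).1 h1.symm)
  have hm0 := h.left_pos hyr0
  have hs0 : 0 < s := by
    rcases (hss.trans h.le).lt_or_eq with h1 | h1
    · have := (hlt h1).1; omega
    · omega
  -- Replacing `X`, `Y` by `j x`, `j y` changes the commutator only by zω, because ω² is central
  -- modulo zω.
  have hcc : c' = c := by
    have h1 : j ⁅x, y⁆ - c' • j y ^ p ^ r ∈ mulAug ε z := by
      have h2 := h.lie_sub_mem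
      rw [Function.iterate_succ_apply'] at h2
      obtain ⟨v, hv, hjv⟩ := hj.isRep.exists_map_eq_mul_aug hε h2
      rw [map_sub, map_smul, hj.isRep.map_iterate] at hjv
      rw [hjv, hy, mul_assoc]
      exact ⟨u * v, by rw [SetLike.mem_coe, mem_aug, map_mul, hv, mul_zero], rfl⟩
    have h2 : X * Y - Y * X - j ⁅x, y⁆ ∈ mulAug ε z := by
      have h3 := hA.commutator_mem hX Y
      have h4 := hA.commutator_mem hY (j x)
      have := sub_mem h4 h3
      rw [hj.isRep.1]
      convert this using 1
      noncomm_ring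
    have h3 : (c' - c) • j y ^ p ^ r ∈ mulAug ε z := by
      have := sub_mem (add_mem hXY (Submodule.smul_mem _ c hYr)) (add_mem h2 h1)
      convert this using 1
      rw [smul_sub, sub_smul]
      abel
    obtain ⟨v, hv, hzv⟩ := mem_mulAug.1 h3
    rw [hy, ← mul_smul_comm] at hzv
    have := augmentation_eq_zero_of_mul_eq hN hA.ne_zero hzv.symm hv
    rw [map_smul, smul_eq_mul, mul_eq_zero, sub_eq_zero] at this
    exact this.resolve_right hu
  subst hcc
  refine ⟨h.span, h.finrank_eq, h.central, h.pos, h.ne_zero, h.lie_sub_mem, ?_, hss.trans h.le, hlt,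
    h.left_min, h.right_iff⟩
  -- Since `s ≤ s'`, the element `x^[p]^m` has a coefficient `e` at level `s`, possibly zero. It
  -- remains to prove `e = d`, working modulo `E ω` with `E = j y ^ p ^ s`.
  have hxs : (pMap p F)^[m] x ∈ orbit p F ((pMap p F)^[s] y) :=
    orbit_iterate_antitone y hss h.left_mem
  by_cases hns : n ≤ s
  · have h0 := (h.right_iff s).2 hns
    rw [orbit_eq_bot h0, Submodule.mem_bot] at hxs
    rw [hxs, h0, smul_zero, sub_zero]; exact zero_mem _
  have hE0 : j y ^ p ^ s ≠ 0 := by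
    rw [← hj.isRep.map_iterate, Ne, map_eq_zero_iff j (hj.injective hk), h.right_iff]; exact hns
  obtain ⟨e, he⟩ := exists_sub_smul_mem_orbit hxs
  have hmul : ∀ {w : G}, w ∈ orbit p F ((pMap p F)^[s] y) → ∀ {a : A}, ε a = 0 →
      j w * a ∈ mulAug ε (j y ^ p ^ s) := by
    intro w hw a ha
    obtain ⟨v, hv⟩ := hj.isRep.exists_map_eq_mul hw
    exact ⟨v * a, by rw [SetLike.mem_coe, mem_aug, map_mul, ha, mul_zero], by
      rw [hv, hj.isRep.map_iterate, LinearMap.mulLeft_apply, mul_assoc]⟩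
  have hmul' : ∀ {w : G}, w ∈ orbit p F ((pMap p F)^[s + 1] y) → ∀ (a : A),
      j w * a ∈ mulAug ε (j y ^ p ^ s) := by
    intro w hw a
    rw [Function.iterate_succ_apply'] at hw
    obtain ⟨v, hv, hjv⟩ := hj.isRep.exists_map_eq_mul_aug hε hw
    exact ⟨v * a, by rw [SetLike.mem_coe, mem_aug, map_mul, hv, zero_mul], by
      rw [hjv, hj.isRep.map_iterate, LinearMap.mulLeft_apply, mul_assoc]⟩
  have hz : ∃ w, z = j y ^ p ^ r * w := by
    obtain ⟨w, hw⟩ := (isUnit_of_augmentation_ne_zero hN hu).exists_right_inv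
    exact ⟨w, by rw [hy, mul_assoc, hw, mul_one]⟩
  obtain ⟨w, hw⟩ := hz
  -- `z` is a multiple of `j y ^ p ^ r`, so `z ^ p ^ i` is a multiple of `E` once `r + i ≥ s`.
  have hzpow : ∀ {i : ℕ}, s ≤ r + i → ∀ {a : A}, ε a = 0 →
      z ^ p ^ i * a ∈ mulAug ε (j y ^ p ^ s) := by
    intro i hi a ha
    have h1 : z ^ p ^ i * a = j ((pMap p F)^[r + i] y) * (w ^ p ^ i * a) := by
      rw [hw, Commute.mul_pow (h.pow_pow_central hj y h.pos w), hj.isRep.map_iterate, ← pow_mul,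
        ← pow_add, mul_assoc]
    rw [h1]
    exact hmul (orbit_iterate_antitone y hi (mem_orbit_self _))
      (by rw [map_mul, ha, mul_zero])
  have hcen := h.pow_central hj
  have hexp : ∀ (a b : A) (g : G), ε a = 0 → ε b = 0 → ∀ i, s ≤ i + 1 → m ≤ i + 1 →
      (j g + j x * a + j y * b) ^ p ^ (i + 1) - j g ^ p ^ (i + 1) ∈ mulAug ε (j y ^ p ^ s) := by
    intro a b g ha hb i hi hmi
    obtain ⟨c, d, v, hc, hd, hv, hsum⟩ := hA.exists_pow_expansion hj.adjoin_eq_top hε hcen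
      (hcen g) (hcen x) (hcen y) (hε x) (hε y) (mem_aug_sq_of_mem (hε x) ha)
      (mem_aug_sq_of_mem (hε y) hb) i
    rw [ha, zero_pow (pow_ne_zero _ hp.ne_zero)] at hc
    rw [hb, zero_pow (pow_ne_zero _ hp.ne_zero)] at hd
    rw [hsum]
    have h1 := hmul (w := (pMap p F)^[i + 1] x) (by
      rw [show i + 1 = (i + 1 - m) + m by omega, Function.iterate_add_apply]
      exact iterate_mem_orbit_of_mem hxs _) hc
    have h2 := hmul (orbit_iterate_antitone y hi (mem_orbit_self _)) hd
    have h3 := hzpow (i := i) (by have := h.pos; omega) hv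
    rw [hj.isRep.map_iterate] at h1 h2
    have := add_mem (add_mem h1 h2) h3
    convert this using 1
    abel
  have hX' : X ^ p ^ m - j x ^ p ^ m ∈ mulAug ε (j y ^ p ^ s) := by
    obtain ⟨a, b, ha, hb, hab⟩ := hgen.exists_eq_of_mem_sq hj.adjoin_eq_top hε hN hX
    obtain ⟨i, rfl⟩ : ∃ i, m = i + 1 := Nat.exists_eq_add_of_le' hm0
    have := hexp a b x ha hb i (hss.trans h.le) le_rfl
    rwa [add_assoc, ← hab, add_sub_cancel] at this
  -- When `s < m`, the generic expansion fails: `x^[p]^s` need not lie in the orbit of `y`. Instead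
  -- `Y ^ p ^ r ∈ zA` forces `Y = y a' + x^(p^(m-r)) b`. The `p^s`-th power of the last term
  -- involves `x^[p]^(m-r+s)`, in the orbit of `y^[p]^(2s-r)`, and `2s - r ≥ s + 1` because `r < s`.
  have hY' : Y ^ p ^ s - j y ^ p ^ s ∈ mulAug ε (j y ^ p ^ s) := by
    obtain ⟨i, rfl⟩ : ∃ i, s = i + 1 := Nat.exists_eq_add_of_le' hs0
    rcases (hss.trans h.le).lt_or_eq with hsm | hsm
    · have hrs := (hlt hsm).1
      have hexp1 : m - r + (i + 1) = (i + 1 - r) + m := by omega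
      have hexp2 : i + 1 + 1 ≤ i + 1 - r + (i + 1) := by omega
      have hexp3 : i + 1 ≤ r + i := by have := h.pos; omega
      have hexp4 : 1 ≤ m - r := by omega
      have hYz : ∃ c, Y ^ p ^ r = z * c := by
        obtain ⟨v, -, hv⟩ := mem_mulAug.1 hYr
        exact ⟨v + u, by rw [mul_add, hv, ← hy, sub_add_cancel]⟩
      obtain ⟨Y', hY', e, hYe⟩ := hA.exists_mem_span hj hk hgen hYz
      obtain ⟨a, b, hab⟩ := hA.exists_eq_of_mem_span hj hk h hu hy hY'
      obtain ⟨t, ht⟩ : ∃ t, p ^ r = t + 1 := Nat.exists_eq_add_of_le'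
        (Nat.one_le_pow r p hp.pos)
      set a' := a + j y ^ t * w * e with ha'
      have hYab : Y = j y * a' + j x ^ p ^ (m - r) * b := by
        rw [hYe, hab, ha', hw, ht, pow_succ', mul_add, mul_assoc, mul_assoc, mul_assoc]
        abel
      have hxmr : j x ^ p ^ (m - r) * b ∈ aug ε ^ 2 := by
        refine mul_mem_aug_sq_right ?_ b
        obtain ⟨l, hl⟩ : ∃ l, p ^ (m - r) = l + 1 + 1 := by
          refine Nat.exists_eq_add_of_le' (m := 2) ?_
          calc 2 ≤ p := hp.two_le
            _ = p ^ 1 := (pow_one p).symm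
            _ ≤ p ^ (m - r) := Nat.pow_le_pow_right hp.pos hexp4
        rw [hl, pow_succ (j x)]
        exact mem_aug_sq_of_mem 
          (by rw [map_pow, hε x, zero_pow (Nat.succ_ne_zero l)]) (hε x)
      -- Modulo ω² both `Y` and `ε a' • j y` equal `j y`, and `j y` is not in ω².
      have hya : ε a' - 1 = 0 := by
        refine (hA.eq_zero_of_generates hj hk hgen (a := 0) (b := ε a' - 1) ?_)
        have h1 := sub_mem hY hxmr
        have h2 : j y * (a' - algebraMap F A (ε a')) ∈ aug ε ^ 2 :=
          mem_aug_sq_of_mem (hε y) (sub_algebraMap_mem_aug a')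
        have := sub_mem h1 h2
        convert this using 1
        rw [hYab, zero_smul, zero_add, map_smul, mul_sub, ← Algebra.commutes, ← Algebra.smul_def,
          sub_smul, one_smul]
        abel
      have hYe' : Y = j y + j y * (a' - 1) + j x ^ p ^ (m - r) * b := by
        rw [hYab, mul_sub, mul_one]; abel
      have ha1 : ε (a' - 1) = 0 := by rw [map_sub, map_one, hya]
      have hxp : ∀ c, (j x ^ p ^ (m - r)) ^ p * c = c * (j x ^ p ^ (m - r)) ^ p := fun c => by
        rw [← hj.isRep.map_iterate]; exact hcen _ c
      obtain ⟨c, d, v, hc, -, hv, hsum⟩ := hA.exists_pow_expansion hj.adjoin_eq_top hε hcen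
        (hcen y) (hcen y) hxp (hε y)
        (by rw [← hj.isRep.map_iterate]; exact hε _) (mem_aug_sq_of_mem (hε y) ha1)
        hxmr i
      rw [ha1, zero_pow (pow_ne_zero _ hp.ne_zero)] at hc
      rw [hYe', hsum]
      have h1 := hmul (mem_orbit_self _) hc
      rw [hj.isRep.map_iterate] at h1
      have h2 := hmul' (w := (pMap p F)^[m - r + (i + 1)] x) (by
        rw [hexp1, Function.iterate_add_apply (pMap p F) (i + 1 - r) m x]
        have h3 := iterate_mem_orbit_iterate hxs (i + 1 - r)
        rw [← Function.iterate_add_apply (pMap p F) _ _ y] at h3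
        exact orbit_iterate_antitone y hexp2 h3) d
      rw [hj.isRep.map_iterate, pow_add p (m - r), pow_mul (j x)] at h2
      have h3 := hzpow (i := i) hexp3 hv
      have := add_mem (add_mem h1 h2) h3
      convert this using 1
      abel
    · obtain ⟨a, b, ha, hb, hab⟩ := hgen.exists_eq_of_mem_sq hj.adjoin_eq_top hε hN hY
      have := hexp a b y ha hb i le_rfl hsm.ge
      rwa [add_assoc, ← hab, add_sub_cancel] at this
  -- Both expressions for `X ^ p ^ m` are now `E` times a scalar plus an element of ω, and the
  -- scalars must agree as `E ≠ 0`.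
  have hed : e = d := by
    obtain ⟨f, hf, hXf⟩ := hXm
    obtain ⟨v, hv, hYv⟩ := mem_mulAug.1 hY'
    obtain ⟨v', hv', hXv⟩ := mem_mulAug.1 hX'
    obtain ⟨v'', hv'', hjv⟩ := hj.isRep.exists_map_eq_mul_aug hε he
    rw [map_sub, map_smul, hj.isRep.map_iterate, hj.isRep.map_iterate] at hjv
    have hYs : Y ^ p ^ s = j y ^ p ^ s * (1 + v) := by
      rw [mul_add, mul_one, hYv, add_sub_cancel]
    have hkey : j y ^ p ^ s * ((e - d) • 1) =
        j y ^ p ^ s * (d • v + (1 + v) * f - v' - v'') := by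
      have h1 : j x ^ p ^ m = e • j y ^ p ^ s + j y ^ p ^ s * v'' := by rw [← hjv]; abel
      have h2 : j y ^ p ^ s * v' = X ^ p ^ m - j x ^ p ^ m := hXv
      rw [hXf, h1, hYs] at h2
      rw [mul_sub, mul_sub, h2, mul_smul_comm, mul_one, sub_smul, mul_add, mul_smul_comm,
        mul_add, mul_one, smul_add, add_mul, add_mul, one_mul, mul_add, mul_assoc]
      abel
    have := augmentation_eq_zero_of_mul_eq hN hE0 hkey (by
      rw [map_sub, map_sub, map_add, map_smul, map_mul, hv, hf, hv', hv'']; simp)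
    rw [map_smul, map_one, smul_eq_mul, mul_one, sub_eq_zero] at this
    exact this
  rw [← hed, Function.iterate_succ_apply']
  exact he

end Comparison

/-! ### The frame of a nonabelian metacyclic algebra. -/

section Metacyclic

variable {p : ℕ} [Fact p.Prime] {F : Type u} [Field F] [CharP F p] {G : Type v} [LieRing G]
  [LieAlgebra F G] [RestrictedLieAlgebra p F G] {A : Type w} [Ring A] [Algebra F A]
  [FiniteDimensional F G] {j : G →ₗ[F] A} {k : ℕ} {x y : G}

theorem commutator_mem_of_adjoin {S : Set A} (hS : Algebra.adjoin F S = ⊤) {z : A}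
    (hz : ∀ a, z * a = a * z) (h : ∀ a ∈ S, ∀ b ∈ S, ∃ c, a * b - b * a = z * c) (a b : A) :
    ∃ c, a * b - b * a = z * c := by
  have key : ∀ (e : A), (∀ a ∈ S, ∃ c, a * e - e * a = z * c) →
      ∀ a, ∃ c, a * e - e * a = z * c := by
    intro e he a
    have ha : a ∈ Algebra.adjoin F S := hS ▸ Algebra.mem_top
    induction ha using Algebra.adjoin_induction with
    | mem a ha => exact he a ha
    | algebraMap r => exact ⟨0, by rw [Algebra.commutes r e, sub_self, mul_zero]⟩
    | add a b _ _ ha hb =>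
      obtain ⟨c, hc⟩ := ha
      obtain ⟨d, hd⟩ := hb
      refine ⟨c + d, ?_⟩
      rw [mul_add z, ← hc, ← hd]; noncomm_ring
    | mul a b _ _ ha hb =>
      obtain ⟨c, hc⟩ := ha
      obtain ⟨d, hd⟩ := hb
      refine ⟨a * d + c * b, ?_⟩
      rw [mul_add z, ← mul_assoc z a, hz a, mul_assoc a z, ← hd, ← mul_assoc z, ← hc]
      noncomm_ring
  refine key b (fun a ha => ?_) a
  obtain ⟨c, hc⟩ := key a (fun b hb => h b hb a ha) b
  exact ⟨-c, by rw [mul_neg, ← hc, neg_sub]⟩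

theorem pow_mem_aug_sq {ε : A →ₐ[F] F} {a : A} (ha : ε a = 0) {n : ℕ} (hn : 2 ≤ n) :
    a ^ n ∈ aug ε ^ 2 := by
  obtain ⟨l, rfl⟩ := Nat.exists_eq_add_of_le' hn
  rw [pow_add]
  exact mul_mem_aug_sq_left (Submodule.pow_mem_pow _ (mem_aug.2 ha) 2) _

/-- `⁅x, y⁆` is central and spans all brackets, so its orbit is the whole commutator ideal and its
image divides every commutator of `A`. -/
theorem IsEnvelope.isFrame (hj : IsEnvelope p j) (hk : ∀ x : G, (pMap p F)^[k] x = 0)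
    (hxy : orbit p F x ⊔ orbit p F y = ⊤) (hmem : ⁅x, y⁆ ∈ orbit p F (pMap p F y))
    (hne : ⁅x, y⁆ ≠ 0) (ε : A →ₐ[F] F) :
    IsFrame p (Module.finrank F (orbit p F ⁅x, y⁆)) ε (j ⁅x, y⁆) := by
  have hnt : Nontrivial A := ε.toRingHom.domain_nontrivial
  have hε : ∀ x, ε (j x) = 0 := hj.isRep.map_eq_zero hk ε
  have hc := lie_iterate_eq_zero_of_lie_mem hmem
  have hcen : ∀ a, j ⁅x, y⁆ * a = a * j ⁅x, y⁆ := hj.mul_comm_of_lie_eq_zero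
    (lie_eq_zero_of_mem_orbit_pMap hxy hc (Submodule.mem_sup_right hmem))
  have hisc : ∃ a b, j ⁅x, y⁆ = a * b - b * a := ⟨j x, j y, hj.isRep.1 x y⟩
  have hcomm : ∀ a b, ∃ c, a * b - b * a = j ⁅x, y⁆ * c := by
    refine commutator_mem_of_adjoin hj.adjoin_eq_top hcen ?_
    rintro _ ⟨a, rfl⟩ _ ⟨b, rfl⟩
    obtain ⟨q, hq⟩ := Submodule.mem_span_singleton.1 (lie_mem_of_central hxy hc
      (Submodule.mem_span_singleton_self (R := F) ⁅x, y⁆) a b)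
    exact ⟨algebraMap F A q, by
      rw [← hj.isRep.1, ← hq, map_smul, Algebra.smul_def, Algebra.commutes]⟩
  have hN : (commIdeal p F G).toSubmodule = orbit p F ⁅x, y⁆ := by
    refine le_antisymm (commIdeal_le_of_central hxy hc (mem_orbit_self _)
      fun w hw => iterate_mem_orbit_of_mem hw 1) (orbit_le.2 fun i => ?_)
    induction i with
    | zero => exact lie_mem_commIdeal x y
    | succ i ih =>
      rw [Function.iterate_succ_apply']
      exact isRestrictedIdeal_commIdeal _ ih
  refine ⟨exists_aug_pow_eq_bot hj.isRep hj.adjoin_eq_top hk ε, hcen, hisc, hcomm, ?_,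
    fun i => ?_, ?_, j x, j y, ?_⟩
  · rw [Nat.pos_iff_ne_zero, Ne, ← Nat.le_zero, ← iterate_finrank_orbit (hk _)]
    exact hne
  · rw [← hj.isRep.map_iterate, map_eq_zero_iff j (hj.injective hk), iterate_finrank_orbit (hk _)]
  · rw [(hj.finrank_commIdeal hk hcen hisc hcomm).2]
    congr 2
    exact congrArg (fun W : Submodule F G => Module.finrank F W) hN
  · have hmem2 : ∀ g : G, ∀ i, j ((pMap p F)^[i + 1] g) ∈ aug ε ^ 2 := by
      intro g i
      rw [Function.iterate_succ_apply', hj.isRep.2]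
      exact pow_mem_aug_sq (hε _) (Fact.out : p.Prime).two_le
    refine (IsRep.aug_le_range_sup hj.adjoin_eq_top hε).trans (sup_le ?_ le_sup_right)
    rw [LinearMap.range_eq_map, ← hxy, Submodule.map_le_iff_le_comap]
    refine sup_le (orbit_le.2 fun i => ?_) (orbit_le.2 fun i => ?_) <;> cases i with
    | zero => exact Submodule.mem_sup_left (Submodule.subset_span (by simp))
    | succ i => exact Submodule.mem_sup_right (hmem2 _ i)

/-- With leading term `c • y^[p]^(e+1)`, the image of `⁅x, y⁆` is `j y ^ p ^ (e+1)` times an element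
of augmentation `c ≠ 0`, a unit. -/
theorem IsEnvelope.exists_hasPower (hj : IsEnvelope p j) (hk : ∀ x : G, (pMap p F)^[k] x = 0)
    (hmem : ⁅x, y⁆ ∈ orbit p F (pMap p F y)) (hne : ⁅x, y⁆ ≠ 0) (ε : A →ₐ[F] F) :
    ∃ r, 0 < r ∧ HasPower p ε (j ⁅x, y⁆) j r := by
  have hnt : Nontrivial A := ε.toRingHom.domain_nontrivial
  have hε : ∀ x, ε (j x) = 0 := hj.isRep.map_eq_zero hk ε
  obtain ⟨N, hN⟩ := exists_aug_pow_eq_bot hj.isRep hj.adjoin_eq_top hk ε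
  obtain ⟨e, c, -, hc, he⟩ := exists_lead (hk (pMap p F y)) hmem hne
  rw [Function.iterate_succ_apply', ← Function.iterate_succ_apply] at he
  obtain ⟨v, hv, hjv⟩ := hj.isRep.exists_map_eq_mul_aug hε he
  rw [map_sub, map_smul, sub_eq_iff_eq_add, hj.isRep.map_iterate] at hjv
  have hw : ε (v + algebraMap F A c) ≠ 0 := by
    rw [map_add, hv, zero_add, AlgHom.commutes]; exact hc
  obtain ⟨u, hu⟩ := (isUnit_of_augmentation_ne_zero hN hw).exists_right_inv
  refine ⟨e + 1, e.succ_pos, y, u, fun h0 => ?_, ?_⟩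
  · have := congrArg ε hu
    rw [map_mul, h0, mul_zero, map_one] at this
    exact zero_ne_one this
  · rw [hjv, Algebra.smul_def, Algebra.commutes, ← mul_add, mul_assoc, hu, mul_one]

theorem IsRep.lt_of_hasPower (hj : IsRep p j) (hk : ∀ x : G, (pMap p F)^[k] x = 0) {ε : A →ₐ[F] F}
    {n : ℕ} (hn : aug ε ^ n = ⊥) {z : A} (hz : z ≠ 0) {r : ℕ} (h : HasPower p ε z j r) :
    r < k := by
  by_contra hr
  obtain ⟨g, u, hu, hg⟩ := h
  obtain ⟨s, rfl⟩ := Nat.exists_eq_add_of_le' (not_lt.1 hr)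
  rw [← hj.map_iterate, Function.iterate_add_apply, hk, pMap_iterate_zero, map_zero] at hg
  exact hz ((isUnit_of_augmentation_ne_zero hn hu).mul_left_eq_zero.1 hg.symm)

end Metacyclic

/-! ### The maximal exponent `r` is an invariant of the algebra. -/

section Power

variable {p ν : ℕ} [Fact p.Prime] {F : Type u} [Field F] [CharP F p] [PerfectField F]
  {G : Type v} [LieRing G] [LieAlgebra F G] [RestrictedLieAlgebra p F G] [FiniteDimensional F G]
  {G' : Type*} [LieRing G'] [LieAlgebra F G'] [RestrictedLieAlgebra p F G']
  {A : Type w} [Ring A] [Algebra F A]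
  {j : G →ₗ[F] A} {j' : G' →ₗ[F] A} {k r : ℕ} {ε : A →ₐ[F] F} {z : A}

/-- The linear part in `G` of `j' g` has the same `p^r`-th power modulo zω, hence again `z` times an
element of nonzero augmentation. -/
theorem IsFrame.hasPower (hA : IsFrame p ν ε z) (hj : IsEnvelope p j)
    (hk : ∀ x : G, (pMap p F)^[k] x = 0) (hr : 0 < r) (h : HasPower p ε z j' r) :
    HasPower p ε z j r := by
  obtain ⟨g, u, hu, hg⟩ := h
  obtain ⟨x, y, hgen⟩ := hA.exists_generates hj hk
  obtain ⟨g', -, hg'⟩ := hA.exists_linear_part_pow hj hk hgen hr ⟨u, hg⟩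
  obtain ⟨v, hv, hzv⟩ := mem_mulAug.1 hg'
  refine ⟨g', u - v, by rwa [map_sub, hv, sub_zero], ?_⟩
  rw [mul_sub, hzv, ← hg, sub_sub_cancel]

/-- If `g` belongs to no generating pair, then `j g ∈ ω²`, and `g` is a `p`-th power of some `h`
modulo the commutator ideal. Then `h` realizes the exponent `r + 1`. -/
theorem IsFrame.exists_generates_of_pow (hA : IsFrame p ν ε z) (hj : IsEnvelope p j)
    (hk : ∀ x : G, (pMap p F)^[k] x = 0) (hr : 0 < r) {g : G} {u : A} (hu : ε u ≠ 0)
    (hg : j g ^ p ^ r = z * u) (hmax : ∀ r', r < r' → ¬ HasPower p ε z j r') :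
    ∃ x, Generates ε j x g := by
  have hp := (Fact.out : p.Prime)
  have hnt : Nontrivial A := ε.toRingHom.domain_nontrivial
  have hε : ∀ x, ε (j x) = 0 := hj.isRep.map_eq_zero hk ε
  obtain ⟨x, y, hgen⟩ := hA.exists_generates hj hk
  obtain ⟨a, b, hab⟩ := hgen g
  by_cases hb : b = 0
  swap
  · exact ⟨x, hgen.of_sub_mem hb hab⟩
  by_cases ha : a = 0
  swap
  · exact ⟨y, hgen.symm.of_sub_mem (a := b) ha (by rwa [add_comm])⟩
  exfalso
  rw [ha, hb, zero_smul, zero_smul, add_zero, map_zero, sub_zero] at hab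
  obtain ⟨h, q, hq⟩ : ∃ (h : G) (q : A), j g = j h ^ p + z * q := by
    letI := abelianization (p := p) (F := F) (G := G)
    have htop := hj.orbit_abelianization hk hgen
    have hmem : (LieSubmodule.Quotient.mk g : G ⧸ commIdeal p F G) ∈
        orbit p F (LieSubmodule.Quotient.mk x : G ⧸ commIdeal p F G) ⊔
          orbit p F (LieSubmodule.Quotient.mk y : G ⧸ commIdeal p F G) := htop ▸ Submodule.mem_top
    obtain ⟨w₁, hw₁, w₂, hw₂, hw⟩ := Submodule.mem_sup.1 hmem
    obtain ⟨c, hc⟩ := exists_sub_smul_mem_orbit hw₁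
    obtain ⟨d, hd⟩ := exists_sub_smul_mem_orbit hw₂
    obtain ⟨v₁, -, hv₁⟩ := exists_iterate_eq (k := 1) hc
    obtain ⟨v₂, -, hv₂⟩ := exists_iterate_eq (k := 1) hd
    obtain ⟨h, hh⟩ := LieSubmodule.Quotient.surjective_mk' _ (v₁ + v₂)
    have h1 : pMap p F (LieSubmodule.Quotient.mk h : G ⧸ commIdeal p F G) =
        LieSubmodule.Quotient.mk g - c • LieSubmodule.Quotient.mk x -
          d • LieSubmodule.Quotient.mk y := by
      have := iterate_add_of_lie_eq_zero (p := p) (F := F) (lie_abelianization v₁ v₂) 1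
      rw [hv₁, hv₂, ← hh] at this
      refine Eq.trans this ?_
      rw [← hw]; abel
    have h2 : pMap p F h - (g - c • x - d • y) ∈ commIdeal p F G := by
      rw [← LieSubmodule.Quotient.mk_eq_zero']
      have h3 := quotient_pMap_mk (commIdeal p F G) isRestrictedIdeal_commIdeal 1 h
      exact sub_eq_zero.2 (h3.symm.trans h1)
    obtain ⟨q, hq⟩ := (hA.mem_commIdeal_iff hj hk _).1 h2
    rw [map_sub, map_sub, map_sub, hj.isRep.2, ← sub_add, ← sub_add, map_smul, map_smul] at hq
    have hmem : j (c • x + d • y) ∈ aug ε ^ 2 := by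
      have h3 : j h ^ p ∈ aug ε ^ 2 := pow_mem_aug_sq (hε h) hp.two_le
      have := add_mem (sub_mem (mul_mem_aug_sq_right hA.mem_aug_sq q) h3) hab
      rw [← hq] at this
      convert this using 1
      rw [map_add, map_smul, map_smul]; abel
    have hd0 := hA.eq_zero_of_generates hj hk hgen hmem
    have hc0 := hA.eq_zero_of_generates hj hk hgen.symm (by rwa [add_comm])
    refine ⟨h, -q, ?_⟩
    rw [mul_neg, ← hq, hc0, hd0, zero_smul, zero_smul]; abel
  refine hmax (r + 1) r.lt_succ_self ?_
  have h1 := hA.add_pow_char_pow_sub_mem (j h ^ p) (mul_mem_aug_sq_right hA.mem_aug_sq q) r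
  rw [← hq, hg, ← pow_mul, ← pow_succ'] at h1
  have h2 : (z * q) ^ p ^ r ∈ mulAug ε z := by
    obtain ⟨l, hl⟩ : ∃ l, p ^ r = l + 1 + 1 := by
      refine Nat.exists_eq_add_of_le' (m := 2) ?_
      calc 2 ≤ p := hp.two_le
        _ = p ^ 1 := (pow_one p).symm
        _ ≤ p ^ r := Nat.pow_le_pow_right hp.pos hr
    rw [Commute.mul_pow (hA.central q), hl, pow_succ' z, mul_assoc]
    exact ⟨_, mem_aug.2 (by
      rw [map_mul, map_pow, hA.augmentation_eq_zero, zero_pow l.succ_ne_zero, zero_mul]), rfl⟩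
  obtain ⟨v, hv, hzv⟩ := mem_mulAug.1 (add_mem h1 h2)
  refine ⟨h, u - v, by rwa [map_sub, hv, sub_zero], ?_⟩
  rw [mul_sub, hzv]; abel

end Power

theorem IsIso.symm {p : ℕ} {F : Type*} [Field F] {G : Type*} [LieRing G] [LieAlgebra F G]
    [RestrictedLieAlgebra p F G] {G' : Type*} [LieRing G'] [LieAlgebra F G']
    [RestrictedLieAlgebra p F G'] (h : IsIso p F G G') : IsIso p F G' G := by
  obtain ⟨e, he⟩ := h
  exact ⟨e.symm, fun x => e.injective <| by
    refine (e.apply_symm_apply _).trans (Eq.trans ?_ (he _).symm)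
    exact congrArg _ (e.apply_symm_apply x).symm⟩

/-! ### The nonabelian case. -/

section Noncommutative

variable {p ν : ℕ} [Fact p.Prime] {F : Type u} [Field F] [CharP F p] [PerfectField F]
  {G : Type v} [LieRing G] [LieAlgebra F G] [RestrictedLieAlgebra p F G] [FiniteDimensional F G]
  {G' : Type*} [LieRing G'] [LieAlgebra F G'] [RestrictedLieAlgebra p F G']
  [FiniteDimensional F G'] {A : Type w} [Ring A] [Algebra F A]
  {j : G →ₗ[F] A} {j' : G' →ₗ[F] A} {k k' r s : ℕ} {ε : A →ₐ[F] F} {z : A}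

/-- The Lie algebra has generators with leading exponent `s` whose second member has its
`p^r`-th power in `z A` but not in `z ω`. -/
def HasLead (p ν : ℕ) {F : Type u} [Field F] {G : Type v} [LieRing G] [LieAlgebra F G]
    [RestrictedLieAlgebra p F G] {A : Type w} [Ring A] [Algebra F A] (ε : A →ₐ[F] F) (z : A)
    (j : G →ₗ[F] A) (r s : ℕ) : Prop :=
  ∃ (m : ℕ) (c d : F) (x y : G) (u : A), IsLead p m (r + ν) r s c d x y ∧ Generates ε j x y ∧
    ε u ≠ 0 ∧ j y ^ p ^ r = z * u

/-- The linear parts in `G'` of the generators of `G` generate `G'`. Minimality of `s` provides the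
inequality `s ≤ s'` that `isLead_of_relations` needs to transfer all parameters. -/
theorem IsFrame.isIso_of_hasLead (hA : IsFrame p ν ε z) (hj : IsEnvelope p j)
    (hk : ∀ x : G, (pMap p F)^[k] x = 0) (hj' : IsEnvelope p j')
    (hk' : ∀ x : G', (pMap p F)^[k'] x = 0) (hr : 0 < r)
    (hmax : ∀ r', r < r' → ¬ HasPower p ε z j r') (h : HasLead p ν ε z j r s)
    (hmin : ∀ s', HasLead p ν ε z j' r s' → s ≤ s') : IsIso p F G G' := by
  have hnt : Nontrivial A := ε.toRingHom.domain_nontrivial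
  have hε : ∀ x, ε (j x) = 0 := hj.isRep.map_eq_zero hk ε
  have hε' : ∀ x, ε (j' x) = 0 := hj'.isRep.map_eq_zero hk' ε
  obtain ⟨m, c, d, x, y, u, hlead, hgen, hu, hy⟩ := h
  have hmax' : ∀ r', r < r' → ¬ HasPower p ε z j' r' := fun r' hr' h' =>
    hmax r' hr' (hA.hasPower hj hk (hr.trans hr') h')
  obtain ⟨x', hx'⟩ := exists_sub_map_mem hj'.adjoin_eq_top hε' (hε x)
  obtain ⟨x₀, y₀, hgen₀⟩ := hA.exists_generates hj' hk'
  obtain ⟨y', hy', hyr⟩ := hA.exists_linear_part_pow hj' hk' hgen₀ hr ⟨u, hy⟩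
  have hgen' : Generates ε j' x' y' :=
    generates_of_aug_le hε' (hgen.aug_le hj.adjoin_eq_top hε) hx' hy'
  obtain ⟨v, hv, hzv⟩ := mem_mulAug.1 hyr
  have hu' : ε (u - v) ≠ 0 := by rwa [map_sub, hv, sub_zero]
  have hyu : j' y' ^ p ^ r = z * (u - v) := by rw [mul_sub, hzv, ← hy, sub_sub_cancel]
  obtain ⟨m', s', c', d', hlead'⟩ := hA.exists_isLead hj' hk' hgen' hr hu' hyu hmax'
  obtain rfl : m = m' := by
    have h1 := (hj.finrank_eq hk).2.symm.trans (hj'.finrank_eq hk').2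
    have h2 := Nat.pow_right_injective (Fact.out : p.Prime).two_le h1
    rw [hlead.finrank_eq, hlead'.finrank_eq] at h2
    exact Nat.add_right_cancel h2
  have hss : s ≤ s' := hmin s' ⟨m, c', d', x', y', u - v, hlead', hgen', hu', hyu⟩
  have hXY : j x * j y - j y * j x - c • j y ^ p ^ r ∈ mulAug ε z := by
    have h1 := hlead.lie_sub_mem
    rw [Function.iterate_succ_apply'] at h1
    obtain ⟨w, hw, hjw⟩ := hj.isRep.exists_map_eq_mul_aug hε h1
    rw [map_sub, map_smul, hj.isRep.1, hj.isRep.map_iterate] at hjw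
    rw [hjw, hy, mul_assoc]
    exact ⟨u * w, mem_aug.2 (by rw [map_mul, hw, mul_zero]), rfl⟩
  have hXm : ∃ e, ε e = 0 ∧ j x ^ p ^ m = d • j y ^ p ^ s + j y ^ p ^ s * e := by
    have h1 := hlead.left_sub_mem
    rw [Function.iterate_succ_apply'] at h1
    obtain ⟨w, hw, hjw⟩ := hj.isRep.exists_map_eq_mul_aug hε h1
    rw [map_sub, map_smul, hj.isRep.map_iterate, hj.isRep.map_iterate] at hjw
    exact ⟨w, hw, by rw [← hjw, add_sub_cancel]⟩
  have hfinal := hA.isLead_of_relations hj' hk' hlead' hgen' hu' hyu hx' hy' hyr hXY hXm hss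
    hlead.lt
  obtain ⟨a, b, hab⟩ := hlead.exists_isPresentation
  obtain ⟨a', b', hab'⟩ := hfinal.exists_isPresentation
  exact hab.isIso hab'

theorem IsFrame.exists_hasLead (hA : IsFrame p ν ε z) (hj : IsEnvelope p j)
    (hk : ∀ x : G, (pMap p F)^[k] x = 0) (hr : 0 < r) (h : HasPower p ε z j r)
    (hmax : ∀ r', r < r' → ¬ HasPower p ε z j r') : ∃ s, HasLead p ν ε z j r s := by
  obtain ⟨y, u, hu, hy⟩ := h
  obtain ⟨x, hx⟩ := hA.exists_generates_of_pow hj hk hr hu hy hmax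
  obtain ⟨m, s, c, d, hlead⟩ := hA.exists_isLead hj hk hx hr hu hy hmax
  exact ⟨s, m, c, d, x, y, u, hlead, hx, hu, hy⟩

/-- With `r` maximal, the least `s` is sought over both algebras at once, so whichever attains it
can be compared with the other. -/
theorem IsFrame.isIso (hA : IsFrame p ν ε z) (hj : IsEnvelope p j)
    (hk : ∀ x : G, (pMap p F)^[k] x = 0) (hj' : IsEnvelope p j')
    (hk' : ∀ x : G', (pMap p F)^[k'] x = 0) (hpow : ∃ r, 0 < r ∧ HasPower p ε z j r) :
    IsIso p F G G' := by
  classical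
  obtain ⟨N, hN⟩ := hA.exists_pow
  have hbound : ∀ r, HasPower p ε z j r → r ≤ k := fun r h =>
    (hj.isRep.lt_of_hasPower hk hN hA.ne_zero h).le
  obtain ⟨r₀, hr₀, hpow⟩ := hpow
  obtain ⟨r, hr⟩ : ∃ r, r = Nat.findGreatest (HasPower p ε z j) k := ⟨_, rfl⟩
  have hrpow : HasPower p ε z j r := hr ▸ Nat.findGreatest_spec (hbound r₀ hpow) hpow
  have hr0 : 0 < r := hr₀.trans_le (hr ▸ Nat.le_findGreatest (hbound r₀ hpow) hpow)
  have hmax : ∀ r', r < r' → ¬ HasPower p ε z j r' := fun r' hr' h' =>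
    Nat.findGreatest_is_greatest (hr ▸ hr') (hbound r' h') h'
  have hmax' : ∀ r', r < r' → ¬ HasPower p ε z j' r' := fun r' hr' h' =>
    hmax r' hr' (hA.hasPower hj hk (hr0.trans hr') h')
  have hex : ∃ s, HasLead p ν ε z j r s ∨ HasLead p ν ε z j' r s := by
    obtain ⟨s, hs⟩ := hA.exists_hasLead hj hk hr0 hrpow hmax
    exact ⟨s, Or.inl hs⟩
  rcases Nat.find_spec hex with h | h
  · exact hA.isIso_of_hasLead hj hk hj' hk' hr0 hmax h fun s' h' => Nat.find_min' hex (Or.inr h')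
  · exact (hA.isIso_of_hasLead hj' hk' hj hk hr0 hmax' h
      fun s' h' => Nat.find_min' hex (Or.inl h')).symm

end Noncommutative

/-! ### The abelian case. -/

section Commutative

variable {p : ℕ} [Fact p.Prime] {F : Type u} [Field F] [CharP F p] [PerfectField F]
  {G : Type v} [LieRing G] [LieAlgebra F G] [RestrictedLieAlgebra p F G] [FiniteDimensional F G]
  {G' : Type*} [LieRing G'] [LieAlgebra F G'] [RestrictedLieAlgebra p F G']
  [FiniteDimensional F G'] {A : Type w} [Ring A] [Algebra F A]
  {j : G →ₗ[F] A} {j' : G' →ₗ[F] A} {k k' : ℕ} {x y : G}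

/-- The exponent is visible in `A`: it governs when `a ^ p ^ i` is the scalar `ε a ^ p ^ i` for
every `a`. -/
theorem IsEnvelope.iterate_eq_zero_of_iterate_eq_zero (hj : IsEnvelope p j)
    (hk : ∀ x : G, (pMap p F)^[k] x = 0) (hj' : IsEnvelope p j')
    (hk' : ∀ x : G', (pMap p F)^[k'] x = 0) (hcomm : ∀ a b : A, a * b = b * a) {i : ℕ}
    (h : ∀ x : G, (pMap p F)^[i] x = 0) (x : G') : (pMap p F)^[i] x = 0 := by
  letI : CommRing A := { (inferInstance : Ring A) with mul_comm := hcomm }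
  obtain ⟨ε, hε⟩ := hj.exists_augmentation
  have hnt : Nontrivial A := ε.toRingHom.domain_nontrivial
  have : CharP A p := charP_of_injective_algebraMap (algebraMap F A).injective p
  have hp := (Fact.out : p.Prime)
  have key : ∀ a : A, a ^ p ^ i = algebraMap F A (ε a ^ p ^ i) := by
    intro a
    have ha : a ∈ Algebra.adjoin F (Set.range j) := hj.adjoin_eq_top ▸ Algebra.mem_top
    induction ha using Algebra.adjoin_induction with
    | mem a ha =>
      obtain ⟨g, rfl⟩ := ha
      rw [← hj.isRep.map_iterate, h, map_zero, hε, zero_pow (pow_ne_zero _ hp.ne_zero), map_zero]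
    | algebraMap r => rw [AlgHom.commutes, map_pow]; rfl
    | add a b _ _ ha hb => rw [add_pow_char_pow, ha, hb, map_add, add_pow_char_pow, map_add]
    | mul a b _ _ ha hb => rw [mul_pow, ha, hb, map_mul, mul_pow, map_mul]
  refine hj'.injective hk' ?_
  rw [map_zero, hj'.isRep.map_iterate, key, hj'.isRep.map_eq_zero hk' ε,
    zero_pow (pow_ne_zero _ hp.ne_zero), map_zero]

/-- Two invariants suffice: the exponent gives the longer cyclic summand, and the dimension then
gives the other. -/
theorem isIso_of_lie_eq_zero (hj : IsEnvelope p j) (hk : ∀ x : G, (pMap p F)^[k] x = 0)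
    (hj' : IsEnvelope p j') (hk' : ∀ x : G', (pMap p F)^[k'] x = 0)
    (hxy : orbit p F x ⊔ orbit p F y = ⊤) (hab : ∀ x y : G, ⁅x, y⁆ = 0) : IsIso p F G G' := by
  have hcomm := hj.mul_comm hab
  obtain ⟨ε, hε⟩ := hj.exists_augmentation
  have hnt : Nontrivial A := ε.toRingHom.domain_nontrivial
  have hε' : ∀ x, ε (j' x) = 0 := hj'.isRep.map_eq_zero hk' ε
  have hab' : ∀ x y : G', ⁅x, y⁆ = 0 := fun x y => hj'.injective hk' (by
    rw [hj'.isRep.1, hcomm, sub_self, map_zero])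
  have hgen : Generates ε j x y := by
    have hmem : ∀ (w g : G), w ∈ orbit p F (pMap p F g) → j w ∈ aug ε ^ 2 := by
      intro w g hw
      obtain ⟨v, hv, hjv⟩ := hj.isRep.exists_map_eq_mul_aug hε hw
      rw [hjv]
      exact mem_aug_sq_of_mem (hε g) hv
    intro g
    have hg : g ∈ orbit p F x ⊔ orbit p F y := hxy ▸ Submodule.mem_top
    obtain ⟨a, ha, b, hb, rfl⟩ := Submodule.mem_sup.1 hg
    obtain ⟨c, hc⟩ := exists_sub_smul_mem_orbit ha
    obtain ⟨d, hd⟩ := exists_sub_smul_mem_orbit hb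
    refine ⟨c, d, ?_⟩
    rw [← map_sub, add_sub_add_comm, map_add]
    exact add_mem (hmem _ _ hc) (hmem _ _ hd)
  obtain ⟨x', hx'⟩ := exists_sub_map_mem hj'.adjoin_eq_top hε' (hε x)
  obtain ⟨y', hy'⟩ := exists_sub_map_mem hj'.adjoin_eq_top hε' (hε y)
  have hgen' : Generates ε j' x' y' :=
    generates_of_aug_le hε' (hgen.aug_le hj.adjoin_eq_top hε) hx' hy'
  have hxy' : orbit p F x' ⊔ orbit p F y' = ⊤ := by
    let K : LieSubalgebra F G' :=
      { orbit p F x' ⊔ orbit p F y' with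
        lie_mem' := fun {a b} _ _ => by
          rw [AddSubsemigroup.mem_carrier, hab']; exact zero_mem (orbit p F x' ⊔ orbit p F y') }
    have hK : ∀ g, g ∈ K ↔ g ∈ orbit p F x' ⊔ orbit p F y' := fun _ => Iff.rfl
    have htop := hj'.eq_top_of_generates hk' (ε := ε) K (fun g hg => by
      obtain ⟨a, ha, b, hb, rfl⟩ := Submodule.mem_sup.1 ((hK g).1 hg)
      rw [hK]
      have := iterate_add_of_lie_eq_zero (p := p) (F := F) (hab' a b) 1
      change pMap p F (a + b) = pMap p F a + pMap p F b at this
      rw [this]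
      exact Submodule.add_mem_sup (iterate_mem_orbit_of_mem ha 1) (iterate_mem_orbit_of_mem hb 1))
      fun g => by
        obtain ⟨c, d, hcd⟩ := hgen' g
        exact ⟨c • x' + d • y', Submodule.add_mem_sup (Submodule.smul_mem _ c (mem_orbit_self _))
          (Submodule.smul_mem _ d (mem_orbit_self _)), hcd⟩
    rw [eq_top_iff]
    exact fun g _ => (hK g).1 (htop ▸ LieSubalgebra.mem_top g)
  obtain ⟨a, b, m, n, hpres, hm⟩ := exists_isPresentation_of_abelian hab hk hxy
  obtain ⟨a', b', m', n', hpres', hm'⟩ := exists_isPresentation_of_abelian hab' hk' hxy'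
  obtain rfl : m = m' := le_antisymm
    ((hm m').1 (hj'.iterate_eq_zero_of_iterate_eq_zero hk' hj hk hcomm ((hm' m').2 le_rfl)))
    ((hm' m).1 (hj.iterate_eq_zero_of_iterate_eq_zero hk hj' hk' hcomm ((hm m).2 le_rfl)))
  obtain rfl : n = n' := by
    have h1 := (hj.finrank_eq hk).2.symm.trans (hj'.finrank_eq hk').2
    have h2 := Nat.pow_right_injective (Fact.out : p.Prime).two_le h1
    rw [hpres.finrank_eq, hpres'.finrank_eq] at h2
    exact Nat.add_left_cancel h2
  exact hpres.isIso hpres'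

end Commutative

/-! ### Structure of metacyclic algebras and conclusion. -/

section Main

variable {p : ℕ} [Fact p.Prime] {F : Type u} [Field F] [CharP F p] {G : Type v} [LieRing G]
  [LieAlgebra F G] [RestrictedLieAlgebra p F G]

theorem closure_singleton_eq_orbit (y : G) : (closure p F {y}).toSubmodule = orbit p F y := by
  let K : LieSubalgebra F G :=
    { orbit p F y with
      lie_mem' := fun {a b} ha hb => by
        rw [AddSubsemigroup.mem_carrier] at *
        have : ⁅a, b⁆ = 0 := lie_orbit_self ha hb
        rw [this]; exact zero_mem (orbit p F y) }
  refine le_antisymm (closure_le (K := K) (Set.singleton_subset_iff.2 (mem_orbit_self y))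
    fun u hu => iterate_mem_orbit_of_mem (y := y) hu 1) (orbit_le.2 fun i => ?_)
  induction i with
  | zero => exact subset_closure _ rfl
  | succ i ih =>
    rw [Function.iterate_succ_apply']
    exact pMap_mem_closure ih

/-- Write `⁅x, y⁆` as `c • y` plus an element of the orbit of `y^[p]`. That orbit commutes with `x`,
so `ad x` multiplies `⁅x, y⁆` by `c`; as `ad x` is nilpotent, `c = 0` or `⁅x, y⁆ = 0`. -/
theorem IsMetacyclic.exists_orbit (h : IsMetacyclic p F G) {k : ℕ}
    (hk : ∀ x : G, (pMap p F)^[k] x = 0) :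
    ∃ x y : G, orbit p F x ⊔ orbit p F y = ⊤ ∧ ⁅x, y⁆ ∈ orbit p F (pMap p F y) := by
  obtain ⟨I, hI, ⟨y, hy⟩, hcyc⟩ := h
  letI := quotient I hI
  obtain ⟨q, hq⟩ := hcyc
  obtain ⟨x, rfl⟩ := LieSubmodule.Quotient.surjective_mk' _ q
  have hIy : ∀ g, g ∈ I ↔ g ∈ orbit p F y := fun g => by
    rw [← closure_singleton_eq_orbit, hy]; rfl
  have hxy : ⁅x, y⁆ ∈ orbit p F y :=
    (hIy _).1 (lie_mem_right F G I x y ((hIy y).2 (mem_orbit_self y)))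
  refine ⟨x, y, eq_top_iff.2 fun g _ => ?_, ?_⟩
  · have hg : (LieSubmodule.Quotient.mk g : G ⧸ I) ∈ orbit p F (LieSubmodule.Quotient.mk' I x) := by
      rw [← closure_singleton_eq_orbit, hq]; trivial
    have hle : orbit p F (LieSubmodule.Quotient.mk' I x) ≤ (orbit p F x).map
        (LieSubmodule.Quotient.mk' I : G →ₗ[F] G ⧸ I) := orbit_le.2 fun i =>
      ⟨_, iterate_mem_orbit x i, (quotient_pMap_mk I hI i x).symm⟩
    obtain ⟨w, hw, hwg⟩ := hle hg
    have : g - w ∈ I := LieSubmodule.Quotient.mk_eq_zero'.1 (sub_eq_zero.2 hwg.symm)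
    rw [← add_sub_cancel w g]
    exact Submodule.add_mem_sup hw ((hIy _).1 this)
  · obtain ⟨c, hc⟩ := exists_sub_smul_mem_orbit hxy
    have h1 : ⁅x, pMap p F y⁆ = 0 := by
      rw [← lie_skew, neg_eq_zero]
      refine lie_pMap_eq_zero_of_lie_lie ?_
      rw [← lie_skew y x, lie_neg, neg_eq_zero]
      exact lie_orbit_self (mem_orbit_self y) hxy
    have h2 : ⁅x, ⁅x, y⁆⁆ = c • ⁅x, y⁆ := by
      have := lie_eq_zero_of_mem_orbit h1 (mem_orbit_self x) hc
      rwa [lie_sub, lie_smul, sub_eq_zero] at this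
    have h3 : ∀ i, (LieAlgebra.ad F G x ^ i) ⁅x, y⁆ = c ^ i • ⁅x, y⁆ := by
      intro i
      induction i with
      | zero => simp
      | succ i ih =>
        rw [pow_succ', Module.End.mul_apply, ih, map_smul, LieAlgebra.ad_apply, h2, smul_smul,
          pow_succ]
    have h4 : ∀ i, LieAlgebra.ad F G x ^ p ^ i = LieAlgebra.ad F G ((pMap p F)^[i] x) := by
      intro i
      induction i with
      | zero => rw [pow_zero, pow_one]; rfl
      | succ i ih => rw [pow_succ, pow_mul, ih, ad_pMap, Function.iterate_succ_apply']
    have h5 := h3 (p ^ k)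
    rw [h4, hk, map_zero, LinearMap.zero_apply, eq_comm, smul_eq_zero] at h5
    rcases h5 with h5 | h5
    · rw [eq_zero_of_pow_eq_zero h5, zero_smul, sub_zero] at hc
      exact hc
    · rw [h5]; exact zero_mem _

end Main

/-- A finite-dimensional `p`-nilpotent metacyclic restricted Lie algebra over a perfect field is
determined by its restricted enveloping algebra. -/
theorem isIso_of_algEquiv_envelopingAlgebra {p : ℕ} [Fact p.Prime] {F : Type u} [Field F]
    [CharP F p] [PerfectField F] {L : Type v} [LieRing L] [LieAlgebra F L]
    [RestrictedLieAlgebra p F L] (hfin : FiniteDimensional F L) (hnil : IsPNilpotent p F L)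
    (hmeta : IsMetacyclic p F L) {H : Type w} [LieRing H] [LieAlgebra F H]
    [RestrictedLieAlgebra p F H] (e : EnvelopingAlgebra p F L ≃ₐ[F] EnvelopingAlgebra p F H) :
    IsIso p F L H := by
  obtain ⟨k, -, hk⟩ := hnil
  have hp := (Fact.out : p.Prime)
  have hj : IsEnvelope p (envι p F L) := isEnvelope_envι
  have hj' : IsEnvelope p (e.symm.toLinearMap ∘ₗ envι p F H) := isEnvelope_envι.trans e.symm
  have hfinA : Module.Finite F (EnvelopingAlgebra p F L) := (hj.finrank_eq hk).1
  have hfinB : Module.Finite F (EnvelopingAlgebra p F H) := Module.Finite.equiv e.toLinearEquiv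
  obtain ⟨ε, hε⟩ := hj'.exists_augmentation
  obtain ⟨n, hn⟩ := exists_aug_pow_eq_bot hj.isRep hj.adjoin_eq_top hk ε
  -- `ε` was chosen to kill `H`; its kernel is nilpotent because `L` is p-nilpotent, so the elements
  -- of `H` become nilpotent, with exponent `n ≤ p ^ n`.
  have hpow : ∀ x : H, envι p F H x ^ p ^ n = 0 := by
    intro x
    have h1 : e.symm (envι p F H x) ^ n = 0 := isNilpotent_of_mem_aug hn (hε x)
    have h2 : e.symm (envι p F H x) ^ p ^ n = 0 :=
      pow_eq_zero_of_le (Nat.lt_pow_self hp.one_lt).le h1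
    rwa [← map_pow, EmbeddingLike.map_eq_zero_iff] at h2
  have hinj := envι_injective_of_isNilpotent hpow
  have hfinH : FiniteDimensional F H := Module.Finite.of_injective _ hinj
  have hk' : ∀ x : H, (pMap p F)^[n] x = 0 := fun x => hinj (by
    rw [(isRep_envι p F).map_iterate, hpow, map_zero])
  obtain ⟨x, y, hxy, hmem⟩ := hmeta.exists_orbit hk
  by_cases hne : ⁅x, y⁆ = 0
  · refine isIso_of_lie_eq_zero hj hk hj' hk' hxy fun a b => ?_
    have := lie_mem_of_central hxy (lie_iterate_eq_zero_of_lie_mem hmem)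
      (W := ⊥) ((Submodule.mem_bot F).2 hne) a b
    exact (Submodule.mem_bot F).1 this
  · exact (hj.isFrame hk hxy hmem hne ε).isIso hj hk hj' hk' (hj.exists_hasPower hk hmem hne ε)

end RestrictedLieAlgebra

theorem mainTheorem8 (p : ℕ) [Fact p.Prime] (F : Type u) [Field F] [CharP F p] [PerfectField F]
    (L : Type v) [LieRing L] [LieAlgebra F L] [RestrictedLieAlgebra p F L]
    (hfin : FiniteDimensional F L)
    (hnil : RestrictedLieAlgebra.IsPNilpotent p F L)
    (hmeta : RestrictedLieAlgebra.IsMetacyclic p F L)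
    (H : Type w) [LieRing H] [LieAlgebra F H] [RestrictedLieAlgebra p F H]
    (hiso : Nonempty (RestrictedLieAlgebra.EnvelopingAlgebra p F L ≃ₐ[F]
      RestrictedLieAlgebra.EnvelopingAlgebra p F H)) :
    RestrictedLieAlgebra.IsIso p F L H := by
  obtain ⟨e⟩ := hiso
  exact RestrictedLieAlgebra.isIso_of_algEquiv_envelopingAlgebra hfin hnil hmeta e
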